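/- **Theorem.** Let $0<|q|<1$, $\tau=q^{-1}$, let $L$ be a value of $\log q$, let $0\le n<l$ be integers and $N=n+l$. Functions of $z_1,\dots,z_N$ are regarded as functions of $\log z_1,\dots,\log z_N$; replacing $z_j$ by $z_j\tau^{\pm4}$ means replacing $\log z_j$ by $\log z_j\mp 4L$. *Kernel.* Put $(z;p)_\infty=\prod_{k\ge0}(1-zp^k)$ and $\psi(z)=\dfrac1{(zq;q^4)_\infty\,(z^{-1}q;q^4)_\infty}$. Let $\vartheta(x_1,\dots,x_n|z_1,\dots,z_N)$ be any function that is antisymmetric and holomorphic in $x_\mu\in\mathbb C\setminus\{0\}$, symmetric and meromorphic in $\log z_j\in\mathbb C$, and satisfies $$\vartheta(x|\dots,z_j\tau^4,\dots)=\vartheta(x|z)\prod_{\mu=1}^n\frac{-z_j\tau}{x_\mu},\qquad \vartheta(\dots,x_\mu\tau^4,\dots|z)=\vartheta(x|z)\prod_{j=1}^N\frac{-x_\mu\tau}{z_j}.$$ Put $\Psi(x|z)=\vartheta(x|z)\prod_{\mu=1}^n\prod_{j=1}^N\psi(x_\mu/z_j)$. *Rational function.* Let $\sigma_\kappa,\tilde\sigma_\kappa$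 be given by $\prod_{j=1}^m(t-a_j)=\sum_\kappa(-1)^\kappa\sigma_\kappa(a_1,\dots,a_m)t^{m-\kappa}$ and $\prod_{j=1}^m(t-a_j)^{-1}=\sum_{\kappa\ge0}\tilde\sigma_\kappa(a_1,\dots,a_m)t^{-m-\kappa}$. For $a=(a_1,\dots,a_n)$, $b=(b_1,\dots,b_l)$ and $\lambda\ge1$ put $$\varphi_{\lambda\kappa}(a|b)=\sigma_\kappa(b)-\sum_{\lambda\le\alpha\le\beta\le\kappa}(-1)^{\beta-\alpha}\tau^{2\beta}\sigma_{\kappa-\beta}(b)\,\sigma_\alpha(a)\,\tilde\sigma_{\beta-\alpha}(a),$$ $$f_\lambda(x|a|b)=\sum_{\kappa=0}^{l-n+\lambda-2}\bigl(1-\tau^{2(l-n+\lambda-1-\kappa)}\bigr)(-\tau)^\kappa\varphi_{\lambda\kappa}(a|b)\,x^{l-n+\lambda-2-\kappa},$$ $$g_\lambda(x|a)=\sum_{\kappa=0}^{\lambda-2}\bigl(1-\tau^{2(\lambda-1-\kappa)}\bigr)(-\tau)^\kappa\sigma_\kappa(a)\,x^{\lambda-2-\kappa},$$ $$A_\lambda(x|a|b)=\prod_{j=1}^n(x-a_j\tau)\,f_\lambda(x|a|b)+\tau^{2(l-n+\lambda-1)}\prod_{i=1}^l(x-b_i\tau^{-1})\,g_\lambda(x|a),$$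 $$\Delta(x|a|b)=\det\bigl(A_\lambda(x_\mu|a|b)\bigr)_{1\le\lambda,\mu\le n},\qquad F(x|z)=\frac{\Delta(x|z_1,\dots,z_n|z_{n+1},\dots,z_N)}{\prod_{j=1}^n\prod_{i=n+1}^N(z_i-z_j\tau^2)}.$$ *Integral.* Let $D$ be the set of all $(\log z_1,\dots,\log z_N)\in\mathbb C^N$ at which $\vartheta$ has no pole and $z_i\ne z_j\tau^{2+4k}$ for all $i,j$ and all $k\ge0$. On $D$ put $$H(z_1,\dots,z_n|z_{n+1},\dots,z_N)=\prod_{\mu=1}^n\oint_C dx_\mu\;F(x_1,\dots,x_n|z_1,\dots,z_N)\,\Psi(x_1,\dots,x_n|z_1,\dots,z_N),$$ where $C$ is an anti-clockwise simple closed (piecewise $C^1$) curve in $\mathbb C\setminus\{0\}$ that encircles the points $z_j\tau^{-1-4k}$ but not the points $z_j\tau^{1+4k}$ ($1\le j\le N$, $k\ge0$). Then $H$ does not depend on the choice of $C$, is holomorphic on $D$ as a function of the $\log z_j$, is symmetric in $(z_1,\dots,z_n)$ and in $(z_{n+1},\dots,z_N)$ separately, and satisfies, with $\delta_+=\tau^{-n}$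 and $\delta_-=\tau^{-l}$, the reduced deformed cyclicity equations $$\delta_+^{-1}H(z_2,\dots,z_{n+1}|z_{n+2},\dots,z_N,z_1\tau^4)=\prod_{j=2}^{n+1}\frac{z_1-z_j\tau^2}{(z_1-z_j)\tau}\,H(z_2,\dots,z_{n+1}|z_{n+2},\dots,z_N,z_1)$$ $$\qquad-\sum_{j=2}^{n+1}\frac{(1-\tau^2)z_1}{(z_1-z_j)\tau}\prod_{\substack{k=2\\k\ne j}}^{n+1}\frac{z_j-z_k\tau^2}{(z_j-z_k)\tau}\,H(z_1,\dots,\widehat{z_j},\dots,z_{n+1}|z_j,z_{n+2},\dots,z_N)$$ and, if $n\ge1$, $$\delta_-\tau^{-2}H(z_1\tau^{-4},z_2,\dots,z_n|z_{n+1},\dots,z_N)=\prod_{j=n+1}^{N}\frac{z_1-z_j\tau^{-2}}{(z_1-z_j)\tau^{-1}}\,H(z_1,\dots,z_n|z_{n+1},\dots,z_N)$$ $$\qquad-\sum_{j=n+1}^{N}\frac{(1-\tau^{-2})z_j}{(z_1-z_j)\tau^{-1}}\prod_{\substack{k=n+1\\k\ne j}}^{N}\frac{z_j-z_k\tau^{-2}}{(z_j-z_k)\tau^{-1}}\,H(z_2,\dots,z_n,z_j|z_1,z_{n+1},\dots,\widehat{z_j},\dots,z_N),$$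 whenever the arguments of $H$ on both sides lie in $D$ and the denominators of the coefficients do not vanish. -/

import Mathlib

namespace SmirnovIntegral

open scoped BigOperators Topology

noncomputable section

/-! ### The polynomials entering the integrand -/

/-- The elementary symmetric polynomial `σ_κ(a)`, so that
`∏ (t - a_j) = ∑_κ (-1)^κ σ_κ(a) t^(m-κ)`. -/
def sigma {m : ℕ} (κ : ℕ) (a : Fin m → ℂ) : ℂ :=
  ∑ s ∈ Finset.powersetCard κ (Finset.univ : Finset (Fin m)), ∏ j ∈ s, a j

/-- The polynomial `σ̃_κ(a)`, defined by `∏ (t - a_j)⁻¹ = ∑_κ σ̃_κ(a) t^(-m-κ)`; with `T = t⁻¹`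
it is the coefficient of `T^κ` in `∏ (1 - a_j T)⁻¹`. -/
def sigmaTilde {m : ℕ} (κ : ℕ) (a : Fin m → ℂ) : ℂ :=
  PowerSeries.coeff κ (∏ j, (1 - PowerSeries.C (a j) * PowerSeries.X : PowerSeries ℂ)⁻¹)

/-- `φ_{λκ}^{(nl)}(a | b)`. -/
def phi (τ : ℂ) {n l : ℕ} (lam κ : ℕ) (a : Fin n → ℂ) (b : Fin l → ℂ) : ℂ :=
  sigma κ b -
    ∑ α ∈ Finset.Icc lam κ, ∑ β ∈ Finset.Icc α κ,
      (-1) ^ (β - α) * τ ^ (2 * β) * sigma (κ - β) b * sigma α a * sigmaTilde (β - α) a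

/-- `f_λ^{(nl)}(x | a | b)`, for `n < l` and `1 ≤ λ` (so that no subtraction is truncated). -/
def fPoly (τ : ℂ) {n l : ℕ} (lam : ℕ) (x : ℂ) (a : Fin n → ℂ) (b : Fin l → ℂ) : ℂ :=
  ∑ κ ∈ Finset.range (l - n + lam - 1),
    (1 - τ ^ (2 * (l - n + lam - 1 - κ))) * (-τ) ^ κ * phi τ lam κ a b *
      x ^ (l - n + lam - 2 - κ)

/-- `g_λ^{(n)}(x | a)`, for `1 ≤ λ`. -/
def gPoly (τ : ℂ) {n : ℕ} (lam : ℕ) (x : ℂ) (a : Fin n → ℂ) : ℂ :=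
  ∑ κ ∈ Finset.range (lam - 1),
    (1 - τ ^ (2 * (lam - 1 - κ))) * (-τ) ^ κ * sigma κ a * x ^ (lam - 2 - κ)

/-- `A_λ^{(nl)}(x | a | b)`, for `n < l` and `1 ≤ λ`. -/
def APoly (τ : ℂ) {n l : ℕ} (lam : ℕ) (x : ℂ) (a : Fin n → ℂ) (b : Fin l → ℂ) : ℂ :=
  (∏ j, (x - a j * τ)) * fPoly τ lam x a b +
    τ ^ (2 * (l - n + lam - 1)) * (∏ i, (x - b i * τ⁻¹)) * gPoly τ lam x a

/-- `Δ^{(nl)}(x | a | b) = det (A_λ^{(nl)}(x_μ | a | b))` with `1 ≤ λ, μ ≤ n`. -/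
def Delta (τ : ℂ) {n l : ℕ} (x : Fin n → ℂ) (a : Fin n → ℂ) (b : Fin l → ℂ) : ℂ :=
  Matrix.det (Matrix.of fun lam μ : Fin n => APoly τ ((lam : ℕ) + 1) (x μ) a b)

/-- The rational function `F`. The `N = n + l` variables `z` are indexed by `Fin n ⊕ Fin l`:
the left summand carries `z_1, …, z_n`, the right one `z_{n+1}, …, z_N`. -/
def FRat (τ : ℂ) {n l : ℕ} (x : Fin n → ℂ) (z : Fin n ⊕ Fin l → ℂ) : ℂ :=
  Delta τ x (fun j => z (Sum.inl j)) (fun i => z (Sum.inr i)) /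
    ∏ j : Fin n, ∏ i : Fin l, (z (Sum.inr i) - z (Sum.inl j) * τ ^ 2)

/-! ### The kernel -/

/-- `(z; p)_∞ = ∏_{k ≥ 0} (1 - z p^k)`, used for `|p| < 1`. -/
def qPoch (z p : ℂ) : ℂ := ∏' k : ℕ, (1 - z * p ^ k)

/-- `ψ(z) = 1 / ((zq; q⁴)_∞ (z⁻¹q; q⁴)_∞)`. -/
def psi (q z : ℂ) : ℂ := 1 / (qPoch (z * q) (q ^ 4) * qPoch (z⁻¹ * q) (q ^ 4))

/-- The multiplicative spectral parameters `z_j = exp u_j`. Functions which are "meromorphic in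
`log z_j`" are functions of the `u_j = log z_j`. -/
def zOf {ι : Type*} (u : ι → ℂ) : ι → ℂ := fun j => Complex.exp (u j)

/-- The set of those `u = log z` near which `ϑ` is jointly holomorphic, for all `x` in
`(ℂ ∖ {0})^n`, i.e. the complement of the polar set of `ϑ`. -/
def regularSet {n : ℕ} {ι : Type*} [Fintype ι] (θ : (Fin n → ℂ) → (ι → ℂ) → ℂ) :
    Set (ι → ℂ) :=
  {u | ∃ W ∈ 𝓝 u, AnalyticOnNhd ℂ (fun p : (Fin n → ℂ) × (ι → ℂ) => θ p.1 p.2)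
    ({x : Fin n → ℂ | ∀ μ, x μ ≠ 0} ×ˢ W)}

/-- The admissible functions `ϑ(x | z)`, regarded as functions of `x` and `u = log z`. Here
`L` is a chosen value of `log q`, and `z_j ↦ z_j τ⁴` means `u_j ↦ u_j - 4 L`.
A function which is meromorphic in `u` is represented by a total function; giving it the
value `0` at its poles, its symmetry and quasi-periodicity hold for every `u`. -/
structure IsTheta (q L : ℂ) {n : ℕ} {ι : Type*} [Fintype ι] [DecidableEq ι]
    (θ : (Fin n → ℂ) → (ι → ℂ) → ℂ) : Prop where
  /-- holomorphic in the `x_μ ∈ ℂ ∖ {0}` and meromorphic in the `u_j ∈ ℂ`: locally in `u` it is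
  a quotient `φ(x, u) / d(u)` of holomorphic functions, where `d` does not vanish
  identically -/
  meromorphic : ∀ u₀ : ι → ℂ, ∃ W ∈ 𝓝 u₀, ∃ (d : (ι → ℂ) → ℂ) (φ : (Fin n → ℂ) → (ι → ℂ) → ℂ),
    AnalyticOnNhd ℂ d W ∧ (∃ᶠ u in 𝓝 u₀, d u ≠ 0) ∧
    AnalyticOnNhd ℂ (fun p : (Fin n → ℂ) × (ι → ℂ) => φ p.1 p.2)
      ({x : Fin n → ℂ | ∀ μ, x μ ≠ 0} ×ˢ W) ∧
    ∀ u ∈ W, d u ≠ 0 → ∀ x : Fin n → ℂ, (∀ μ, x μ ≠ 0) → θ x u = φ x u / d u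
  antisymm : ∀ (σ : Equiv.Perm (Fin n)) (x : Fin n → ℂ) (u : ι → ℂ), (∀ μ, x μ ≠ 0) →
    θ (x ∘ σ) u = ((Equiv.Perm.sign σ : ℤ) : ℂ) * θ x u
  symm : ∀ (σ : Equiv.Perm ι) (x : Fin n → ℂ) (u : ι → ℂ), (∀ μ, x μ ≠ 0) →
    θ x (u ∘ σ) = θ x u
  shift_z : ∀ (j : ι) (x : Fin n → ℂ) (u : ι → ℂ), (∀ μ, x μ ≠ 0) →
    θ x (Function.update u j (u j - 4 * L)) =
      θ x u * ∏ μ, (-(zOf u j) * q⁻¹ / x μ)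
  shift_x : ∀ (μ : Fin n) (x : Fin n → ℂ) (u : ι → ℂ), (∀ ν, x ν ≠ 0) →
    θ (Function.update x μ (x μ * q⁻¹ ^ 4)) u =
      θ x u * ∏ j, (-(x μ) * q⁻¹ / zOf u j)

/-- The kernel `Ψ(x | z) = ϑ(x | z) ∏_μ ∏_j ψ(x_μ / z_j)`. -/
def Psi (q : ℂ) {n : ℕ} {ι : Type*} [Fintype ι] (θ : (Fin n → ℂ) → (ι → ℂ) → ℂ)
    (x : Fin n → ℂ) (u : ι → ℂ) : ℂ :=
  θ x u * ∏ μ, ∏ j, psi q (x μ / zOf u j)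

/-! ### The contour and the integral -/

/-- The closed curve `γ : [0,1] → ℂ` avoids `p` and winds `m` times around it. -/
def Winds (γ : ℝ → ℂ) (p : ℂ) (m : ℤ) : Prop :=
  (∀ t ∈ Set.Icc (0 : ℝ) 1, γ t ≠ p) ∧
    ∫ t in (0 : ℝ)..1, deriv γ t / (γ t - p) = 2 * Real.pi * Complex.I * m

/-- `γ : [0,1] → ℂ ∖ {0}` is an anti-clockwise, piecewise continuously differentiable, simple
closed curve which encircles the points `z_j τ^(-1-4k)` but not the points `z_j τ^(1+4k)`
(`k ≥ 0`), where `τ = q⁻¹`. -/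
structure IsContour (q : ℂ) {ι : Type*} (z : ι → ℂ) (γ : ℝ → ℂ) : Prop where
  continuousOn : ContinuousOn γ (Set.Icc 0 1)
  piecewise : ∃ S : Finset ℝ, ∀ t ∈ Set.Ioo (0 : ℝ) 1, t ∉ S → ContDiffAt ℝ 1 γ t
  integrable : IntervalIntegrable (deriv γ) MeasureTheory.volume 0 1
  closed : γ 0 = γ 1
  simple : Set.InjOn γ (Set.Ico 0 1)
  ne_zero : ∀ t ∈ Set.Icc (0 : ℝ) 1, γ t ≠ 0
  encircles : ∀ (j : ι) (k : ℕ), Winds γ (z j * q ^ (1 + 4 * k)) 1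
  excludes : ∀ (j : ι) (k : ℕ), Winds γ (z j * q⁻¹ ^ (1 + 4 * k)) 0

/-- The `n`-fold integral `∏_μ ∮_γ dx_μ f(x_1, …, x_n)`. -/
def multiContourIntegral {n : ℕ} (γ : ℝ → ℂ) (f : (Fin n → ℂ) → ℂ) : ℂ :=
  ∫ t in Set.Icc (0 : Fin n → ℝ) 1, (∏ μ, deriv γ (t μ)) * f (fun μ => γ (t μ))

/-- `∏_μ ∮_γ dx_μ F(x | z) Ψ(x | z)` at `z = exp u`. -/
def smirnovIntegral (q : ℂ) {n l : ℕ} (θ : (Fin n → ℂ) → (Fin n ⊕ Fin l → ℂ) → ℂ)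
    (γ : ℝ → ℂ) (u : Fin n ⊕ Fin l → ℂ) : ℂ :=
  multiContourIntegral γ fun x => FRat q⁻¹ x (zOf u) * Psi q θ x u

/-- The set of those `u = log z` at which `ϑ` has no pole and no point `z_i τ^(-1-4k)` coincides
with a point `z_j τ^(1+4m)`, i.e. at which the integral makes sense. -/
def domain (q : ℂ) {n l : ℕ} (θ : (Fin n → ℂ) → (Fin n ⊕ Fin l → ℂ) → ℂ) :
    Set (Fin n ⊕ Fin l → ℂ) :=
  {u | u ∈ regularSet θ ∧
    ∀ (s t : Fin n ⊕ Fin l) (k : ℕ), zOf u s ≠ zOf u t * q⁻¹ ^ (2 + 4 * k)}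

/-! ### The reduced deformed cyclicity equations

In both equations `H` is a function of `u = log z`, symmetric in the variables of the left group
and in those of the right group. -/

/-- First equation. The arguments `(z_2, …, z_{n+1} | z_{n+2}, …, z_N, z_1)` of `H` are
written as `z`, with `z_1 = z (inr i)`; exchanging `z_1` with `z_j` in the
left group gives the arguments `(z_1, …, ẑ_j, …, z_{n+1} | z_j, z_{n+2}, …, z_N)`. The two
conditions on `z` say that the denominators of the coefficients do not vanish. -/
def EquationB (τ L δ : ℂ) {n l : ℕ} (D : Set (Fin n ⊕ Fin l → ℂ))
    (H : (Fin n ⊕ Fin l → ℂ) → ℂ) : Prop :=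
  ∀ (u : Fin n ⊕ Fin l → ℂ) (i : Fin l), u ∈ D →
    Function.update u (Sum.inr i) (u (Sum.inr i) - 4 * L) ∈ D →
    (∀ j : Fin n, zOf u (Sum.inr i) ≠ zOf u (Sum.inl j)) →
    (Function.Injective fun j : Fin n => zOf u (Sum.inl j)) →
    δ⁻¹ * H (Function.update u (Sum.inr i) (u (Sum.inr i) - 4 * L)) =
      (∏ j : Fin n, (zOf u (Sum.inr i) - zOf u (Sum.inl j) * τ ^ 2) /
          ((zOf u (Sum.inr i) - zOf u (Sum.inl j)) * τ)) * H u -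
      ∑ j : Fin n, (1 - τ ^ 2) * zOf u (Sum.inr i) /
          ((zOf u (Sum.inr i) - zOf u (Sum.inl j)) * τ) *
        (∏ k ∈ Finset.univ.erase j, (zOf u (Sum.inl j) - zOf u (Sum.inl k) * τ ^ 2) /
          ((zOf u (Sum.inl j) - zOf u (Sum.inl k)) * τ)) *
        H (u ∘ Equiv.swap (Sum.inr i) (Sum.inl j))

/-- Second equation. The arguments `(z_1, …, z_n | z_{n+1}, …, z_N)` of `H` are written as `z`,
with `z_1 = z (inl i)`; exchanging `z_1` with `z_j` in the right group gives the
arguments `(z_2, …, z_n, z_j | z_1, z_{n+1}, …, ẑ_j, …, z_N)`. The equation is empty for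
`n = 0`. -/
def EquationC (τ L δ : ℂ) {n l : ℕ} (D : Set (Fin n ⊕ Fin l → ℂ))
    (H : (Fin n ⊕ Fin l → ℂ) → ℂ) : Prop :=
  ∀ (u : Fin n ⊕ Fin l → ℂ) (i : Fin n), u ∈ D →
    Function.update u (Sum.inl i) (u (Sum.inl i) + 4 * L) ∈ D →
    (∀ j : Fin l, zOf u (Sum.inl i) ≠ zOf u (Sum.inr j)) →
    (Function.Injective fun j : Fin l => zOf u (Sum.inr j)) →
    δ * τ⁻¹ ^ 2 * H (Function.update u (Sum.inl i) (u (Sum.inl i) + 4 * L)) =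
      (∏ j : Fin l, (zOf u (Sum.inl i) - zOf u (Sum.inr j) * τ⁻¹ ^ 2) /
          ((zOf u (Sum.inl i) - zOf u (Sum.inr j)) * τ⁻¹)) * H u -
      ∑ j : Fin l, (1 - τ⁻¹ ^ 2) * zOf u (Sum.inr j) /
          ((zOf u (Sum.inl i) - zOf u (Sum.inr j)) * τ⁻¹) *
        (∏ k ∈ Finset.univ.erase j, (zOf u (Sum.inr j) - zOf u (Sum.inr k) * τ⁻¹ ^ 2) /
          ((zOf u (Sum.inr j) - zOf u (Sum.inr k)) * τ⁻¹)) *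
        H (u ∘ Equiv.swap (Sum.inl i) (Sum.inr j))

end

end SmirnovIntegral

/-! Write σ = τ², A = ∏(x − z_jτ) over the left group and B = ∏(x − z_iτ⁻¹) over the right group.
Everything rests on the alternating form J(P_1, …, P_n) = ∮ det(P_λ(x_μ)) Ψ dx on polynomials
(`thetaForm`). The difference equations of ψ and ϑ give two facts. J vanishes as soon as one
argument is a total difference A·(Br)(σ⁻¹x) − B·(Ar)(σx), divided by x (`thetaForm_killsExact`). And
replacing z_j by z_jτ⁴ turns J into J' with J'((x − z_jτ³)G) = J((x − z_jτ)G) (`thetaForm_shift`).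
Both follow from moving contours without crossing poles, that is, from the homology form of Cauchy's
theorem (`Cycle.int_eq_of_agree`, `Good.int_eq`).

The rows of Δ are, up to powers of τ, of the form A·(Q(σ⁻¹x) − Q(x))/x − B·(T(σx) − T(x))/x with T
monic of degree λ − 1 and deg(BT − AQ) ≤ n (`APoly_eq`, `natDegree_headPoly_phiPoly`). The degree
bound determines Q up to a constant, which the difference quotient kills, so such a row depends on T
alone; for T = Ar it is exact. Hence J of these rows is an alternating n-form in T on the
n-dimensional space ℂ[x]/(A). It is determined by a single number `baseVal`, and multiplying all T
by D multiplies it by ∏D(α_j) over the roots α_j of A (`altMap_mul`). Thus H is an explicit factor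
times `baseVal`, and convenient representatives T may replace the given ones.

For the first equation, single out a right variable y and put M = A·(x − yτ), D = B/(x − yτ⁻¹). Both
are unchanged when y is exchanged with a left variable. Solving D·T_k − M·K_k = x^k gives rows
affine in a parameter w, so all values of H in the equation come from one polynomial p of degree at
most n: p(y/τ) for H itself, p(z_j/τ) after an exchange, p(yτ) after the shift. The equation is
Lagrange interpolation of p at the n + 1 nodes y/τ, z_j/τ (`lagrange_B`).

For the second equation y is a left variable, M = B·(x − yτ⁻¹) and D = A/(x − yτ). Rows built from T
= 1 and T = (x − yτ)(x − yτ⁻¹)x^k give a polynomial p of degree at most l − 1, and the equation is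
interpolation of x·p at l + 1 nodes (`lagrange_C`). -/

namespace SmirnovIntegral
open scoped BigOperators Topology
noncomputable section

/-! ### Cycles in the plane -/

/-- A generalized closed chain in `ℂ`: a parametrized complex measure `w dm` carried by a compact
set `K`, on which all functions with a global single-valued primitive off one point
integrate to zero. -/
structure Cycle where
  c : ℝ → ℂ
  w : ℝ → ℂ
  m : MeasureTheory.Measure ℝ
  K : Set ℂ
  finite : MeasureTheory.IsFiniteMeasure m
  compact : IsCompact K
  meas : Measurable c
  mem : ∀ t, c t ∈ K
  integrable : MeasureTheory.Integrable w m
  -- Closedness is needed only against 1 and (x − z)⁻²: the latter makes the winding number locally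
  -- constant, and together they make it vanish near infinity. Integrality of winding numbers plays
  -- no role.
  closed_const : ∫ t, w t ∂m = 0
  closed : ∀ z ∉ K, ∫ t, w t * ((c t - z) ^ 2)⁻¹ ∂m = 0

namespace Cycle

open MeasureTheory Metric Set Filter

instance (Γ : Cycle) : IsFiniteMeasure Γ.m := Γ.finite

/-- The integral of `f` over a cycle. -/
def int (Γ : Cycle) (f : ℂ → ℂ) : ℂ := ∫ t, Γ.w t * f (Γ.c t) ∂Γ.m

/-- The winding number of a cycle, times `2 π i`. -/
def wind (Γ : Cycle) (z : ℂ) : ℂ := Γ.int fun x => (x - z)⁻¹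

variable (Γ : Cycle)

lemma measurable_comp {f : ℂ → ℂ} (hf : ContinuousOn f Γ.K) : Measurable fun t => f (Γ.c t) := by
  have h1 : Measurable (Set.codRestrict Γ.c Γ.K Γ.mem) := Γ.meas.subtype_mk
  exact (continuousOn_iff_continuous_domRestrict.1 hf).measurable.comp h1

lemma integrable_comp {f : ℂ → ℂ} (hf : ContinuousOn f Γ.K) :
    Integrable (fun t => Γ.w t * f (Γ.c t)) Γ.m := by
  obtain ⟨C, hC⟩ := Γ.compact.exists_bound_of_continuousOn hf
  exact Γ.integrable.mul_bdd (Γ.measurable_comp hf).aestronglyMeasurable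
    (Eventually.of_forall fun t => hC _ (Γ.mem t))

lemma int_congr {f g : ℂ → ℂ} (h : ∀ x ∈ Γ.K, f x = g x) : Γ.int f = Γ.int g := by
  unfold int
  congr 1; ext t; rw [h _ (Γ.mem t)]

lemma int_sub {f g : ℂ → ℂ} (hf : ContinuousOn f Γ.K) (hg : ContinuousOn g Γ.K) :
    Γ.int (fun x => f x - g x) = Γ.int f - Γ.int g := by
  unfold int
  rw [← integral_sub (Γ.integrable_comp hf) (Γ.integrable_comp hg)]
  congr 1; ext t; ring

lemma int_const_mul (a : ℂ) (f : ℂ → ℂ) : Γ.int (fun x => a * f x) = a * Γ.int f := by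
  unfold int
  rw [← integral_const_mul]
  congr 1; ext t; ring

lemma norm_int_le {f : ℂ → ℂ} {B : ℝ} (h : ∀ x ∈ Γ.K, ‖f x‖ ≤ B) :
    ‖Γ.int f‖ ≤ (∫ t, ‖Γ.w t‖ ∂Γ.m) * B := by
  unfold int
  rw [← integral_mul_const]
  refine norm_integral_le_of_norm_le (Γ.integrable.norm.mul_const B) (Eventually.of_forall fun t => ?_)
  rw [norm_mul]
  exact mul_le_mul_of_nonneg_left (h _ (Γ.mem t)) (norm_nonneg _)

/-- Differentiation under the integral sign for a bounded holomorphic family. -/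
lemma hasDerivAt_int {F : ℂ → ℂ → ℂ} {z₀ : ℂ} {r B : ℝ} (hr : 0 < r)
    (hc : ∀ z ∈ ball z₀ r, ContinuousOn (F z) Γ.K)
    (hd : ∀ x ∈ Γ.K, DifferentiableOn ℂ (fun z => F z x) (ball z₀ r))
    (hB : ∀ x ∈ Γ.K, ∀ z ∈ ball z₀ r, ‖F z x‖ ≤ B) :
    HasDerivAt (fun z => Γ.int (F z)) (Γ.int fun x => deriv (fun z => F z x) z₀) z₀ := by
  have hder : ∀ x ∈ Γ.K, ∀ z ∈ ball z₀ r,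
      HasDerivAt (fun z => F z x) (deriv (fun z => F z x) z) z := fun x hx z hz =>
    ((hd x hx).differentiableAt (isOpen_ball.mem_nhds hz)).hasDerivAt
  refine (hasDerivAt_integral_of_dominated_loc_of_deriv_le (𝕜 := ℂ)
    (F := fun z t => Γ.w t * F z (Γ.c t))
    (F' := fun z t => Γ.w t * deriv (fun z => F z (Γ.c t)) z)
    (bound := fun t => ‖Γ.w t‖ * (B / (r / 2)))
    (ball_mem_nhds z₀ (half_pos hr)) ?_ ?_ ?_ ?_ ?_ ?_).2
  · filter_upwards [ball_mem_nhds z₀ hr] with z hz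
    exact (Γ.integrable_comp (hc z hz)).aestronglyMeasurable
  · exact Γ.integrable_comp (hc z₀ (mem_ball_self hr))
  -- The derivative is measurable in t as a limit of difference quotients with steps (r/2)/(n + 1),
  -- which stay inside the ball.
  · refine Γ.integrable.aestronglyMeasurable.mul ?_
    have hs : Tendsto (fun n : ℕ => ((r / 2 : ℝ) : ℂ) / (n + 1)) atTop (𝓝[≠] 0) := by
      refine tendsto_nhdsWithin_iff.2 ⟨?_, Eventually.of_forall fun n => ?_⟩
      · have := (tendsto_const_div_atTop_nhds_zero_nat ((r/2 : ℝ) : ℂ))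
        have := (tendsto_add_atTop_iff_nat 1).2 this
        simpa using this
      · have : (n : ℂ) + 1 ≠ 0 := by exact_mod_cast n.succ_ne_zero
        simp [this, hr.ne']
    refine aestronglyMeasurable_of_tendsto_ae atTop
      (f := fun (n : ℕ) t => (((r / 2 : ℝ) : ℂ) / (n + 1))⁻¹ *
        (F (z₀ + ((r / 2 : ℝ) : ℂ) / (n + 1)) (Γ.c t) - F z₀ (Γ.c t))) ?_ ?_
    · intro n
      have hz : z₀ + ((r / 2 : ℝ) : ℂ) / (n + 1) ∈ ball z₀ r := by
        have h2 : ((n : ℂ) + 1) = ((n + 1 : ℝ) : ℂ) := by push_cast; rfl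
        rw [mem_ball, dist_eq_norm, add_sub_cancel_left, h2, ← Complex.ofReal_div, Complex.norm_real,
          Real.norm_of_nonneg (by positivity)]
        have : (r / 2) / ((n : ℝ) + 1) ≤ r / 2 := div_le_self (by positivity) (by linarith [n.cast_nonneg (α := ℝ)])
        linarith
      exact ((Γ.measurable_comp (hc _ hz)).sub
        (Γ.measurable_comp (hc _ (mem_ball_self hr)))).const_mul _ |>.aestronglyMeasurable
    · refine Eventually.of_forall fun t => ?_
      have := (hder _ (Γ.mem t) z₀ (mem_ball_self hr)).tendsto_slope_zero.comp hs
      simpa [Function.comp_def] using this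
  · refine Eventually.of_forall fun t z hz => ?_
    rw [norm_mul]
    refine mul_le_mul_of_nonneg_left ?_ (norm_nonneg _)
    -- Cauchy's estimate on the disc of radius r/2 about z yields the dominating constant B/(r/2).
    have hsub : closedBall z (r / 2) ⊆ ball z₀ r := by
      refine closedBall_subset_ball' ?_
      have := mem_ball.1 hz; linarith
    refine Complex.norm_deriv_le_of_forall_mem_sphere_norm_le (half_pos hr) ?_ ?_
    · refine DifferentiableOn.diffContOnCl ((hd _ (Γ.mem t)).mono ?_)
      exact closure_ball_subset_closedBall.trans hsub
    · exact fun y hy => hB _ (Γ.mem t) y (hsub (sphere_subset_closedBall hy))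
  · exact Γ.integrable.norm.mul_const _
  · refine Eventually.of_forall fun t z hz => ?_
    exact (hder _ (Γ.mem t) z (ball_subset_ball (by linarith) hz)).const_mul _

/-- Cauchy-type integrals are holomorphic off the support. -/
lemma hasDerivAt_cauchy {f : ℂ → ℂ} (hf : ContinuousOn f Γ.K) {z₀ : ℂ} (hz : z₀ ∉ Γ.K) :
    HasDerivAt (fun z => Γ.int fun x => f x * (x - z)⁻¹)
      (Γ.int fun x => f x * ((x - z₀) ^ 2)⁻¹) z₀ := by
  obtain ⟨δ, hδ, hδ'⟩ := Metric.isOpen_iff.1 Γ.compact.isClosed.isOpen_compl z₀ hz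
  obtain ⟨C, hC⟩ := Γ.compact.exists_bound_of_continuousOn hf
  have hne : ∀ x ∈ Γ.K, ∀ z ∈ ball z₀ (δ / 2), δ / 2 ≤ ‖x - z‖ := by
    intro x hx z hz
    by_contra! h
    refine (show x ∉ Γ.K from hδ' ?_) hx
    rw [mem_ball, dist_eq_norm] at *
    calc ‖x - z₀‖ = ‖(x - z) + (z - z₀)‖ := by ring_nf
      _ ≤ ‖x - z‖ + ‖z - z₀‖ := norm_add_le _ _
      _ < δ := by linarith
  have hne' : ∀ x ∈ Γ.K, ∀ z ∈ ball z₀ (δ / 2), x - z ≠ 0 := fun x hx z hz h => by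
    have := hne x hx z hz; rw [h, norm_zero] at this; linarith
  have hd : ∀ x ∈ Γ.K, ∀ z ∈ ball z₀ (δ / 2),
      HasDerivAt (fun z => f x * (x - z)⁻¹) (f x * ((x - z) ^ 2)⁻¹) z := by
    intro x hx z hz
    have := (((hasDerivAt_id z).const_sub x).inv (hne' x hx z hz)).const_mul (f x)
    convert! this using 1
    simp
  convert! Γ.hasDerivAt_int (F := fun z x => f x * (x - z)⁻¹) (z₀ := z₀) (r := δ / 2)
    (B := |C| * (δ / 2)⁻¹) (by positivity) ?_ ?_ ?_ using 1
  · refine Γ.int_congr fun x hx => ((hd x hx z₀ (mem_ball_self (by positivity))).deriv).symm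
  · exact fun z hz => hf.mul ((continuousOn_id.sub continuousOn_const).inv₀ fun x hx => hne' x hx z hz)
  · exact fun x hx z hz => (hd x hx z hz).differentiableAt.differentiableWithinAt
  · intro x hx z hz
    rw [norm_mul, norm_inv]
    gcongr
    · exact (hC x hx).trans (le_abs_self C)
    · exact hne x hx z hz

lemma hasDerivAt_wind {z : ℂ} (hz : z ∉ Γ.K) : HasDerivAt Γ.wind 0 z := by
  have h := Γ.hasDerivAt_cauchy (f := fun _ => 1) continuousOn_const hz
  have h0 : (Γ.int fun x => 1 * ((x - z) ^ 2)⁻¹) = 0 := by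
    simpa [int] using Γ.closed z hz
  rw [h0] at h
  convert! h using 2
  simp [wind]

/-- The winding number is locally constant off the support. -/
lemma eventually_wind_eq {z : ℂ} (hz : z ∉ Γ.K) : ∀ᶠ y in 𝓝 z, y ∉ Γ.K ∧ Γ.wind y = Γ.wind z := by
  obtain ⟨δ, hδ, hδ'⟩ := Metric.isOpen_iff.1 Γ.compact.isClosed.isOpen_compl z hz
  filter_upwards [ball_mem_nhds z hδ] with y hy
  refine ⟨hδ' hy, ?_⟩
  refine isOpen_ball.is_const_of_deriv_eq_zero (convex_ball z δ).isPreconnected ?_ ?_ hy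
    (mem_ball_self hδ)
  · exact fun x hx => (Γ.hasDerivAt_wind (hδ' hx)).differentiableAt.differentiableWithinAt
  · exact fun x hx => (Γ.hasDerivAt_wind (hδ' hx)).deriv

/-- In the coordinate s = 1/z the winding number is the integral of s/(sx − 1). It is holomorphic on
|s| < 1/R' with zero derivative, by `closed` for s ≠ 0 and by `closed_const` at s = 0; so it equals
its value 0 at s = 0. -/
lemma wind_eq_zero_of_norm_gt {R : ℝ} (hR : ∀ x ∈ Γ.K, ‖x‖ < R) {z : ℂ} (hz : R < ‖z‖) :
    Γ.wind z = 0 := by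
  have hR0 : 0 < R := (norm_nonneg _).trans_lt (hR _ (Γ.mem 0))
  have hz0 : z ≠ 0 := norm_pos_iff.1 (hR0.trans hz)
  obtain ⟨C, hC⟩ := Γ.compact.exists_bound_of_continuousOn (continuousOn_id (s := Γ.K))
  obtain ⟨R', hR'R, hRz⟩ := exists_between hz
  have hR'0 : 0 < R' := hR0.trans hR'R
  -- the function `s ↦ wind (1/s)` on a disc around `0`
  set G : ℂ → ℂ → ℂ := fun s x => s * (s * x - 1)⁻¹ with hG
  have hlow : ∀ x ∈ Γ.K, ∀ s ∈ ball (0 : ℂ) R'⁻¹, 1 - R / R' ≤ ‖s * x - 1‖ := by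
    intro x hx s hs
    have h1 : ‖s * x‖ ≤ R / R' := by
      rw [norm_mul, div_eq_inv_mul]
      have := mem_ball_zero_iff.1 hs
      exact mul_le_mul this.le (hR x hx).le (norm_nonneg _) (by positivity)
    calc 1 - R / R' ≤ ‖(1 : ℂ)‖ - ‖s * x‖ := by rw [norm_one]; linarith
      _ ≤ ‖1 - s * x‖ := norm_sub_norm_le _ _
      _ = ‖s * x - 1‖ := norm_sub_rev _ _
  have hpos : 0 < 1 - R / R' := by rw [sub_pos, div_lt_one hR'0]; exact hR'R
  have hne : ∀ x ∈ Γ.K, ∀ s ∈ ball (0 : ℂ) R'⁻¹, s * x - 1 ≠ 0 := fun x hx s hs h => by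
    have := hlow x hx s hs; rw [h, norm_zero] at this; linarith
  have hd : ∀ x ∈ Γ.K, ∀ s ∈ ball (0 : ℂ) R'⁻¹,
      HasDerivAt (fun s => G s x) (-((s * x - 1) ^ 2)⁻¹) s := by
    intro x hx s hs
    have h1 : HasDerivAt (fun s : ℂ => s * x - 1) x s := by
      simpa using ((hasDerivAt_id s).mul_const x).sub_const 1
    have := (hasDerivAt_id s).mul (h1.inv (hne x hx s hs))
    convert! this using 1
    have := hne x hx s hs
    simp only [id, Pi.inv_apply]
    field_simp
    ring
  have key : ∀ s ∈ ball (0 : ℂ) R'⁻¹, HasDerivAt (fun s => Γ.int (G s)) 0 s := by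
    intro s hs
    obtain ⟨δ, hδ, hδ'⟩ := Metric.isOpen_iff.1 isOpen_ball s hs
    convert! Γ.hasDerivAt_int (F := G) (z₀ := s) (r := δ) (B := R'⁻¹ * (1 - R / R')⁻¹) hδ ?_ ?_ ?_
      using 1
    · rw [Γ.int_congr (g := fun x => -((s * x - 1) ^ 2)⁻¹) fun x hx => (hd x hx s hs).deriv]
      by_cases h0 : s = 0
      · have := Γ.closed_const
        simp [h0, int, integral_neg, this]
      · have hsK : s⁻¹ ∉ Γ.K := fun h => hne _ h s hs (by field_simp; ring)
        have h2 := Γ.closed s⁻¹ hsK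
        rw [Γ.int_congr (g := fun x => (-(s ^ 2)⁻¹) * ((x - s⁻¹) ^ 2)⁻¹), int_const_mul]
        · unfold int; rw [h2, mul_zero]
        · intro x hx
          have h3 := hne x hx s hs
          have h4 : x - s⁻¹ ≠ 0 := fun h => h3 (by rw [sub_eq_zero.1 h]; field_simp; ring)
          have h5 : s * x - 1 = s * (x - s⁻¹) := by field_simp
          rw [h5, mul_pow, mul_inv]; ring
    · exact fun z hz => continuousOn_const.mul
        (((continuousOn_const.mul continuousOn_id).sub continuousOn_const).inv₀
          fun x hx => hne x hx z (hδ' hz))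
    · exact fun x hx z hz => (hd x hx z (hδ' hz)).differentiableAt.differentiableWithinAt
    · intro x hx z hz
      simp only [hG]
      rw [norm_mul, norm_inv]
      have := mem_ball_zero_iff.1 (hδ' hz)
      gcongr
      exact hlow x hx z (hδ' hz)
  have hzs : z⁻¹ ∈ ball (0 : ℂ) R'⁻¹ := by
    rw [mem_ball_zero_iff, norm_inv]
    exact inv_strictAnti₀ hR'0 hRz
  have h1 : Γ.int (G z⁻¹) = Γ.int (G 0) := by
    refine isOpen_ball.is_const_of_deriv_eq_zero (convex_ball (0:ℂ) R'⁻¹).isPreconnected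
      (f := fun s => Γ.int (G s)) ?_ ?_ hzs (mem_ball_self (by positivity))
    · exact fun x hx => (key x hx).differentiableAt.differentiableWithinAt
    · exact fun x hx => (key x hx).deriv
  have h2 : Γ.int (G 0) = 0 := by simp [hG, int]
  rw [h2] at h1
  rw [← h1]
  refine Γ.int_congr fun x hx => ?_
  have h3 := hne x hx _ hzs
  have h5 : z⁻¹ * x - 1 = z⁻¹ * (x - z) := by field_simp
  simp only [hG]
  rw [h5, mul_inv, inv_inv, ← mul_assoc, inv_mul_cancel₀ hz0, one_mul]

end Cycle
end
end SmirnovIntegral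

/-! ### Divided differences and the homology form of Cauchy's theorem. -/

namespace SmirnovIntegral
open scoped BigOperators Topology
noncomputable section

namespace Cycle

open MeasureTheory Metric Set Filter

/-- For x in the ball the mean value inequality applies; outside it |x − z| ≥ δ/2 and the bound on f
suffices. Uniformity in x and z is what differentiation under the integral requires. -/
lemma norm_dslope_le {f : ℂ → ℂ} {z₀ : ℂ} {δ B M : ℝ} (hδ : 0 < δ)
    (hf : ∀ x ∈ ball z₀ δ, AnalyticAt ℂ f x) (hB : ∀ x ∈ ball z₀ δ, ‖deriv f x‖ ≤ B)
    {x z : ℂ} (hz : z ∈ ball z₀ (δ / 2)) (hMz : ‖f z‖ ≤ M) (hMx : ‖f x‖ ≤ M) :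
    ‖dslope f z x‖ ≤ max B (4 * M / δ) := by
  have hzb : z ∈ ball z₀ δ := ball_subset_ball (by linarith) hz
  by_cases hx : x ∈ ball z₀ δ
  · refine le_max_of_le_left ?_
    rcases eq_or_ne x z with rfl | hne
    · rw [dslope_same]; exact hB _ hx
    · rw [dslope_of_ne _ hne, slope_def_field, norm_div,
        div_le_iff₀ (norm_pos_iff.2 (sub_ne_zero.2 hne))]
      exact (convex_ball z₀ δ).norm_image_sub_le_of_norm_deriv_le
        (fun y hy => (hf y hy).differentiableAt) hB hzb hx
  · refine le_max_of_le_right ?_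
    have hd : δ / 2 ≤ ‖x - z‖ := by
      by_contra! h
      apply hx
      rw [mem_ball, dist_eq_norm] at *
      calc ‖x - z₀‖ = ‖(x - z) + (z - z₀)‖ := by ring_nf
        _ ≤ ‖x - z‖ + ‖z - z₀‖ := norm_add_le _ _
        _ < δ := by linarith
    have hne : x ≠ z := fun h => by rw [h, sub_self, norm_zero] at hd; linarith
    rw [dslope_of_ne _ hne, slope_def_field, norm_div]
    have h1 : ‖f x - f z‖ ≤ 2 * M := (norm_sub_le _ _).trans (by linarith)
    calc ‖f x - f z‖ / ‖x - z‖ ≤ (2 * M) / (δ / 2) :=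
          div_le_div₀ ((norm_nonneg _).trans h1) h1 (by positivity) hd
      _ = 4 * M / δ := by field_simp; ring

/-- Symmetry transfers holomorphy in the moving point to holomorphy in the base point. -/
lemma dslope_symm (f : ℂ → ℂ) (x z : ℂ) : dslope f z x = dslope f x z := by
  rcases eq_or_ne x z with rfl | hne
  · rfl
  · rw [dslope_of_ne _ hne, dslope_of_ne _ hne.symm, slope_comm]

/-- Integrals of divided differences are holomorphic. -/
lemma differentiableAt_int_dslope (Γ : Cycle) {f : ℂ → ℂ} (hf : ∀ x ∈ Γ.K, AnalyticAt ℂ f x)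
    {z₀ : ℂ} (hz : AnalyticAt ℂ f z₀) :
    DifferentiableAt ℂ (fun z => Γ.int fun x => dslope f z x) z₀ := by
  have hU : IsOpen {x | AnalyticAt ℂ f x} := isOpen_analyticAt ℂ f
  obtain ⟨δ, hδ, hδ'⟩ := Metric.nhds_basis_closedBall.mem_iff.1 (hU.mem_nhds hz)
  have han : ∀ x ∈ closedBall z₀ δ, AnalyticAt ℂ f x := hδ'
  have hbU : ball z₀ (δ / 2) ⊆ {x | AnalyticAt ℂ f x} :=
    (ball_subset_closedBall.trans (closedBall_subset_closedBall (by linarith))).trans hδ'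
  obtain ⟨B, hB⟩ := (isCompact_closedBall z₀ δ).exists_bound_of_continuousOn
    (f := deriv f) fun x hx => (han x hx).deriv.continuousAt.continuousWithinAt
  obtain ⟨M, hM⟩ := (Γ.compact.union (isCompact_closedBall z₀ δ)).exists_bound_of_continuousOn
    (f := f) fun x hx => by
      rcases hx with hx | hx
      exacts [(hf x hx).continuousAt.continuousWithinAt, (han x hx).continuousAt.continuousWithinAt]
  have hdU : DifferentiableOn ℂ f {x | AnalyticAt ℂ f x} :=
    fun x hx => (AnalyticAt.differentiableAt hx).differentiableWithinAt
  have hds : ∀ y, AnalyticAt ℂ f y → DifferentiableOn ℂ (dslope f y) {x | AnalyticAt ℂ f x} :=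
    fun y hy => (Complex.differentiableOn_dslope (hU.mem_nhds hy)).2 hdU
  refine (Γ.hasDerivAt_int (F := fun z x => dslope f z x) (z₀ := z₀) (r := δ / 2)
    (B := max B (4 * M / δ)) (by positivity) ?_ ?_ ?_).differentiableAt
  · exact fun z hz => (hds z (hbU hz)).continuousOn.mono fun x hx => hf x hx
  · intro x hx
    simp only [dslope_symm f x]
    exact (hds x (hf x hx)).mono hbU
  · intro x hx z hz
    refine norm_dslope_le hδ (fun y hy => han y (ball_subset_closedBall hy))
      (fun y hy => hB y (ball_subset_closedBall hy)) hz ?_ ?_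
    · exact hM z (Or.inr (ball_subset_closedBall (ball_subset_ball (by linarith) hz)))
    · exact hM x (Or.inl hx)

/-- The values `z` off the supports of `Γ, Γ'` at which the two winding numbers agree. -/
def agree (Γ Γ' : Cycle) : Set ℂ := {z | z ∉ Γ.K ∧ z ∉ Γ'.K ∧ Γ.wind z = Γ'.wind z}

lemma isOpen_agree (Γ Γ' : Cycle) : IsOpen (agree Γ Γ') := by
  rw [isOpen_iff_mem_nhds]
  rintro z ⟨h1, h2, h3⟩
  filter_upwards [Γ.eventually_wind_eq h1, Γ'.eventually_wind_eq h2] with y hy hy'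
  exact ⟨hy.1, hy'.1, by rw [hy.2, hy'.2, h3]⟩

lemma eventually_cocompact_agree (Γ Γ' : Cycle) : ∀ᶠ z in cocompact ℂ, z ∈ agree Γ Γ' := by
  obtain ⟨R, hR⟩ := (Γ.compact.union Γ'.compact).isBounded.subset_ball (0 : ℂ)
  have h1 : ∀ x ∈ Γ.K, ‖x‖ < R := fun x hx => mem_ball_zero_iff.1 (hR (Or.inl hx))
  have h2 : ∀ x ∈ Γ'.K, ‖x‖ < R := fun x hx => mem_ball_zero_iff.1 (hR (Or.inr hx))
  filter_upwards [tendsto_norm_cocompact_atTop.eventually (eventually_gt_atTop R)] with z hz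
  exact ⟨fun h => (h1 z h).not_gt hz, fun h => (h2 z h).not_gt hz,
    by rw [Γ.wind_eq_zero_of_norm_gt h1 hz, Γ'.wind_eq_zero_of_norm_gt h2 hz]⟩

lemma tendsto_int_cauchy (Γ : Cycle) {f : ℂ → ℂ} (hf : ContinuousOn f Γ.K) :
    Tendsto (fun z => Γ.int fun x => f x * (x - z)⁻¹) (cocompact ℂ) (𝓝 0) := by
  obtain ⟨R, hR⟩ := Γ.compact.isBounded.subset_ball (0 : ℂ)
  obtain ⟨M, hM⟩ := Γ.compact.exists_bound_of_continuousOn hf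
  have h1 : ∀ x ∈ Γ.K, ‖x‖ < R := fun x hx => mem_ball_zero_iff.1 (hR hx)
  refine squeeze_zero_norm' (a := fun z => (∫ t, ‖Γ.w t‖ ∂Γ.m) * (M * (‖z‖ - R)⁻¹)) ?_ ?_
  · filter_upwards [tendsto_norm_cocompact_atTop.eventually (eventually_gt_atTop R)] with z hz
    refine Γ.norm_int_le fun x hx => ?_
    rw [norm_mul, norm_inv]
    have h2 : ‖z‖ - R ≤ ‖x - z‖ := by
      have := norm_sub_norm_le z x
      rw [norm_sub_rev] at this
      linarith [h1 x hx]
    have h3 : 0 < ‖z‖ - R := sub_pos.2 hz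
    have := hM x hx
    gcongr
    exact (norm_nonneg _).trans this
  · have h : Tendsto (fun z : ℂ => (‖z‖ - R)⁻¹) (cocompact ℂ) (𝓝 0) :=
      tendsto_inv_atTop_zero.comp
        (tendsto_atTop_add_const_right _ (-R) tendsto_norm_cocompact_atTop)
    simpa using (h.const_mul M).const_mul (∫ t, ‖Γ.w t‖ ∂Γ.m)

/-- Cauchy's theorem in its homology form (Dixon's argument). -/
theorem int_eq_of_agree (Γ Γ' : Cycle) {f : ℂ → ℂ} (hf : ∀ x ∈ Γ.K, AnalyticAt ℂ f x)
    (hf' : ∀ x ∈ Γ'.K, AnalyticAt ℂ f x) (h : ∀ z, AnalyticAt ℂ f z ∨ z ∈ agree Γ Γ') :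
    Γ.int f = Γ'.int f := by
  -- The argument runs with g = f·(x − z₀), for which the Cauchy transform at z₀ is the integral of
  -- f itself.
  obtain ⟨z₀, hz₀⟩ := (eventually_cocompact_agree Γ Γ').exists
  set g : ℂ → ℂ := fun x => f x * (x - z₀) with hg
  have hga : ∀ x, AnalyticAt ℂ f x → AnalyticAt ℂ g x := fun x hx =>
    hx.mul (analyticAt_id.sub analyticAt_const)
  have hgK : ∀ x ∈ Γ.K, AnalyticAt ℂ g x := fun x hx => hga x (hf x hx)
  have hgK' : ∀ x ∈ Γ'.K, AnalyticAt ℂ g x := fun x hx => hga x (hf' x hx)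
  have hgc : ContinuousOn g Γ.K := fun x hx => (hgK x hx).continuousAt.continuousWithinAt
  have hgc' : ContinuousOn g Γ'.K := fun x hx => (hgK' x hx).continuousAt.continuousWithinAt
  classical
  set D : ℂ → ℂ := fun z => (Γ.int fun x => g x * (x - z)⁻¹) - Γ'.int fun x => g x * (x - z)⁻¹
    with hD
  -- Dixon's function: divided differences where g is analytic, Cauchy transforms on `agree`. On the
  -- overlap the two differ by g(z) times the difference of winding numbers, which is 0. So H is
  -- entire, tends to 0 at infinity, and vanishes by Liouville.
  set H : ℂ → ℂ := fun z => if AnalyticAt ℂ g z then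
    (Γ.int fun x => dslope g z x) - Γ'.int fun x => dslope g z x else D z with hH
  have hHD : ∀ z ∈ agree Γ Γ', H z = D z := by
    rintro z ⟨h1, h2, h3⟩
    by_cases hz : AnalyticAt ℂ g z
    · have key : ∀ (Δ : Cycle), ContinuousOn g Δ.K → z ∉ Δ.K → (Δ.int fun x => dslope g z x) =
          (Δ.int fun x => g x * (x - z)⁻¹) - g z * Δ.wind z := by
        intro Δ hΔ hzΔ
        have hinv : ContinuousOn (fun x => (x - z)⁻¹) Δ.K :=
          (continuousOn_id.sub continuousOn_const).inv₀ fun x hx h =>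
            hzΔ (by rw [← sub_eq_zero.1 (show x - z = 0 from h)]; exact hx)
        rw [wind, ← int_const_mul, 
          ← Δ.int_sub (f := fun x => g x * (x - z)⁻¹) (g := fun x => g z * (x - z)⁻¹)
            (hΔ.mul hinv) (continuousOn_const.mul hinv)]
        refine Δ.int_congr fun x hx => ?_
        have hne : x ≠ z := fun h => hzΔ (h ▸ hx)
        rw [dslope_of_ne _ hne, slope_def_field]
        ring
      simp only [hH, if_pos hz, hD, key Γ hgc h1, key Γ' hgc' h2, h3]
      ring
    · simp only [hH, if_neg hz]
  have hdiff : Differentiable ℂ H := by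
    intro z
    rcases h z with hz | hz
    · have hgz := hga z hz
      have hev : H =ᶠ[𝓝 z] fun z =>
          (Γ.int fun x => dslope g z x) - Γ'.int fun x => dslope g z x := by
        filter_upwards [hgz.eventually_analyticAt] with y hy
        simp only [hH, if_pos hy]
      refine DifferentiableAt.congr_of_eventuallyEq ?_ hev
      exact (Γ.differentiableAt_int_dslope hgK hgz).sub (Γ'.differentiableAt_int_dslope hgK' hgz)
    · have hev : H =ᶠ[𝓝 z] D := by
        filter_upwards [(isOpen_agree Γ Γ').mem_nhds hz] with y hy using hHD y hy
      refine DifferentiableAt.congr_of_eventuallyEq ?_ hev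
      exact (Γ.hasDerivAt_cauchy hgc hz.1).differentiableAt.sub
        (Γ'.hasDerivAt_cauchy hgc' hz.2.1).differentiableAt
  have hlim : Tendsto H (cocompact ℂ) (𝓝 0) := by
    have h1 : Tendsto D (cocompact ℂ) (𝓝 0) := by
      simpa using (Γ.tendsto_int_cauchy hgc).sub (Γ'.tendsto_int_cauchy hgc')
    refine h1.congr' ?_
    filter_upwards [eventually_cocompact_agree Γ Γ'] with z hz using (hHD z hz).symm
  have h0 : D z₀ = 0 := by
    rw [← hHD z₀ hz₀]
    exact hdiff.apply_eq_of_tendsto_cocompact z₀ hlim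
  have hfg : ∀ (Δ : Cycle), z₀ ∉ Δ.K → (Δ.int fun x => g x * (x - z₀)⁻¹) = Δ.int f := by
    intro Δ hΔ
    refine Δ.int_congr fun x hx => ?_
    have hne : x - z₀ ≠ 0 := fun h => hΔ (by rw [← sub_eq_zero.1 h]; exact hx)
    simp only [hg]
    field_simp
  simp only [hD, hfg Γ hz₀.1, hfg Γ' hz₀.2.1] at h0
  exact sub_eq_zero.1 h0

end Cycle
end
end SmirnovIntegral

namespace SmirnovIntegral
open scoped BigOperators Topology
noncomputable section

namespace Cycle

open MeasureTheory Metric Set Filter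

/-! ### Multiple integrals over products of cycles -/

/-- The integral of a function of `n` variables over a product of cycles. -/
def multi {n : ℕ} (Γ : Fin n → Cycle) (f : (Fin n → ℂ) → ℂ) : ℂ :=
  ∫ t : Fin n → ℝ, (∏ μ, (Γ μ).w (t μ)) * f (fun μ => (Γ μ).c (t μ))
    ∂(Measure.pi fun μ => (Γ μ).m)

/-- The support of a product of cycles. -/
def box {n : ℕ} (Γ : Fin n → Cycle) : Set (Fin n → ℂ) := {x | ∀ μ, x μ ∈ (Γ μ).K}

section

variable {n : ℕ} (Γ : Fin n → Cycle)

lemma isCompact_box : IsCompact (box Γ) := by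
  have : box Γ = Set.pi univ fun μ => (Γ μ).K := by ext x; simp [box]
  rw [this]
  exact isCompact_univ_pi fun μ => (Γ μ).compact

lemma mem_box (t : Fin n → ℝ) : (fun μ => (Γ μ).c (t μ)) ∈ box Γ := fun μ => (Γ μ).mem _

lemma measurable_comp_box {E : Type*} [TopologicalSpace E] [MeasurableSpace E] [BorelSpace E]
    {f : (Fin n → ℂ) → E} (hf : ContinuousOn f (box Γ)) :
    Measurable fun t : Fin n → ℝ => f (fun μ => (Γ μ).c (t μ)) := by
  have h1 : Measurable (Set.codRestrict (fun (t : Fin n → ℝ) μ => (Γ μ).c (t μ)) (box Γ)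
      (mem_box Γ)) := by
    refine Measurable.subtype_mk ?_
    exact measurable_pi_lambda _ fun μ => (Γ μ).meas.comp (measurable_pi_apply μ)
  exact (continuousOn_iff_continuous_domRestrict.1 hf).measurable.comp h1

lemma integrable_weight : Integrable (fun t : Fin n → ℝ => ∏ μ, (Γ μ).w (t μ))
    (Measure.pi fun μ => (Γ μ).m) :=
  Integrable.fintype_prod fun μ => (Γ μ).integrable

lemma integrable_multi {f : (Fin n → ℂ) → ℂ} (hf : ContinuousOn f (box Γ)) :
    Integrable (fun t : Fin n → ℝ => (∏ μ, (Γ μ).w (t μ)) * f (fun μ => (Γ μ).c (t μ)))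
      (Measure.pi fun μ => (Γ μ).m) := by
  obtain ⟨C, hC⟩ := (isCompact_box Γ).exists_bound_of_continuousOn hf
  exact (integrable_weight Γ).mul_bdd (measurable_comp_box Γ hf).aestronglyMeasurable
    (Eventually.of_forall fun t => hC _ (mem_box Γ t))

lemma multi_congr {f g : (Fin n → ℂ) → ℂ} (h : ∀ x ∈ box Γ, f x = g x) :
    multi Γ f = multi Γ g := by
  unfold multi
  congr 1; ext t; rw [h _ (mem_box Γ t)]

lemma multi_const_mul (a : ℂ) (f : (Fin n → ℂ) → ℂ) :
    multi Γ (fun x => a * f x) = a * multi Γ f := by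
  unfold multi
  rw [← integral_const_mul]
  congr 1; ext t; ring

lemma multi_add {f g : (Fin n → ℂ) → ℂ} (hf : ContinuousOn f (box Γ))
    (hg : ContinuousOn g (box Γ)) :
    multi Γ (fun x => f x + g x) = multi Γ f + multi Γ g := by
  unfold multi
  rw [← integral_add (integrable_multi Γ hf) (integrable_multi Γ hg)]
  congr 1; ext t; ring

lemma multi_zero : multi Γ (fun _ => 0) = 0 := by
  unfold multi
  simp

lemma multi_sum {ι : Type*} (s : Finset ι) {f : ι → (Fin n → ℂ) → ℂ}
    (hf : ∀ i ∈ s, ContinuousOn (f i) (box Γ)) :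
    multi Γ (fun x => ∑ i ∈ s, f i x) = ∑ i ∈ s, multi Γ (f i) := by
  classical
  induction s using Finset.induction_on with
  | empty => simp [multi_zero]
  | insert a s ha ih =>
    simp only [Finset.sum_insert ha]
    rw [multi_add Γ (hf a (Finset.mem_insert_self _ _))
      (continuousOn_finsetSum _ fun i hi => hf i (Finset.mem_insert_of_mem hi)),
      ih fun i hi => hf i (Finset.mem_insert_of_mem hi)]

end

/-- Integrating out one variable first. -/
lemma multi_eq_integral_int {m : ℕ} (Γ : Fin (m + 1) → Cycle) (i : Fin (m + 1))
    {f : (Fin (m + 1) → ℂ) → ℂ} (hf : ContinuousOn f (box Γ)) :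
    multi Γ f = ∫ y : Fin m → ℝ, (∏ ν, (Γ (i.succAbove ν)).w (y ν)) *
      (Γ i).int (fun ξ => f (i.insertNth (α := fun _ => ℂ) ξ fun ν => (Γ (i.succAbove ν)).c (y ν)))
      ∂(Measure.pi fun ν => (Γ (i.succAbove ν)).m) := by
  have hmp := (measurePreserving_piFinSuccAbove (fun μ => (Γ μ).m) i).symm
  have hint := integrable_multi Γ hf
  unfold multi
  rw [← hmp.integral_comp']
  refine (integral_prod_symm _
    ((hmp.integrable_comp_emb (MeasurableEquiv.measurableEmbedding _)).2 hint)).trans ?_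
  congr 1
  ext y
  unfold int
  rw [← integral_const_mul]
  congr 1
  ext s
  have h1 : (MeasurableEquiv.piFinSuccAbove (fun _ => ℝ) i).symm (s, y) =
    i.insertNth (α := fun _ => ℝ) s y := rfl
  have h2 : (fun μ => (Γ μ).c (i.insertNth (α := fun _ => ℝ) s y μ)) =
      i.insertNth (α := fun _ => ℂ) ((Γ i).c s) fun ν => (Γ (i.succAbove ν)).c (y ν) := by
    ext μ
    refine Fin.succAboveCases i ?_ (fun ν => ?_) μ <;> simp
  simp only [Function.comp_apply]
  rw [h1, h2, Fin.prod_univ_succAbove _ i]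
  simp only [Fin.insertNth_apply_same, Fin.insertNth_apply_succAbove]
  ring

/-- The `i`-th coordinate is a filler; it is overwritten by the updates to which this is applied. -/
lemma insertNth_mem_box {m : ℕ} (Γ : Fin (m + 1) → Cycle) (i : Fin (m + 1)) (y : Fin m → ℝ) :
    (i.insertNth (α := fun _ => ℂ) ((Γ i).c 0) fun ν => (Γ (i.succAbove ν)).c (y ν)) ∈ box Γ := by
  intro μ
  refine Fin.succAboveCases i ?_ (fun ν => ?_) μ <;> simp [mem]

section

variable {n : ℕ} (Γ : Fin n → Cycle)

lemma multi_eq_zero_of_int (i : Fin n) {f : (Fin n → ℂ) → ℂ} (hf : ContinuousOn f (box Γ))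
    (h : ∀ x ∈ box Γ, (Γ i).int (fun ξ => f (Function.update x i ξ)) = 0) : multi Γ f = 0 := by
  obtain ⟨m, rfl⟩ : ∃ m, n = m + 1 := ⟨n - 1, by have := i.pos; omega⟩
  rw [multi_eq_integral_int Γ i hf]
  refine (integral_congr_ae (Eventually.of_forall fun y => ?_)).trans (integral_zero _ _)
  have := h _ (insertNth_mem_box Γ i y)
  simp only [Fin.update_insertNth] at this
  simp only [this, mul_zero]

lemma multi_update (i : Fin n) (Δ : Cycle) {f : (Fin n → ℂ) → ℂ} (hf : ContinuousOn f (box Γ))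
    (hf' : ContinuousOn f (box (Function.update Γ i Δ)))
    (h : ∀ x ∈ box Γ, (Γ i).int (fun ξ => f (Function.update x i ξ)) =
      Δ.int (fun ξ => f (Function.update x i ξ))) :
    multi Γ f = multi (Function.update Γ i Δ) f := by
  obtain ⟨m, rfl⟩ : ∃ m, n = m + 1 := ⟨n - 1, by have := i.pos; omega⟩
  rw [multi_eq_integral_int Γ i hf, multi_eq_integral_int _ i hf']
  simp only [Function.update_self, ne_eq, Fin.succAbove_ne, not_false_eq_true,
    Function.update_of_ne]
  congr 1
  ext y
  have := h _ (insertNth_mem_box Γ i y)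
  simp only [Fin.update_insertNth] at this
  rw [this]

/-- Two products of cycles give the same integral if they do in each variable separately. -/
lemma multi_eq_multi (Γ' : Fin n → Cycle) {f : (Fin n → ℂ) → ℂ}
    (hf : ContinuousOn f {x | ∀ μ, x μ ∈ (Γ μ).K ∪ (Γ' μ).K})
    (h : ∀ i x, (∀ μ, x μ ∈ (Γ μ).K ∪ (Γ' μ).K) →
      (Γ i).int (fun ξ => f (Function.update x i ξ)) =
        (Γ' i).int (fun ξ => f (Function.update x i ξ))) :
    multi Γ f = multi Γ' f := by
  have hbox : ∀ s : Finset (Fin n), box (s.piecewise Γ' Γ) ⊆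
      {x | ∀ μ, x μ ∈ (Γ μ).K ∪ (Γ' μ).K} := by
    intro s x hx μ
    have := hx μ
    by_cases hμ : μ ∈ s
    · rw [Finset.piecewise_eq_of_mem _ _ _ hμ] at this; exact Or.inr this
    · rw [Finset.piecewise_eq_of_notMem _ _ _ hμ] at this; exact Or.inl this
  -- The cycles are exchanged one coordinate at a time; `s` is the set of coordinates already
  -- exchanged.
  have key : ∀ s : Finset (Fin n), multi Γ f = multi (s.piecewise Γ' Γ) f := by
    intro s
    induction s using Finset.induction_on with
    | empty => simp
    | insert i s hi ih =>
      have hb := hbox (insert i s)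
      rw [Finset.piecewise_insert] at hb ⊢
      rw [ih]
      refine multi_update _ i (Γ' i) (hf.mono (hbox s)) (hf.mono hb) fun x hx => ?_
      rw [Finset.piecewise_eq_of_notMem _ _ _ hi]
      exact h i x (hbox s hx)
  simpa using key Finset.univ

/-- A multiple integral depends holomorphically on parameters. -/
lemma differentiableAt_multi {E : Type*} [NormedAddCommGroup E] [NormedSpace ℂ E]
    [FiniteDimensional ℂ E] {F : (Fin n → ℂ) × E → ℂ} {u₀ : E}
    (hF : ∀ x ∈ box Γ, AnalyticAt ℂ F (x, u₀)) :
    DifferentiableAt ℂ (fun u => multi Γ fun x => F (x, u)) u₀ := by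
  have : ProperSpace E := FiniteDimensional.proper ℂ E
  let _ : NormedSpace ℝ E := NormedSpace.restrictScalars ℝ ℂ E
  -- Compactness of the box gives one neighbourhood of u₀ on which the integrand is analytic for all
  -- x at once.
  obtain ⟨O, V, -, hV, hO', hV', hOV⟩ := generalized_tube_lemma (isCompact_box Γ)
    (isCompact_singleton (x := u₀)) (isOpen_analyticAt ℂ F) (by
      rintro ⟨x, u⟩ ⟨hx, hu⟩
      obtain rfl : u = u₀ := hu
      exact hF x hx)
  obtain ⟨δ, hδ, hδ'⟩ := Metric.nhds_basis_closedBall.mem_iff.1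
    (hV.mem_nhds (hV' rfl))
  have han : ∀ x ∈ box Γ, ∀ u ∈ closedBall u₀ δ, AnalyticAt ℂ F (x, u) :=
    fun x hx u hu => hOV ⟨hO' hx, hδ' hu⟩
  set D : (Fin n → ℂ) × E → E →L[ℂ] ℂ := fun p =>
    (fderiv ℂ F p).comp (ContinuousLinearMap.inr ℂ (Fin n → ℂ) E) with hD
  have hDc : ContinuousOn D (box Γ ×ˢ closedBall u₀ δ) := by
    rintro ⟨x, u⟩ ⟨hx, hu⟩
    exact ((han x hx u hu).fderiv.continuousAt.clm_comp
      continuousAt_const).continuousWithinAt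
  obtain ⟨B, hB⟩ := ((isCompact_box Γ).prod (isCompact_closedBall u₀ δ)).exists_bound_of_continuousOn
    hDc
  have hslice : ∀ u ∈ closedBall u₀ δ, ContinuousOn (fun x => F (x, u)) (box Γ) := by
    intro u hu x hx
    have h1 : ContinuousAt F (x, u) := (han x hx u hu).continuousAt
    exact (h1.comp (f := fun x => (x, u)) (by fun_prop)).continuousWithinAt
  refine (hasFDerivAt_integral_of_dominated_of_fderiv_le (𝕜 := ℂ)
    (F := fun u (t : Fin n → ℝ) => (∏ μ, (Γ μ).w (t μ)) * F (fun μ => (Γ μ).c (t μ), u))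
    (F' := fun u (t : Fin n → ℝ) => (∏ μ, (Γ μ).w (t μ)) • D (fun μ => (Γ μ).c (t μ), u))
    (bound := fun t => ‖∏ μ, (Γ μ).w (t μ)‖ * B) (s := ball u₀ δ)
    (ball_mem_nhds u₀ hδ) ?_ ?_ ?_ ?_ ?_ ?_).differentiableAt
  · filter_upwards [ball_mem_nhds u₀ hδ] with u hu
    exact (integrable_multi Γ (hslice u (ball_subset_closedBall hu))).aestronglyMeasurable
  · exact integrable_multi Γ (hslice u₀ (mem_closedBall_self hδ.le))
  · refine (integrable_weight Γ).aestronglyMeasurable.smul ?_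
    refine (measurable_comp_box Γ (f := fun x => D (x, u₀)) ?_).aestronglyMeasurable
    exact hDc.comp (f := fun x => (x, u₀)) (by fun_prop) fun x hx => ⟨hx, mem_closedBall_self hδ.le⟩
  · refine Eventually.of_forall fun t u hu => ?_
    rw [norm_smul]
    exact mul_le_mul_of_nonneg_left (hB _ ⟨mem_box Γ t, ball_subset_closedBall hu⟩) (norm_nonneg _)
  · exact (integrable_weight Γ).norm.mul_const B
  · refine Eventually.of_forall fun t u hu => ?_
    have h1 := (han _ (mem_box Γ t) u (ball_subset_closedBall hu)).differentiableAt.hasFDerivAt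
    have h2 := (h1.comp u (hasFDerivAt_prodMk_right (fun μ => (Γ μ).c (t μ)) u))
    have h3 := h2.const_mul (∏ μ, (Γ μ).w (t μ))
    exact h3

end

end Cycle
end
end SmirnovIntegral

namespace SmirnovIntegral
open scoped BigOperators Topology
noncomputable section

/-! ### The infinite products -/

section qPoch

variable {p : ℂ}

lemma summable_norm_qPoch (hp : ‖p‖ < 1) (y : ℂ) : Summable fun k : ℕ => ‖-(y * p ^ k)‖ := by
  simp only [norm_neg, norm_mul, norm_pow]
  exact (summable_geometric_of_lt_one (norm_nonneg _) hp).mul_left _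

lemma multipliable_qPoch (hp : ‖p‖ < 1) (y : ℂ) : Multipliable fun k : ℕ => 1 - y * p ^ k := by
  have := multipliable_one_add_of_summable (summable_norm_qPoch hp y)
  simpa only [sub_eq_add_neg] using this

lemma qPoch_eq_mul (hp : ‖p‖ < 1) (y : ℂ) : qPoch y p = (1 - y) * qPoch (y * p) p := by
  have h1 : (fun k : ℕ => 1 - y * p * p ^ k) = fun k : ℕ => 1 - y * p ^ (k + 1) := by
    ext k; ring
  have h2 : Multipliable fun k : ℕ => 1 - y * p ^ (k + 1) := h1 ▸ multipliable_qPoch hp (y * p)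
  unfold qPoch
  rw [h1, tprod_eq_zero_mul' (f := fun k : ℕ => 1 - y * p ^ k) h2, pow_zero, mul_one]

lemma qPoch_ne_zero (hp : ‖p‖ < 1) {y : ℂ} (h : ∀ k : ℕ, y * p ^ k ≠ 1) : qPoch y p ≠ 0 := by
  unfold qPoch
  simp only [sub_eq_add_neg]
  refine tprod_one_add_ne_zero_of_summable (fun k => ?_) (summable_norm_qPoch hp y)
  rw [← sub_eq_add_neg, sub_ne_zero]
  exact (h k).symm

lemma differentiable_qPoch (hp : ‖p‖ < 1) : Differentiable ℂ fun y => qPoch y p := by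
  intro y
  have hprod : HasProdLocallyUniformlyOn (fun (k : ℕ) (y : ℂ) => 1 + -(y * p ^ k))
      (fun y => ∏' k : ℕ, (1 + -(y * p ^ k))) (Metric.ball 0 (‖y‖ + 1)) := by
    refine Summable.hasProdLocallyUniformlyOn_nat_one_add Metric.isOpen_ball
      (u := fun k => (‖y‖ + 1) * ‖p‖ ^ k)
      ((summable_geometric_of_lt_one (norm_nonneg _) hp).mul_left _)
      (Filter.Eventually.of_forall fun k x hx => ?_) (fun k => by fun_prop)
    rw [norm_neg, norm_mul, norm_pow]
    exact mul_le_mul_of_nonneg_right (mem_ball_zero_iff.1 hx).le (by positivity)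
  have := hprod.differentiableOn (.of_forall fun s ↦ by
    exact DifferentiableOn.fun_finsetProd fun _ _ ↦ by fun_prop) Metric.isOpen_ball
  have h2 := this.differentiableAt (x := y) (Metric.isOpen_ball.mem_nhds (by simp))
  simpa [qPoch, sub_eq_add_neg] using h2

lemma analyticAt_qPoch (hp : ‖p‖ < 1) (y : ℂ) : AnalyticAt ℂ (fun y => qPoch y p) y :=
  (differentiable_qPoch hp).analyticAt y

end qPoch

/-! ### The one-variable kernel -/

/-- One factor of the kernel. -/
def kfac (p a b ξ : ℂ) : ℂ := (qPoch (ξ / b) p * qPoch (a / ξ) p)⁻¹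

/-- The kernel with inner poles `a_j p^k` and outer poles `b_j p^(-k)`. -/
def ker (p : ℂ) {ι : Type*} [Fintype ι] (a b : ι → ℂ) (ξ : ℂ) : ℂ := ∏ j, kfac p (a j) (b j) ξ

/-- The factor cancels the first outer pole, so the remaining ones start at b/p. The point ξ = b
must be excluded, since there the left-hand side is 0 by the convention for division. -/
lemma kfac_mul_outer {p a b ξ : ℂ} (hp : ‖p‖ < 1) (hp0 : p ≠ 0) (hb : b ≠ 0) (h : ξ ≠ b) :
    (1 - ξ / b) * kfac p a b ξ = kfac p a (b / p) ξ := by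
  have h1 : 1 - ξ / b ≠ 0 := by
    rw [sub_ne_zero]
    intro h2
    exact h ((div_eq_one_iff_eq hb).1 h2.symm)
  have h3 : ξ / (b / p) = ξ / b * p := by field_simp
  unfold kfac
  rw [qPoch_eq_mul hp (ξ / b), h3]
  field_simp

lemma kfac_mul_inner {p a b ξ : ℂ} (hp : ‖p‖ < 1) (hξ : ξ ≠ 0) (h : ξ ≠ a) :
    (1 - a / ξ) * kfac p a b ξ = kfac p (a * p) b ξ := by
  have h1 : 1 - a / ξ ≠ 0 := by
    rw [sub_ne_zero]
    intro h2
    exact h ((div_eq_one_iff_eq hξ).1 h2.symm).symm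
  have h3 : a * p / ξ = a / ξ * p := by ring
  unfold kfac
  rw [qPoch_eq_mul hp (a / ξ), h3]
  field_simp

/-- Only the ratios ξ/b and a/ξ enter, so dilating the variable trades a shift of the outer poles
for one of the inner poles. -/
lemma kfac_scale {p a b ξ : ℂ} (hp0 : p ≠ 0) :
    kfac p a (b / p) (p⁻¹ * ξ) = kfac p (a * p) b ξ := by
  unfold kfac
  have h1 : p⁻¹ * ξ / (b / p) = ξ / b := by field_simp
  have h2 : a / (p⁻¹ * ξ) = a * p / ξ := by field_simp
  rw [h1, h2]

/-- The poles may vary with the parameter, so that this serves both for x alone and for joint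
analyticity in x and log z. -/
lemma analyticAt_kfac {E : Type*} [NormedAddCommGroup E] [NormedSpace ℂ E] {p : ℂ}
    (hp : ‖p‖ < 1) {a b ξ : E → ℂ} {e : E} (ha : AnalyticAt ℂ a e) (hb : AnalyticAt ℂ b e)
    (hξ : AnalyticAt ℂ ξ e) (hξ0 : ξ e ≠ 0) (hb0 : b e ≠ 0) (h1 : ∀ k : ℕ, ξ e * p ^ k ≠ b e)
    (h2 : ∀ k : ℕ, a e * p ^ k ≠ ξ e) : AnalyticAt ℂ (fun e => kfac p (a e) (b e) (ξ e)) e := by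
  refine AnalyticAt.inv (AnalyticAt.mul ?_ ?_) (mul_ne_zero ?_ ?_)
  · exact (analyticAt_qPoch hp _).comp (hξ.div hb hb0)
  · exact (analyticAt_qPoch hp _).comp (ha.div hξ hξ0)
  · refine qPoch_ne_zero hp fun k hk => h1 k ?_
    field_simp at hk
    exact hk
  · refine qPoch_ne_zero hp fun k hk => h2 k ?_
    field_simp at hk
    exact hk

lemma analyticAt_ker {ι E : Type*} [Fintype ι] [NormedAddCommGroup E] [NormedSpace ℂ E] {p : ℂ}
    (hp : ‖p‖ < 1) {a b : E → ι → ℂ} {ξ : E → ℂ} {e : E}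
    (ha : ∀ j, AnalyticAt ℂ (fun e => a e j) e) (hb : ∀ j, AnalyticAt ℂ (fun e => b e j) e)
    (hξ : AnalyticAt ℂ ξ e) (hξ0 : ξ e ≠ 0) (hb0 : ∀ j, b e j ≠ 0)
    (h1 : ∀ j (k : ℕ), ξ e * p ^ k ≠ b e j)
    (h2 : ∀ j (k : ℕ), a e j * p ^ k ≠ ξ e) : AnalyticAt ℂ (fun e => ker p (a e) (b e) (ξ e)) e := by
  unfold ker
  exact Finset.analyticAt_fun_prod _ fun j _ =>
    analyticAt_kfac hp (ha j) (hb j) hξ hξ0 (hb0 j) (h1 j) (h2 j)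

/-- A cycle winding once around `0` and around the inner poles, and not around the outer ones. -/
structure Good (p : ℂ) {ι : Type*} (a b : ι → ℂ) (Γ : Cycle) : Prop where
  zero : 0 ∉ Γ.K ∧ Γ.wind 0 = 2 * Real.pi * Complex.I
  inner : ∀ j (k : ℕ), a j * p ^ k ∉ Γ.K ∧ Γ.wind (a j * p ^ k) = 2 * Real.pi * Complex.I
  outer : ∀ j (k : ℕ), b j * p⁻¹ ^ k ∉ Γ.K ∧ Γ.wind (b j * p⁻¹ ^ k) = 0

section

variable {ι : Type*} {p : ℂ} {a b : ι → ℂ} {Γ Γ' : Cycle}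

lemma Good.ne_zero (h : Good p a b Γ) {x : ℂ} (hx : x ∈ Γ.K) : x ≠ 0 := by
  rintro rfl; exact h.zero.1 hx

lemma Good.ne_inner (h : Good p a b Γ) {x : ℂ} (hx : x ∈ Γ.K) (j : ι) (k : ℕ) : a j * p ^ k ≠ x := by
  rintro rfl; exact (h.inner j k).1 hx

lemma Good.ne_outer (h : Good p a b Γ) (hp0 : p ≠ 0) {x : ℂ} (hx : x ∈ Γ.K) (j : ι) (k : ℕ) :
    x * p ^ k ≠ b j := by
  intro h1
  refine (h.outer j k).1 ?_
  rwa [← h1, inv_pow, mul_inv_cancel_right₀ (pow_ne_zero _ hp0)]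

lemma analyticAt_ker_self [Fintype ι] (hp : ‖p‖ < 1) {x : ℂ} (hx : x ≠ 0) (hb : ∀ j, b j ≠ 0)
    (h1 : ∀ j (k : ℕ), x * p ^ k ≠ b j) (h2 : ∀ j (k : ℕ), a j * p ^ k ≠ x) :
    AnalyticAt ℂ (ker p a b) x :=
  analyticAt_ker hp (fun _ => analyticAt_const) (fun _ => analyticAt_const) analyticAt_id hx hb h1 h2

lemma Good.analyticAt_ker [Fintype ι] (h : Good p a b Γ) (hp : ‖p‖ < 1) (hp0 : p ≠ 0) (hb : ∀ j, b j ≠ 0)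
    {x : ℂ} (hx : x ∈ Γ.K) : AnalyticAt ℂ (ker p a b) x :=
  analyticAt_ker_self hp (h.ne_zero hx) hb (h.ne_outer hp0 hx) (h.ne_inner hx)

/-- Contour independence in one variable. -/
theorem Good.int_eq [Fintype ι] (h : Good p a b Γ) (h' : Good p a b Γ') (hp : ‖p‖ < 1) (hp0 : p ≠ 0)
    (hb : ∀ j, b j ≠ 0) {g : ℂ → ℂ} (hg : ∀ x, x ≠ 0 → AnalyticAt ℂ g x) :
    Γ.int (fun x => g x * ker p a b x) = Γ'.int fun x => g x * ker p a b x := by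
  refine Cycle.int_eq_of_agree Γ Γ' ?_ ?_ ?_
  · exact fun x hx => (hg x (h.ne_zero hx)).mul (h.analyticAt_ker hp hp0 hb hx)
  · exact fun x hx => (hg x (h'.ne_zero hx)).mul (h'.analyticAt_ker hp hp0 hb hx)
  -- A point where the integrand is not analytic is 0, an inner pole or an outer pole, and at those
  -- a good cycle has a prescribed winding number.
  · intro z
    by_cases h0 : z = 0
    · subst h0
      exact Or.inr ⟨h.zero.1, h'.zero.1, h.zero.2.trans h'.zero.2.symm⟩
    by_cases h1 : ∃ j, ∃ k : ℕ, z * p ^ k = b j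
    · obtain ⟨j, k, hk⟩ := h1
      have hz : z = b j * p⁻¹ ^ k := by
        rw [← hk, inv_pow, mul_inv_cancel_right₀ (pow_ne_zero _ hp0)]
      right
      rw [hz]
      exact ⟨(h.outer j k).1, (h'.outer j k).1, (h.outer j k).2.trans (h'.outer j k).2.symm⟩
    by_cases h2 : ∃ j, ∃ k : ℕ, a j * p ^ k = z
    · obtain ⟨j, k, rfl⟩ := h2
      exact Or.inr ⟨(h.inner j k).1, (h'.inner j k).1, (h.inner j k).2.trans (h'.inner j k).2.symm⟩
    push Not at h1 h2
    exact Or.inl ((hg z h0).mul (analyticAt_ker_self hp h0 hb h1 h2))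

end

/-! ### Dilating a cycle -/

open MeasureTheory in
/-- The image of a cycle under multiplication by `s ≠ 0`. -/
def Cycle.scale (Γ : Cycle) (s : ℂ) (hs : s ≠ 0) : Cycle where
  c t := s * Γ.c t
  w t := s * Γ.w t
  m := Γ.m
  K := (fun x => s * x) '' Γ.K
  finite := Γ.finite
  compact := Γ.compact.image (by fun_prop)
  meas := Γ.meas.const_mul s
  mem t := ⟨_, Γ.mem t, rfl⟩
  integrable := Γ.integrable.const_mul s
  closed_const := by rw [integral_const_mul, Γ.closed_const, mul_zero]
  closed z hz := by
    have h1 : z / s ∉ Γ.K := fun h => hz ⟨_, h, by field_simp⟩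
    have h2 : (fun t => s * Γ.w t * ((s * Γ.c t - z) ^ 2)⁻¹) =
        fun t => s⁻¹ * (Γ.w t * ((Γ.c t - z / s) ^ 2)⁻¹) := by
      ext t
      have h3 : s * Γ.c t - z = s * (Γ.c t - z / s) := by field_simp
      rw [h3, mul_pow, mul_inv]
      field_simp
    rw [h2, integral_const_mul, Γ.closed _ h1, mul_zero]

lemma Cycle.int_scale (Γ : Cycle) {s : ℂ} (hs : s ≠ 0) (f : ℂ → ℂ) :
    (Γ.scale s hs).int f = Γ.int fun x => s * f (s * x) := by
  unfold Cycle.int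
  congr 1
  ext t
  simp only [Cycle.scale]
  ring

lemma Cycle.mem_scale (Γ : Cycle) {s : ℂ} (hs : s ≠ 0) {z : ℂ} :
    s * z ∈ (Γ.scale s hs).K ↔ z ∈ Γ.K := by
  constructor
  · rintro ⟨y, hy, hyz⟩
    rwa [← mul_left_cancel₀ hs hyz]
  · exact fun h => ⟨z, h, rfl⟩

lemma Cycle.wind_scale (Γ : Cycle) {s : ℂ} (hs : s ≠ 0) (z : ℂ) :
    (Γ.scale s hs).wind (s * z) = Γ.wind z := by
  unfold Cycle.wind
  rw [Γ.int_scale hs]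
  refine Γ.int_congr fun x _ => ?_
  rw [← mul_sub, mul_inv, ← mul_assoc, mul_inv_cancel₀ hs, one_mul]

/-! ### Total differences of the one-variable kernel. -/

section

variable {ι : Type*} {p : ℂ} {a b : ι → ℂ} {Γ : Cycle}

lemma Good.outer_div (h : Good p a b Γ) : Good p a (fun j => b j / p) Γ where
  zero := h.zero
  inner := h.inner
  outer j k := by
    have := h.outer j (k + 1)
    rwa [pow_succ', ← mul_assoc, ← div_eq_mul_inv] at this

/-- Each a_j p^k is p⁻¹ times the inner pole a_j p^(k+1), so it is encircled by p⁻¹Γ. With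
`Good.outer_div`, Γ and p⁻¹Γ are good for the same poles a, b/p, hence interchangeable: the dilation
crosses no pole. -/
lemma Good.scale (h : Good p a b Γ) (hp0 : p ≠ 0) :
    Good p a (fun j => b j / p) (Γ.scale p⁻¹ (inv_ne_zero hp0)) where
  zero := by
    have h0 : (0 : ℂ) = p⁻¹ * 0 := by simp
    rw [h0, Cycle.mem_scale, Cycle.wind_scale]
    exact h.zero
  inner j k := by
    have h0 : a j * p ^ k = p⁻¹ * (a j * p ^ (k + 1)) := by field_simp; ring
    rw [h0, Cycle.mem_scale, Cycle.wind_scale]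
    exact h.inner j (k + 1)
  outer j k := by
    have h0 : b j / p * p⁻¹ ^ k = p⁻¹ * (b j * p⁻¹ ^ k) := by ring
    rw [h0, Cycle.mem_scale, Cycle.wind_scale]
    exact h.outer j k

/-- Total differences integrate to zero: here `g` satisfies a first-order difference
equation compensating the one of the kernel. -/
theorem Good.int_difference [Fintype ι] (h : Good p a b Γ) (hp : ‖p‖ < 1) (hp0 : p ≠ 0)
    (hb : ∀ j, b j ≠ 0) {g : ℂ → ℂ} (hg : ∀ x, x ≠ 0 → AnalyticAt ℂ g x) :
    Γ.int (fun x => (∏ j, (1 - x / b j)) * g x * ker p a b x) =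
      Γ.int fun x => p⁻¹ * ((∏ j, (1 - a j / x)) * g (p⁻¹ * x) * ker p a b x) := by
  -- Integrate g against the kernel with poles a, b/p over Γ and over p⁻¹Γ. On Γ this kernel is ∏(1
  -- − x/b_j) times the original one; after the substitution x ↦ p⁻¹x it is ∏(1 − a_j/x) times the
  -- original one.
  have h1 := h.outer_div.int_eq (h.scale hp0) hp hp0 (fun j => div_ne_zero (hb j) hp0) hg
  rw [Cycle.int_scale] at h1
  refine Eq.trans (Γ.int_congr fun x hx => ?_) (h1.trans (Γ.int_congr fun x hx => ?_))
  · unfold ker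
    rw [mul_comm (∏ j, (1 - x / b j)), mul_assoc, ← Finset.prod_mul_distrib]
    congr 1
    refine Finset.prod_congr rfl fun j _ => kfac_mul_outer hp hp0 (hb j) ?_
    have := h.ne_outer hp0 hx j 0
    rwa [pow_zero, mul_one] at this
  · unfold ker
    rw [mul_comm (∏ j, (1 - a j / x)), mul_assoc (g _), ← Finset.prod_mul_distrib]
    congr 2
    refine Finset.prod_congr rfl fun j _ => ?_
    rw [kfac_scale hp0, kfac_mul_inner hp (h.ne_zero hx)]
    have := h.ne_inner hx j 0
    rw [pow_zero, mul_one] at this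
    exact this.symm

end

end
end SmirnovIntegral

namespace SmirnovIntegral
open scoped BigOperators Topology
noncomputable section

open Polynomial

/-! ### The alternating form on polynomials defined by a kernel -/

/-- Evaluation of a polynomial at the `n` points `x_μ`. -/
def evalAt {n : ℕ} (x : Fin n → ℂ) : ℂ[X] →ₗ[ℂ] (Fin n → ℂ) := LinearMap.pi fun μ => leval (x μ)

/-- The determinant `det (P_λ(x_μ))` as an alternating function of the polynomials. -/
def detEval {n : ℕ} (x : Fin n → ℂ) : ℂ[X] [⋀^Fin n]→ₗ[ℂ] ℂ :=
  Matrix.detRowAlternating.compLinearMap (evalAt x)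

lemma detEval_apply {n : ℕ} (x : Fin n → ℂ) (P : Fin n → ℂ[X]) :
    detEval x P = (Matrix.of fun i μ => (P i).eval (x μ)).det := rfl

lemma continuous_detEval {n : ℕ} (P : Fin n → ℂ[X]) : Continuous fun x => detEval x P := by
  simp only [detEval_apply]
  refine Continuous.matrix_det (continuous_matrix fun i μ => ?_)
  exact (P i).continuous.comp (continuous_apply μ)

lemma analyticAt_detEval {n : ℕ} (P : Fin n → ℂ[X]) (x : Fin n → ℂ) :
    AnalyticAt ℂ (fun x => detEval x P) x := by
  simp only [detEval_apply, Matrix.det_apply']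
  refine Finset.analyticAt_fun_sum _ fun σ _ => analyticAt_const.mul ?_
  refine Finset.analyticAt_fun_prod _ fun μ _ => ?_
  have h : AnalyticAt ℂ (fun y : ℂ => (P (σ μ)).eval y) (x μ) :=
    (P (σ μ)).differentiable.analyticAt _
  exact h.comp (f := fun x : Fin n → ℂ => x μ)
    ((ContinuousLinearMap.proj (R := ℂ) (φ := fun _ : Fin n => ℂ) μ).analyticAt x)

lemma detEval_mul {n : ℕ} (x : Fin n → ℂ) (c : ℂ[X]) (P : Fin n → ℂ[X]) :
    detEval x (fun i => c * P i) = (∏ μ, c.eval (x μ)) * detEval x P := by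
  simp only [detEval_apply, eval_mul]
  exact Matrix.det_mul_row (fun μ => c.eval (x μ)) (Matrix.of fun i μ => (P i).eval (x μ))

/-- Integration of `det (P_λ(x_μ)) k(x)` over the `n`-th power of a cycle. -/
def altInt {n : ℕ} (Γ : Cycle) (k : (Fin n → ℂ) → ℂ)
    (hk : ContinuousOn k (Cycle.box fun _ : Fin n => Γ)) : ℂ[X] [⋀^Fin n]→ₗ[ℂ] ℂ where
  toFun P := Cycle.multi (fun _ => Γ) fun x => detEval x P * k x
  map_update_add' P i a b := by
    rename_i inst
    obtain rfl : inst = instDecidableEqFin n := Subsingleton.elim _ _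
    have h : ∀ P, ContinuousOn (fun x => detEval x P * k x) (Cycle.box fun _ : Fin n => Γ) :=
      fun P => (continuous_detEval P).continuousOn.mul hk
    rw [← Cycle.multi_add _ (h _) (h _)]
    simp only [AlternatingMap.map_update_add, add_mul]
  map_update_smul' P i c a := by
    rename_i inst
    obtain rfl : inst = instDecidableEqFin n := Subsingleton.elim _ _
    simp only [AlternatingMap.map_update_smul, smul_eq_mul, mul_assoc, Cycle.multi_const_mul]
  map_eq_zero_of_eq' P i j hij hne := by
    simp only [AlternatingMap.map_eq_zero_of_eq _ P hij hne, zero_mul, Cycle.multi_zero]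

lemma altInt_apply {n : ℕ} (Γ : Cycle) (k : (Fin n → ℂ) → ℂ)
    (hk : ContinuousOn k (Cycle.box fun _ : Fin n => Γ)) (P : Fin n → ℂ[X]) :
    altInt Γ k hk P = Cycle.multi (fun _ => Γ) fun x => detEval x P * k x := rfl

/-- The form vanishes if one of the polynomials integrates to zero against all slices of `k`. -/
lemma altInt_eq_zero {n : ℕ} (Γ : Cycle) (k : (Fin n → ℂ) → ℂ)
    (hk : ContinuousOn k (Cycle.box fun _ : Fin n => Γ)) {P : Fin n → ℂ[X]} (l : Fin n)
    (h : ∀ i, ∀ x ∈ Cycle.box fun _ : Fin n => Γ,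
      Γ.int (fun ξ => (P l).eval ξ * k (Function.update x i ξ)) = 0) : altInt Γ k hk P = 0 := by
  have hcont : ∀ σ : Equiv.Perm (Fin n), ContinuousOn
      (fun x : Fin n → ℂ => (((Equiv.Perm.sign σ : ℤ) : ℂ) * ∏ μ, (P (σ μ)).eval (x μ)) * k x)
      (Cycle.box fun _ : Fin n => Γ) := fun σ => by
    refine ContinuousOn.mul (Continuous.continuousOn ?_) hk
    refine continuous_const.mul (continuous_finsetProd _ fun μ _ => ?_)
    exact (P (σ μ)).continuous.comp (continuous_apply μ)
  rw [altInt_apply]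
  simp only [detEval_apply, Matrix.det_apply', Matrix.of_apply, Finset.sum_mul]
  rw [Cycle.multi_sum _ _ fun σ _ => hcont σ]
  refine Finset.sum_eq_zero fun σ _ => ?_
  -- In the term of σ the polynomial P l stands in the variable with index σ⁻¹ l; that variable is
  -- integrated first.
  refine Cycle.multi_eq_zero_of_int _ (σ⁻¹ l) (hcont σ) fun x hx => ?_
  have h1 : ∀ ξ, ∏ μ, (P (σ μ)).eval (Function.update x (σ⁻¹ l) ξ μ) =
      (P l).eval ξ * ∏ μ ∈ Finset.univ.erase (σ⁻¹ l), (P (σ μ)).eval (x μ) := by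
    intro ξ
    rw [← Finset.mul_prod_erase _ _ (Finset.mem_univ (σ⁻¹ l))]
    simp only [Function.update_self, Equiv.Perm.inv_def, Equiv.apply_symm_apply]
    congr 1
    refine Finset.prod_congr rfl fun μ hμ => ?_
    rw [Function.update_of_ne (Finset.ne_of_mem_erase hμ)]
  simp only [h1]
  rw [Γ.int_congr (g := fun ξ => (((Equiv.Perm.sign σ : ℤ) : ℂ) *
    ∏ μ ∈ Finset.univ.erase (σ⁻¹ l), (P (σ μ)).eval (x μ)) *
      ((P l).eval ξ * k (Function.update x (σ⁻¹ l) ξ))) fun ξ _ => by ring,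
    Cycle.int_const_mul, h _ x hx, mul_zero]

/-! ### The `n`-variable kernel -/

section

variable {ι : Type*} {n : ℕ} {p : ℂ} {a b : ι → ℂ} {Γ Γ' : Cycle}

/-- The kernel in `n` variables. -/
def kern [Fintype ι] (p : ℂ) (a b : ι → ℂ) (Θ : (Fin n → ℂ) → ℂ) (x : Fin n → ℂ) : ℂ :=
  Θ x * ∏ μ, ker p a b (x μ)

lemma analyticAt_update {x : Fin n → ℂ} {i : Fin n} (ξ : ℂ) :
    AnalyticAt ℂ (fun ξ => Function.update x i ξ) ξ := by
  refine AnalyticAt.pi fun μ => ?_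
  by_cases h : μ = i
  · subst h; simp only [Function.update_self]; exact analyticAt_id
  · simpa [Function.update_of_ne h] using analyticAt_const

lemma continuousOn_kern [Fintype ι] {Θ : (Fin n → ℂ) → ℂ}
    (hΘ : AnalyticOnNhd ℂ Θ {x | ∀ μ, x μ ≠ 0}) (hp : ‖p‖ < 1)
    (hp0 : p ≠ 0) (hb : ∀ j, b j ≠ 0) {s : Set (Fin n → ℂ)}
    (hs : ∀ x ∈ s, ∀ μ, ∃ Γ : Cycle, Good p a b Γ ∧ x μ ∈ Γ.K) :
    ContinuousOn (kern p a b Θ) s := by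
  intro x hx
  refine ContinuousAt.continuousWithinAt (ContinuousAt.mul ?_ ?_)
  · refine (hΘ x fun μ => ?_).continuousAt
    obtain ⟨Γ, hΓ, hxΓ⟩ := hs x hx μ
    exact hΓ.ne_zero hxΓ
  · refine tendsto_finsetProd _ fun μ _ => ?_
    obtain ⟨Γ, hΓ, hxΓ⟩ := hs x hx μ
    exact (hΓ.analyticAt_ker hp hp0 hb hxΓ)
      |>.continuousAt.comp (f := fun x : Fin n → ℂ => x μ) (continuous_apply μ).continuousAt

lemma Good.continuousOn_kern [Fintype ι] (h : Good p a b Γ) {Θ : (Fin n → ℂ) → ℂ}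
    (hΘ : AnalyticOnNhd ℂ Θ {x | ∀ μ, x μ ≠ 0}) (hp : ‖p‖ < 1)
    (hp0 : p ≠ 0) (hb : ∀ j, b j ≠ 0) :
    ContinuousOn (kern p a b Θ) (Cycle.box fun _ : Fin n => Γ) :=
  SmirnovIntegral.continuousOn_kern hΘ hp hp0 hb fun _ hx μ => ⟨Γ, h, hx μ⟩

lemma kern_update [Fintype ι] (Θ : (Fin n → ℂ) → ℂ) (x : Fin n → ℂ) (i : Fin n) (ξ : ℂ) :
    kern p a b Θ (Function.update x i ξ) =
      (Θ (Function.update x i ξ) * ∏ μ ∈ Finset.univ.erase i, ker p a b (x μ)) * ker p a b ξ := by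
  unfold kern
  rw [← Finset.mul_prod_erase _ _ (Finset.mem_univ i), Function.update_self]
  rw [Finset.prod_congr rfl fun μ hμ => by rw [Function.update_of_ne (Finset.ne_of_mem_erase hμ)]]
  ring

/-- Contour independence of the `n`-fold integral. -/
theorem Good.multi_eq [Fintype ι] (h : Good p a b Γ) (h' : Good p a b Γ') (hp : ‖p‖ < 1)
    (hp0 : p ≠ 0) (hb : ∀ j, b j ≠ 0) {Θ : (Fin n → ℂ) → ℂ}
    (hΘ : AnalyticOnNhd ℂ Θ {x | ∀ μ, x μ ≠ 0}) :
    Cycle.multi (fun _ => Γ) (kern p a b Θ) = Cycle.multi (fun _ => Γ') (kern p a b Θ) := by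
  have hmem : ∀ x : ℂ, x ∈ Γ.K ∪ Γ'.K → ∃ Γ : Cycle, Good p a b Γ ∧ x ∈ Γ.K := by
    rintro x (hx | hx)
    exacts [⟨Γ, h, hx⟩, ⟨Γ', h', hx⟩]
  refine Cycle.multi_eq_multi _ _
    (SmirnovIntegral.continuousOn_kern hΘ hp hp0 hb fun x hx μ => hmem _ (hx μ)) fun i x hx => ?_
  simp only [kern_update]
  refine h.int_eq h' hp hp0 hb fun ξ hξ => AnalyticAt.mul ?_ analyticAt_const
  refine (hΘ _ fun μ => ?_).comp (analyticAt_update ξ)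
  by_cases hμ : μ = i
  · subst hμ; simpa using hξ
  · rw [Function.update_of_ne hμ]
    obtain ⟨Δ, hΔ, hxΔ⟩ := hmem _ (hx μ)
    exact hΔ.ne_zero hxΔ

lemma ker_mul_outer [Fintype ι] [DecidableEq ι] (hp : ‖p‖ < 1) (hp0 : p ≠ 0) (i : ι) (hb : b i ≠ 0)
    {ξ : ℂ} (h : ξ ≠ b i) :
    (1 - ξ / b i) * ker p a b ξ = ker p a (Function.update b i (b i / p)) ξ := by
  unfold ker
  rw [← Finset.mul_prod_erase _ _ (Finset.mem_univ i),
    ← Finset.mul_prod_erase _ (fun j => kfac p (a j) (Function.update b i (b i / p) j) ξ)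
      (Finset.mem_univ i), ← mul_assoc, kfac_mul_outer hp hp0 hb h, Function.update_self]
  congr 1
  refine Finset.prod_congr rfl fun μ hμ => ?_
  rw [Function.update_of_ne (Finset.ne_of_mem_erase hμ)]

lemma ker_mul_inner [Fintype ι] [DecidableEq ι] (hp : ‖p‖ < 1) (i : ι) {ξ : ℂ} (hξ : ξ ≠ 0)
    (h : ξ ≠ a i) :
    (1 - a i / ξ) * ker p a b ξ = ker p (Function.update a i (a i * p)) b ξ := by
  unfold ker
  rw [← Finset.mul_prod_erase _ _ (Finset.mem_univ i),
    ← Finset.mul_prod_erase _ (fun j => kfac p (Function.update a i (a i * p) j) (b j) ξ)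
      (Finset.mem_univ i), ← mul_assoc, kfac_mul_inner hp hξ h, Function.update_self]
  congr 1
  refine Finset.prod_congr rfl fun μ hμ => ?_
  rw [Function.update_of_ne (Finset.ne_of_mem_erase hμ)]

lemma Good.update_outer [DecidableEq ι] (h : Good p a b Γ) (i : ι) :
    Good p a (Function.update b i (b i / p)) Γ where
  zero := h.zero
  inner := h.inner
  outer j k := by
    by_cases hj : j = i
    · subst hj
      rw [Function.update_self]
      exact h.outer_div.outer j k
    · rw [Function.update_of_ne hj]
      exact h.outer j k

lemma Good.update_inner [DecidableEq ι] (h : Good p a b Γ) (i : ι) :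
    Good p (Function.update a i (a i * p)) b Γ where
  zero := h.zero
  outer := h.outer
  inner j k := by
    by_cases hj : j = i
    · subst hj
      rw [Function.update_self, mul_assoc, ← pow_succ']
      exact h.inner j (k + 1)
    · rw [Function.update_of_ne hj]
      exact h.inner j k

/-- Comparison of the forms attached to the kernels before and after a shift of the
`i`-th parameter. -/
theorem Good.altInt_shift [Fintype ι] [DecidableEq ι] {a' b' : ι → ℂ} (i : ι) (h : Good p a b Γ)
    (h' : Good p a' b' Γ') (hp : ‖p‖ < 1) (hp0 : p ≠ 0) (hb : ∀ j, b j ≠ 0)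
    (ha' : a = Function.update a' i (a' i * p)) (hb' : b' = Function.update b i (b i / p))
    (hb0' : ∀ j, b' j ≠ 0)
    {Θ Θ' : (Fin n → ℂ) → ℂ} (hΘ : AnalyticOnNhd ℂ Θ {x | ∀ μ, x μ ≠ 0})
    (hΘ' : AnalyticOnNhd ℂ Θ' {x | ∀ μ, x μ ≠ 0})
    (hΘΘ' : ∀ x : Fin n → ℂ, (∀ μ, x μ ≠ 0) → Θ' x = Θ x * ∏ μ, (-(b i) / x μ))
    (G : Fin n → ℂ[X]) :
    altInt Γ' (kern p a' b' Θ') (h'.continuousOn_kern hΘ' hp hp0 hb0')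
        (fun l => (X - C (a' i)) * G l) =
      altInt Γ (kern p a b Θ) (h.continuousOn_kern hΘ hp hp0 hb) (fun l => (X - C (b i)) * G l) := by
  -- Both sides reduce to Φ times the kernel with inner poles a and outer poles b'. On Γ' the
  -- factors x − a'_i move the inner poles a'_i to a_i = a'_i p; on Γ the factors x − b_i move the
  -- outer poles b_i to b_i/p. For this common kernel Γ and Γ' are both good.
  set Φ : (Fin n → ℂ) → ℂ := fun x => detEval x G * ((-(b i)) ^ n * Θ x) with hΦ
  have hΦa : AnalyticOnNhd ℂ Φ {x | ∀ μ, x μ ≠ 0} := fun x hx =>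
    (analyticAt_detEval G x).mul (analyticAt_const.mul (hΘ x hx))
  have hgood : Good p a b' Γ := hb' ▸ h.update_outer i
  have hgood' : Good p a b' Γ' := ha' ▸ h'.update_inner i
  have key := hgood.multi_eq hgood' hp hp0 hb0' hΦa
  rw [altInt_apply, altInt_apply]
  refine Eq.trans (Cycle.multi_congr _ fun x hx => ?_)
    (key.symm.trans (Cycle.multi_congr _ fun x hx => ?_))
  · have hx0 : ∀ μ, x μ ≠ 0 := fun μ => h'.ne_zero (hx μ)
    have h1 : ∀ μ, ((X - C (a' i)).eval (x μ)) * ((-(b i) / x μ) * ker p a' b' (x μ)) =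
        -(b i) * ker p a b' (x μ) := by
      intro μ
      have h2 := h'.ne_inner (hx μ) i 0
      rw [pow_zero, mul_one] at h2
      rw [ha', ← ker_mul_inner hp i (hx0 μ) h2.symm]
      simp only [eval_sub, eval_X, eval_C]
      have := hx0 μ
      field_simp
    rw [detEval_mul, kern, kern, hΘΘ' x hx0, hΦ]
    have h3 := Finset.prod_congr (rfl : (Finset.univ : Finset (Fin n)) = _) fun μ _ => h1 μ
    simp only [Finset.prod_mul_distrib, Finset.prod_const, Finset.card_univ, Fintype.card_fin] at h3
    linear_combination (detEval x G * Θ x) * h3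
  · have h1 : ∀ μ, ((X - C (b i)).eval (x μ)) * ker p a b (x μ) = -(b i) * ker p a b' (x μ) := by
      intro μ
      have h2 := h.ne_outer hp0 (hx μ) i 0
      rw [pow_zero, mul_one] at h2
      rw [hb', ← ker_mul_outer hp hp0 i (hb i) h2]
      simp only [eval_sub, eval_X, eval_C]
      have := hb i
      field_simp
      ring
    rw [detEval_mul, kern, kern, hΦ]
    have h3 := Finset.prod_congr (rfl : (Finset.univ : Finset (Fin n)) = _) fun μ _ => h1 μ
    simp only [Finset.prod_mul_distrib, Finset.prod_const, Finset.card_univ, Fintype.card_fin] at h3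
    linear_combination - (detEval x G * Θ x) * h3

/-- Exact polynomials are in the kernel of the form. -/
theorem Good.altInt_exact [Fintype ι] {q : ℂ} (hq0 : q ≠ 0) {z : ι → ℂ}
    (hz : ∀ j, z j ≠ 0) (hp : ‖q ^ 4‖ < 1)
    (h : Good (q ^ 4) (fun j => z j * q) (fun j => z j * q⁻¹) Γ)
    {Θ : (Fin n → ℂ) → ℂ} (hΘ : AnalyticOnNhd ℂ Θ {x | ∀ μ, x μ ≠ 0})
    (hshift : ∀ (i : Fin n) (x : Fin n → ℂ), (∀ μ, x μ ≠ 0) →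
      Θ (Function.update x i (x i * q⁻¹ ^ 4)) = Θ x * ∏ j, (-(x i) * q⁻¹ / z j))
    (hk : ContinuousOn (kern (q ^ 4) (fun j => z j * q) (fun j => z j * q⁻¹) Θ)
      (Cycle.box fun _ : Fin n => Γ))
    {P : Fin n → ℂ[X]} (l : Fin n) (r : ℂ[X])
    (hP : X * P l = (∏ j, (X - C (z j * q⁻¹))) * r -
      C (q⁻¹ ^ (2 * Fintype.card ι)) * (∏ j, (X - C (z j * q))) * r.comp (C (q⁻¹ ^ 4) * X)) :
    altInt Γ (kern (q ^ 4) (fun j => z j * q) (fun j => z j * q⁻¹) Θ) hk P = 0 := by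
  have hp0 : q ^ 4 ≠ 0 := pow_ne_zero _ hq0
  have hb : ∀ j, z j * q⁻¹ ≠ 0 := fun j => mul_ne_zero (hz j) (inv_ne_zero hq0)
  refine altInt_eq_zero _ _ hk l fun i x hx => ?_
  have hx0 : ∀ μ, x μ ≠ 0 := fun μ => h.ne_zero (hx μ)
  have hxu : ∀ ξ, ξ ≠ 0 → ∀ μ, Function.update x i ξ μ ≠ 0 := by
    intro ξ hξ μ
    by_cases hμ : μ = i
    · subst hμ; simpa using hξ
    · rw [Function.update_of_ne hμ]; exact hx0 μ
  set K : ℂ := ∏ μ ∈ Finset.univ.erase i, ker (q ^ 4) (fun j => z j * q) (fun j => z j * q⁻¹) (x μ)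
    with hK
  -- The total difference of this g is, up to the constant c, the integrand with P l. Dividing by ξ
  -- absorbs the Jacobian p⁻¹ of the dilation, and the quasi-periodicity of Θ converts ∏(1 − z_j
  -- q/ξ) into the second product of `hP`.
  set g : ℂ → ℂ := fun ξ => r.eval ξ / ξ * Θ (Function.update x i ξ) with hg
  have hga : ∀ ξ, ξ ≠ 0 → AnalyticAt ℂ g ξ := fun ξ hξ =>
    ((r.differentiable.analyticAt ξ).div analyticAt_id hξ).mul
      ((hΘ _ (hxu ξ hξ)).comp (analyticAt_update ξ))
  have key := h.int_difference hp hp0 hb hga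
  set c : ℂ := ∏ j, (-q / z j) with hc
  have hcz : c ≠ 0 := Finset.prod_ne_zero_iff.2 fun j _ => div_ne_zero (neg_ne_zero.2 hq0) (hz j)
  have e1 : ∀ ξ : ℂ, ∏ j, (1 - ξ / (z j * q⁻¹)) = c * ∏ j, (ξ - z j * q⁻¹) := by
    intro ξ
    rw [hc, ← Finset.prod_mul_distrib]
    refine Finset.prod_congr rfl fun j _ => ?_
    have := hz j
    field_simp
    ring
  have e2 : ∀ ξ : ℂ, ξ ≠ 0 → (∏ j, (1 - z j * q / ξ)) * ∏ j, (-ξ * q⁻¹ / z j) =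
      c * (q⁻¹ ^ (2 * Fintype.card ι) * ∏ j, (ξ - z j * q)) := by
    intro ξ hξ
    have h0 : q⁻¹ ^ (2 * Fintype.card ι) = ∏ _j : ι, q⁻¹ ^ 2 := by
      rw [Finset.prod_const, Finset.card_univ, pow_mul]
    rw [hc, h0, ← Finset.prod_mul_distrib, ← Finset.prod_mul_distrib, ← Finset.prod_mul_distrib]
    refine Finset.prod_congr rfl fun j _ => ?_
    have := hz j
    field_simp
  have e3 : ∀ ξ : ℂ, ξ ≠ 0 → g ((q ^ 4)⁻¹ * ξ) = r.eval (q⁻¹ ^ 4 * ξ) / (q⁻¹ ^ 4 * ξ) *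
      (Θ (Function.update x i ξ) * ∏ j, (-ξ * q⁻¹ / z j)) := by
    intro ξ hξ
    have h1 := hshift i _ (hxu ξ hξ)
    simp only [Function.update_self, Function.update_idem] at h1
    rw [← h1, hg, ← inv_pow]
    simp only [mul_comm ξ]
  have e4 : ∀ ξ : ℂ, ξ * (P l).eval ξ = (∏ j, (ξ - z j * q⁻¹)) * r.eval ξ -
      q⁻¹ ^ (2 * Fintype.card ι) * (∏ j, (ξ - z j * q)) * r.eval (q⁻¹ ^ 4 * ξ) := by
    intro ξ
    have := congrArg (eval ξ) hP
    simpa [eval_prod] using this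
  have hkc : ContinuousOn (ker (q ^ 4) (fun j => z j * q) (fun j => z j * q⁻¹)) Γ.K :=
    fun ξ hξ => (h.analyticAt_ker hp hp0 hb hξ).continuousAt.continuousWithinAt
  have hT : ContinuousOn (fun ξ => Θ (Function.update x i ξ)) Γ.K := fun ξ hξ =>
    ((hΘ _ (hxu ξ (h.ne_zero hξ))).comp (analyticAt_update ξ)).continuousAt.continuousWithinAt
  have hinv : ContinuousOn (fun ξ : ℂ => ξ⁻¹) Γ.K :=
    continuousOn_id.inv₀ fun ξ hξ => h.ne_zero hξ
  -- The second function is the first minus c·P·Θ·ker, that is, the integrand of the shifted side.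
  -- By `key` the two integrals agree, so c·P·Θ·ker integrates to 0.
  have hsub := Γ.int_sub
    (f := fun ξ => (∏ j, (1 - ξ / (z j * q⁻¹))) * g ξ *
      ker (q ^ 4) (fun j => z j * q) (fun j => z j * q⁻¹) ξ)
    (g := fun ξ => (∏ j, (1 - ξ / (z j * q⁻¹))) * g ξ *
      ker (q ^ 4) (fun j => z j * q) (fun j => z j * q⁻¹) ξ -
      c * ((P l).eval ξ * Θ (Function.update x i ξ) *
      ker (q ^ 4) (fun j => z j * q) (fun j => z j * q⁻¹) ξ)) ?_ ?_
  · have e5 : (Γ.int fun ξ => (∏ j, (1 - ξ / (z j * q⁻¹))) * g ξ *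
        ker (q ^ 4) (fun j => z j * q) (fun j => z j * q⁻¹) ξ -
        c * ((P l).eval ξ * Θ (Function.update x i ξ) *
        ker (q ^ 4) (fun j => z j * q) (fun j => z j * q⁻¹) ξ)) =
        Γ.int fun ξ => (q ^ 4)⁻¹ * ((∏ j, (1 - z j * q / ξ)) * g ((q ^ 4)⁻¹ * ξ) *
          ker (q ^ 4) (fun j => z j * q) (fun j => z j * q⁻¹) ξ) := by
      refine Γ.int_congr fun ξ hξ => ?_
      have hξ0 := h.ne_zero hξ
      have e2' := e2 ξ hξ0
      have e4' : (P l).eval ξ = ((∏ j, (ξ - z j * q⁻¹)) * r.eval ξ -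
        q⁻¹ ^ (2 * Fintype.card ι) * (∏ j, (ξ - z j * q)) * r.eval (q⁻¹ ^ 4 * ξ)) / ξ := by
        rw [← e4 ξ, mul_div_cancel_left₀ _ hξ0]
      have e6 : (q ^ 4)⁻¹ * (r.eval (q⁻¹ ^ 4 * ξ) / (q⁻¹ ^ 4 * ξ)) = r.eval (q⁻¹ ^ 4 * ξ) / ξ := by
        field_simp
      rw [e1, e3 ξ hξ0, e4', hg]
      linear_combination (-(r.eval (q⁻¹ ^ 4 * ξ) / ξ) * Θ (Function.update x i ξ) *
          ker (q ^ 4) (fun j => z j * q) (fun j => z j * q⁻¹) ξ) * e2' -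
        ((∏ j, (1 - z j * q / ξ)) * (Θ (Function.update x i ξ) * ∏ j, (-ξ * q⁻¹ / z j)) *
          ker (q ^ 4) (fun j => z j * q) (fun j => z j * q⁻¹) ξ) * e6
    rw [key, e5, sub_self] at hsub
    simp only [sub_sub_cancel] at hsub
    rw [Γ.int_const_mul, mul_eq_zero] at hsub
    have h0 := hsub.resolve_left hcz
    simp only [kern_update]
    rw [Γ.int_congr (g := fun ξ => K * ((P l).eval ξ * Θ (Function.update x i ξ) *
      ker (q ^ 4) (fun j => z j * q) (fun j => z j * q⁻¹) ξ)) fun ξ _ => by rw [hK]; ring,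
      Γ.int_const_mul, h0, mul_zero]
  · refine ((Continuous.continuousOn (by fun_prop)).mul fun ξ hξ =>
      (hga ξ (h.ne_zero hξ)).continuousAt.continuousWithinAt).mul hkc
  · refine ContinuousOn.sub (((Continuous.continuousOn (by fun_prop)).mul fun ξ hξ =>
      (hga ξ (h.ne_zero hξ)).continuousAt.continuousWithinAt).mul hkc) ?_
    exact continuousOn_const.mul (((P l).continuous.continuousOn.mul hT).mul hkc)

end

end
end SmirnovIntegral

namespace SmirnovIntegral
open scoped BigOperators Topology
noncomputable section

/-! ### Cycles from closed paths, and sums of cycles -/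

namespace Cycle

open MeasureTheory Metric Set Filter

/-- The fundamental theorem of calculus for G ∘ γ, which is continuous and differentiable off a
finite set; the endpoint values cancel. -/
lemma integral_deriv_mul_eq_zero {γ : ℝ → ℂ} {a b : ℝ} (hab : a ≤ b)
    (hc : ContinuousOn γ (Icc a b))
    (hd : ∃ S : Finset ℝ, ∀ t ∈ Ioo a b, t ∉ S → DifferentiableAt ℝ γ t)
    (hi : IntervalIntegrable (deriv γ) volume a b) (hcl : γ a = γ b) {G g : ℂ → ℂ}
    (hG : ∀ t ∈ Icc a b, HasDerivAt G (g (γ t)) (γ t))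
    (hg : ContinuousOn (fun t => g (γ t)) (Icc a b)) :
    ∫ t in a..b, deriv γ t * g (γ t) = 0 := by
  obtain ⟨S, hS⟩ := hd
  rw [integral_eq_of_hasDerivAt_off_countable (fun t => G (γ t)) _ S.countable_toSet, hcl, sub_self]
  · rw [uIcc_of_le hab]
    exact fun t ht => (hG t ht).continuousAt.comp_continuousWithinAt (hc t ht)
  · rw [min_eq_left hab, max_eq_right hab]
    rintro t ⟨ht, htS⟩
    have h1 := (hS t ht htS).hasDerivAt
    have := (hG t (Ioo_subset_Icc_self ht)).comp_of_eq t h1 rfl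
    rw [mul_comm]
    exact this
  · exact hi.mul_continuousOn (by rwa [uIcc_of_le hab])

/-- The cycle defined by a closed piecewise differentiable path. -/
def ofPath (γ : ℝ → ℂ) (a b : ℝ) (hab : a ≤ b) (hc : ContinuousOn γ (Icc a b))
    (hd : ∃ S : Finset ℝ, ∀ t ∈ Ioo a b, t ∉ S → DifferentiableAt ℝ γ t)
    (hi : IntervalIntegrable (deriv γ) volume a b) (hcl : γ a = γ b) : Cycle where
  -- The path is frozen outside [a, b], so that it is continuous on the whole line and never leaves
  -- its support.
  c t := γ (projIcc a b hab t)
  w := deriv γ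
  m := volume.restrict (Ioc a b)
  K := γ '' Icc a b
  finite := inferInstance
  compact := isCompact_Icc.image_of_continuousOn hc
  meas := by
    have : Continuous fun t => γ (projIcc a b hab t) :=
      (continuousOn_iff_continuous_domRestrict.1 hc).comp continuous_projIcc
    exact this.measurable
  mem t := ⟨_, (projIcc a b hab t).2, rfl⟩
  integrable := (intervalIntegrable_iff_integrableOn_Ioc_of_le hab).1 hi
  closed_const := by
    have := integral_deriv_mul_eq_zero hab hc hd hi hcl (G := id) (g := fun _ => 1)
      (fun t _ => hasDerivAt_id _) continuousOn_const
    simpa [intervalIntegral.integral_of_le hab] using this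
  closed z hz := by
    have hne : ∀ t ∈ Icc a b, γ t - z ≠ 0 := fun t ht h =>
      hz ⟨t, ht, sub_eq_zero.1 h⟩
    have := integral_deriv_mul_eq_zero hab hc hd hi hcl (G := fun x => -(x - z)⁻¹)
      (g := fun x => ((x - z) ^ 2)⁻¹) (fun t ht => ?_) ?_
    · rw [intervalIntegral.integral_of_le hab] at this
      rw [← this]
      refine setIntegral_congr_fun measurableSet_Ioc fun t ht => ?_
      simp only [projIcc_of_mem hab (Ioc_subset_Icc_self ht)]
    · have := (((hasDerivAt_id (γ t)).sub_const z).inv (hne t ht)).neg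
      convert! this using 1
      simp [div_eq_mul_inv]
    · exact ((hc.sub continuousOn_const).pow 2).inv₀ fun t ht => pow_ne_zero 2 (hne t ht)

section ofPath

variable {γ : ℝ → ℂ} {a b : ℝ} {hab : a ≤ b} {hc : ContinuousOn γ (Icc a b)}
  {hd : ∃ S : Finset ℝ, ∀ t ∈ Ioo a b, t ∉ S → DifferentiableAt ℝ γ t}
  {hi : IntervalIntegrable (deriv γ) volume a b} {hcl : γ a = γ b}

lemma int_ofPath (f : ℂ → ℂ) :
    (ofPath γ a b hab hc hd hi hcl).int f = ∫ t in a..b, deriv γ t * f (γ t) := by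
  rw [intervalIntegral.integral_of_le hab]
  refine setIntegral_congr_fun measurableSet_Ioc fun t ht => ?_
  simp only [ofPath, projIcc_of_mem hab (Ioc_subset_Icc_self ht)]

lemma multi_ofPath {n : ℕ} {h01 : (0 : ℝ) ≤ 1} {hc : ContinuousOn γ (Icc 0 1)}
    {hd : ∃ S : Finset ℝ, ∀ t ∈ Ioo (0 : ℝ) 1, t ∉ S → DifferentiableAt ℝ γ t}
    {hi : IntervalIntegrable (deriv γ) volume 0 1} {hcl : γ 0 = γ 1} (f : (Fin n → ℂ) → ℂ) :
    multi (fun _ => ofPath γ 0 1 h01 hc hd hi hcl) f = multiContourIntegral γ f := by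
  have h1 : (Measure.pi fun _ : Fin n => (volume : Measure ℝ).restrict (Ioc 0 1)) =
      volume.restrict (Icc (0 : Fin n → ℝ) 1) := by
    -- Cycles use the half-open interval and contour integrals the closed one; they differ by a null
    -- set.
    have h2 : (volume : Measure ℝ).restrict (Ioc 0 1) = volume.restrict (Icc 0 1) :=
      Measure.restrict_congr_set Ioc_ae_eq_Icc
    rw [h2, ← Measure.restrict_pi_pi, ← volume_pi]
    congr 1
    exact pi_univ_Icc 0 1
  unfold multi multiContourIntegral
  rw [← h1]
  simp only [ofPath]
  rw [h1]
  refine setIntegral_congr_fun measurableSet_Icc fun t ht => ?_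
  have h3 : ∀ μ, t μ ∈ Icc (0 : ℝ) 1 := fun μ => ⟨ht.1 μ, ht.2 μ⟩
  simp only [projIcc_of_mem h01 (h3 _)]

end ofPath

/-- The positively oriented circle. -/
def circle (p : ℂ) (R : ℝ) : Cycle :=
  ofPath (circleMap p R) 0 (2 * Real.pi) Real.two_pi_pos.le (continuous_circleMap p R).continuousOn
    ⟨∅, fun t _ _ => differentiable_circleMap p R t⟩
    (by
      have : deriv (circleMap p R) = fun t => circleMap 0 R t * Complex.I := by
        ext t; exact deriv_circleMap p R t
      rw [this]
      exact ((continuous_circleMap 0 R).mul continuous_const).intervalIntegrable _ _)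
    (by simp [circleMap])

lemma circle_K_subset (p : ℂ) {R : ℝ} (hR : 0 ≤ R) : (circle p R).K ⊆ sphere p R := by
  rintro _ ⟨t, -, rfl⟩
  exact circleMap_mem_sphere p hR t

lemma wind_circle (p : ℂ) (R : ℝ) (z : ℂ) : (circle p R).wind z = ∮ x in C(p, R), (x - z)⁻¹ := by
  unfold wind circle
  rw [int_ofPath]
  rfl

lemma wind_circle_of_mem {p z : ℂ} {R : ℝ} (h : z ∈ ball p R) :
    (circle p R).wind z = 2 * Real.pi * Complex.I := by
  rw [wind_circle, circleIntegral.integral_sub_inv_of_mem_ball h]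

lemma wind_circle_of_notMem {p z : ℂ} {R : ℝ} (hR : 0 ≤ R) (h : z ∉ closedBall p R) :
    (circle p R).wind z = 0 := by
  rw [wind_circle]
  have hne : ∀ x ∈ closedBall p R, x - z ≠ 0 := fun x hx h0 => h (by rwa [← sub_eq_zero.1 h0])
  refine Complex.circleIntegral_eq_zero_of_differentiable_on_off_countable hR countable_empty ?_ ?_
  · exact (continuousOn_id.sub continuousOn_const).inv₀ hne
  · rintro x ⟨hx, -⟩
    exact (differentiableAt_id.sub_const z).inv (hne x (ball_subset_closedBall hx))

/-- The maps exp and −exp embed two disjoint copies of the line into ℝ, which puts the parameters of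
two cycles on one line. -/
lemma measurableEmbedding_exp : MeasurableEmbedding Real.exp :=
  Real.isOpenEmbedding_exp.measurableEmbedding

lemma measurableEmbedding_neg_exp : MeasurableEmbedding fun t => -Real.exp t :=
  (MeasurableEquiv.neg ℝ).measurableEmbedding.comp measurableEmbedding_exp

/-- Gluing of two functions on the line into one. -/
def glue (f g : ℝ → ℂ) (t : ℝ) : ℂ := if 0 < t then f (Real.log t) else g (Real.log t)

lemma glue_exp (f g : ℝ → ℂ) (t : ℝ) : glue f g (Real.exp t) = f t := by
  simp [glue, Real.exp_pos]

lemma glue_neg_exp (f g : ℝ → ℂ) (t : ℝ) : glue f g (-Real.exp t) = g t := by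
  simp [glue, (Real.exp_pos t).le]

lemma integral_glue (m m' : Measure ℝ) (F : ℝ → ℂ) (h : Integrable (fun t => F (Real.exp t)) m)
    (h' : Integrable (fun t => F (-Real.exp t)) m') :
    ∫ t, F t ∂(m.map Real.exp + m'.map fun t => -Real.exp t) =
      (∫ t, F (Real.exp t) ∂m) + ∫ t, F (-Real.exp t) ∂m' := by
  rw [integral_add_measure (measurableEmbedding_exp.integrable_map_iff.2 h)
    (measurableEmbedding_neg_exp.integrable_map_iff.2 h'), measurableEmbedding_exp.integral_map,
    measurableEmbedding_neg_exp.integral_map]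

lemma integrable_inv_sq (Γ : Cycle) {z : ℂ} (hz : z ∉ Γ.K) :
    Integrable (fun t => Γ.w t * ((Γ.c t - z) ^ 2)⁻¹) Γ.m :=
  Γ.integrable_comp (f := fun x => ((x - z) ^ 2)⁻¹)
    (((continuousOn_id.sub continuousOn_const).pow 2).inv₀ fun x hx h =>
      hz (by rw [← sub_eq_zero.1 (pow_eq_zero_iff two_ne_zero |>.1 h : x - z = 0)]; exact hx))

/-- The sum of two cycles. -/
def add (Γ Γ' : Cycle) : Cycle where
  c := glue Γ.c Γ'.c
  w := glue Γ.w Γ'.w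
  m := Γ.m.map Real.exp + Γ'.m.map fun t => -Real.exp t
  K := Γ.K ∪ Γ'.K
  finite := inferInstance
  compact := Γ.compact.union Γ'.compact
  meas := Measurable.ite measurableSet_Ioi (Γ.meas.comp Real.measurable_log)
    (Γ'.meas.comp Real.measurable_log)
  mem t := by
    unfold glue
    split_ifs
    exacts [Or.inl (Γ.mem _), Or.inr (Γ'.mem _)]
  integrable := by
    refine Integrable.add_measure (measurableEmbedding_exp.integrable_map_iff.2 ?_)
      (measurableEmbedding_neg_exp.integrable_map_iff.2 ?_)
    · simpa only [Function.comp_def, glue_exp] using Γ.integrable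
    · simpa only [Function.comp_def, glue_neg_exp] using Γ'.integrable
  closed_const := by
    rw [integral_glue] <;> simp only [glue_exp, glue_neg_exp]
    · rw [Γ.closed_const, Γ'.closed_const, add_zero]
    · exact Γ.integrable
    · exact Γ'.integrable
  closed z hz := by
    have h1 : z ∉ Γ.K := fun h => hz (Or.inl h)
    have h2 : z ∉ Γ'.K := fun h => hz (Or.inr h)
    rw [integral_glue] <;> simp only [glue_exp, glue_neg_exp]
    · rw [Γ.closed z h1, Γ'.closed z h2, add_zero]
    · exact Γ.integrable_inv_sq h1
    · exact Γ'.integrable_inv_sq h2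

lemma continuousOn_sub_inv (Γ : Cycle) {z : ℂ} (hz : z ∉ Γ.K) :
    ContinuousOn (fun x => (x - z)⁻¹) Γ.K :=
  (continuousOn_id.sub continuousOn_const).inv₀ fun x hx h =>
    hz (by rw [← sub_eq_zero.1 (show x - z = 0 from h)]; exact hx)

lemma wind_add (Γ Γ' : Cycle) {z : ℂ} (h : z ∉ Γ.K) (h' : z ∉ Γ'.K) :
    (Γ.add Γ').wind z = Γ.wind z + Γ'.wind z := by
  unfold wind int add
  simp only
  rw [integral_glue] <;> simp only [glue_exp, glue_neg_exp]
  · exact Γ.integrable_comp (Γ.continuousOn_sub_inv h)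
  · exact Γ'.integrable_comp (Γ'.continuousOn_sub_inv h')

end Cycle

/-! ### Contours are good cycles -/

/-- The closed path of an admissible contour, as a cycle. -/
def IsContour.cycle {q : ℂ} {ι : Type*} {z : ι → ℂ} {γ : ℝ → ℂ} (h : IsContour q z γ) : Cycle :=
  Cycle.ofPath γ 0 1 zero_le_one h.continuousOn
    (h.piecewise.imp fun _ hS t ht htS => (hS t ht htS).differentiableAt one_ne_zero)
    h.integrable h.closed

lemma Winds.wind_eq {γ : ℝ → ℂ} {p : ℂ} {m : ℤ} (hw : Winds γ p m) {q : ℂ} {ι : Type*} {z : ι → ℂ}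
    (h : IsContour q z γ) : p ∉ h.cycle.K ∧ h.cycle.wind p = 2 * Real.pi * Complex.I * m := by
  constructor
  · rintro ⟨t, ht, htp⟩
    exact hw.1 t ht htp
  · rw [← hw.2]
    unfold IsContour.cycle Cycle.wind
    rw [Cycle.int_ofPath]
    simp only [div_eq_mul_inv]

/-- The definition of a contour does not mention the winding number of 0. It is recovered from the
inner poles: z_j q^(1+4k) tends to 0 and the winding number is locally constant off the curve. This
requires at least one index j. -/
theorem IsContour.good {q : ℂ} (hq1 : ‖q‖ < 1) {ι : Type*} [Nonempty ι] {z : ι → ℂ}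
    {γ : ℝ → ℂ} (h : IsContour q z γ) :
    Good (q ^ 4) (fun j => z j * q) (fun j => z j * q⁻¹) h.cycle := by
  have hinner : ∀ j (k : ℕ), z j * q * (q ^ 4) ^ k ∉ h.cycle.K ∧
      h.cycle.wind (z j * q * (q ^ 4) ^ k) = 2 * Real.pi * Complex.I := by
    intro j k
    have := (h.encircles j k).wind_eq h
    rwa [pow_add, pow_one, pow_mul, ← mul_assoc, Int.cast_one, mul_one] at this
  have h0 : (0 : ℂ) ∉ h.cycle.K := by
    rintro ⟨t, ht, htp⟩
    exact h.ne_zero t ht htp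
  refine ⟨⟨h0, ?_⟩, hinner, fun j k => ?_⟩
  · obtain ⟨j⟩ := ‹Nonempty ι›
    have hlim : Filter.Tendsto (fun k : ℕ => z j * q * (q ^ 4) ^ k) Filter.atTop (𝓝 0) := by
      have : ‖q ^ 4‖ < 1 := by rw [norm_pow]; exact pow_lt_one₀ (norm_nonneg _) hq1 (by norm_num)
      simpa using (tendsto_pow_atTop_nhds_zero_of_norm_lt_one this).const_mul (z j * q)
    obtain ⟨k, hk⟩ := (hlim.eventually (h.cycle.eventually_wind_eq h0)).exists
    rw [← hk.2, (hinner j k).2]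
  · have := (h.excludes j k).wind_eq h
    rwa [pow_add, pow_one, pow_mul, ← mul_assoc, Int.cast_zero, mul_zero, inv_pow q 4] at this

end
end SmirnovIntegral

namespace SmirnovIntegral
open scoped BigOperators Topology
noncomputable section

open Metric Set Filter

/-! ### Stability and existence of good cycles -/

/-- For y near a, all but finitely many of the points y p^k lie in a fixed disc about 0 inside O,
uniformly in y; the finitely many remaining conditions are open. -/
lemma eventually_forall_mul_pow_mem {p : ℂ} (hp : ‖p‖ < 1) {O : Set ℂ} (hO : IsOpen O)
    (h0 : (0 : ℂ) ∈ O) {a : ℂ} (ha : ∀ k : ℕ, a * p ^ k ∈ O) :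
    ∀ᶠ y in 𝓝 a, ∀ k : ℕ, y * p ^ k ∈ O := by
  obtain ⟨ρ, hρ, hρO⟩ := Metric.isOpen_iff.1 hO 0 h0
  obtain ⟨N, hN⟩ : ∃ N : ℕ, ∀ k ≥ N, (‖a‖ + 1) * ‖p‖ ^ k < ρ := by
    have : Tendsto (fun k : ℕ => (‖a‖ + 1) * ‖p‖ ^ k) atTop (𝓝 0) := by
      simpa using (tendsto_pow_atTop_nhds_zero_of_lt_one (norm_nonneg _) hp).const_mul (‖a‖ + 1)
    exact eventually_atTop.1 (this.eventually (gt_mem_nhds hρ))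
  have h1 : ∀ᶠ y in 𝓝 a, ∀ k ∈ Finset.range N, y * p ^ k ∈ O := by
    rw [eventually_all_finset]
    intro k _
    have : ContinuousAt (fun y : ℂ => y * p ^ k) a := by fun_prop
    exact this.eventually (hO.mem_nhds (ha k))
  have h2 : ∀ᶠ y in 𝓝 a, ‖y‖ < ‖a‖ + 1 :=
    continuous_norm.continuousAt.eventually (gt_mem_nhds (lt_add_one _))
  filter_upwards [h1, h2] with y hy1 hy2 k
  by_cases hk : k < N
  · exact hy1 k (Finset.mem_range.2 hk)
  · refine hρO (mem_ball_zero_iff.2 ?_)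
    rw [norm_mul, norm_pow]
    exact (mul_le_mul_of_nonneg_right hy2.le (by positivity)).trans_lt (hN k (not_lt.1 hk))

/-- The same argument with infinity in place of 0; b ≠ 0 makes y p⁻ᵏ escape uniformly for y near b.
-/
lemma eventually_forall_mul_inv_pow_mem {p : ℂ} (hp : ‖p‖ < 1) (hp0 : p ≠ 0) {O : Set ℂ}
    (hO : IsOpen O) (hinf : ∀ᶠ y in cocompact ℂ, y ∈ O) {b : ℂ} (hb0 : b ≠ 0)
    (hb : ∀ k : ℕ, b * p⁻¹ ^ k ∈ O) : ∀ᶠ y in 𝓝 b, ∀ k : ℕ, y * p⁻¹ ^ k ∈ O := by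
  obtain ⟨R, hR⟩ := (Metric.hasBasis_cobounded_compl_closedBall (0 : ℂ)).eventually_iff.1
    (Metric.cobounded_eq_cocompact (α := ℂ) ▸ hinf)
  have hp0' : 0 < ‖p‖ := norm_pos_iff.2 hp0
  have hb0' : 0 < ‖b‖ := norm_pos_iff.2 hb0
  obtain ⟨N, hN⟩ : ∃ N : ℕ, ∀ k ≥ N, R < ‖b‖ / 2 * ‖p‖⁻¹ ^ k := by
    have : Tendsto (fun k : ℕ => ‖b‖ / 2 * ‖p‖⁻¹ ^ k) atTop atTop :=
      (tendsto_pow_atTop_atTop_of_one_lt ((one_lt_inv₀ hp0').2 hp)).const_mul_atTop (by positivity)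
    exact eventually_atTop.1 (this.eventually (eventually_gt_atTop R))
  have h1 : ∀ᶠ y in 𝓝 b, ∀ k ∈ Finset.range N, y * p⁻¹ ^ k ∈ O := by
    rw [eventually_all_finset]
    intro k _
    have : ContinuousAt (fun y : ℂ => y * p⁻¹ ^ k) b := by fun_prop
    exact this.eventually (hO.mem_nhds (hb k))
  have h2 : ∀ᶠ y in 𝓝 b, ‖b‖ / 2 < ‖y‖ :=
    continuous_norm.continuousAt.eventually (lt_mem_nhds (half_lt_self hb0'))
  filter_upwards [h1, h2] with y hy1 hy2 k
  by_cases hk : k < N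
  · exact hy1 k (Finset.mem_range.2 hk)
  · refine hR.2 ?_
    rw [mem_compl_iff, mem_closedBall_zero_iff, not_le, norm_mul, norm_pow, norm_inv]
    exact (hN k (not_lt.1 hk)).trans_le (mul_le_mul_of_nonneg_right hy2.le (by positivity))

namespace Cycle

/-- The set of points off the support with given winding number. -/
def windSet (Γ : Cycle) (m : ℂ) : Set ℂ := {z | z ∉ Γ.K ∧ Γ.wind z = m}

lemma isOpen_windSet (Γ : Cycle) (m : ℂ) : IsOpen (Γ.windSet m) := by
  rw [isOpen_iff_mem_nhds]
  rintro z ⟨h1, h2⟩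
  filter_upwards [Γ.eventually_wind_eq h1] with y hy
  exact ⟨hy.1, hy.2.trans h2⟩

lemma eventually_cocompact_windSet (Γ : Cycle) : ∀ᶠ z in cocompact ℂ, z ∈ Γ.windSet 0 := by
  obtain ⟨R, hR⟩ := Γ.compact.isBounded.subset_ball (0 : ℂ)
  have h1 : ∀ x ∈ Γ.K, ‖x‖ < R := fun x hx => mem_ball_zero_iff.1 (hR hx)
  filter_upwards [tendsto_norm_cocompact_atTop.eventually (eventually_gt_atTop R)] with z hz
  exact ⟨fun h => (h1 z h).not_gt hz, Γ.wind_eq_zero_of_norm_gt h1 hz⟩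

end Cycle

/-- A good cycle remains good under small changes of the poles. -/
theorem Good.eventually {ι : Type*} [Finite ι] {p : ℂ} {a b : ι → ℂ} {Γ : Cycle}
    (h : Good p a b Γ) (hp : ‖p‖ < 1) (hp0 : p ≠ 0) (hb : ∀ j, b j ≠ 0) :
    ∀ᶠ y : (ι → ℂ) × (ι → ℂ) in 𝓝 (a, b), Good p y.1 y.2 Γ := by
  have h1 : ∀ᶠ y : (ι → ℂ) × (ι → ℂ) in 𝓝 (a, b), ∀ j, ∀ k : ℕ,
      y.1 j * p ^ k ∈ Γ.windSet (2 * Real.pi * Complex.I) := by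
    rw [eventually_all]
    intro j
    have hc : ContinuousAt (fun y : (ι → ℂ) × (ι → ℂ) => y.1 j) (a, b) := by fun_prop
    exact hc.eventually (eventually_forall_mul_pow_mem hp (Γ.isOpen_windSet _) h.zero (h.inner j))
  have h2 : ∀ᶠ y : (ι → ℂ) × (ι → ℂ) in 𝓝 (a, b), ∀ j, ∀ k : ℕ,
      y.2 j * p⁻¹ ^ k ∈ Γ.windSet 0 := by
    rw [eventually_all]
    intro j
    have hc : ContinuousAt (fun y : (ι → ℂ) × (ι → ℂ) => y.2 j) (a, b) := by fun_prop
    exact hc.eventually (eventually_forall_mul_inv_pow_mem hp hp0 (Γ.isOpen_windSet _)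
      Γ.eventually_cocompact_windSet (hb j) (h.outer j))
  filter_upwards [h1, h2] with y hy1 hy2
  exact ⟨h.zero, hy1, hy2⟩

lemma finite_inner {ι : Type*} [Finite ι] {p : ℂ} (hp : ‖p‖ < 1) (a : ι → ℂ) {δ : ℝ} (hδ : 0 < δ) :
    {x : ℂ | δ ≤ ‖x‖ ∧ ∃ j, ∃ k : ℕ, a j * p ^ k = x}.Finite := by
  have hfin : ∀ j, {k : ℕ | δ ≤ ‖a j * p ^ k‖}.Finite := by
    intro j
    have : Tendsto (fun k : ℕ => ‖a j * p ^ k‖) atTop (𝓝 0) := by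
      simpa using ((tendsto_pow_atTop_nhds_zero_of_norm_lt_one hp).const_mul (a j)).norm
    obtain ⟨N, hN⟩ := eventually_atTop.1 (this.eventually (gt_mem_nhds hδ))
    refine (Set.finite_lt_nat N).subset fun k hk => ?_
    by_contra hkN
    exact (hN k (not_lt.1 hkN)).not_ge hk
  refine (Set.finite_iUnion fun j => (hfin j).image fun k => a j * p ^ k).subset ?_
  rintro x ⟨hx, j, k, rfl⟩
  exact mem_iUnion.2 ⟨j, k, hx, rfl⟩

lemma finite_outer {ι : Type*} [Finite ι] {p : ℂ} (hp : ‖p‖ < 1) (hp0 : p ≠ 0) {b : ι → ℂ}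
    (hb : ∀ j, b j ≠ 0) (R : ℝ) :
    {x : ℂ | ‖x‖ ≤ R ∧ ∃ j, ∃ k : ℕ, b j * p⁻¹ ^ k = x}.Finite := by
  have hp0' : 0 < ‖p‖ := norm_pos_iff.2 hp0
  have hfin : ∀ j, {k : ℕ | ‖b j * p⁻¹ ^ k‖ ≤ R}.Finite := by
    intro j
    have : Tendsto (fun k : ℕ => ‖b j * p⁻¹ ^ k‖) atTop atTop := by
      simp only [norm_mul, norm_pow, norm_inv]
      exact (tendsto_pow_atTop_atTop_of_one_lt ((one_lt_inv₀ hp0').2 hp)).const_mul_atTop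
        (norm_pos_iff.2 (hb j))
    obtain ⟨N, hN⟩ := eventually_atTop.1 (this.eventually (eventually_gt_atTop R))
    refine (Set.finite_lt_nat N).subset fun k hk => ?_
    by_contra hkN
    exact (hN k (not_lt.1 hkN)).not_ge hk
  refine (Set.finite_iUnion fun j => (hfin j).image fun k => b j * p⁻¹ ^ k).subset ?_
  rintro x ⟨hx, j, k, rfl⟩
  exact mem_iUnion.2 ⟨j, k, hx, rfl⟩

/-- A cycle winding once around the points of `Z` of modulus less than `r` and the points of the
finite set `P`, and not around the other points of `Z`. -/
lemma exists_cycle_of_isolated {Z : Set ℂ} {r : ℝ} (hr : 0 < r) (hrZ : ∀ z ∈ Z, ‖z‖ ≠ r)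
    (P : Finset ℂ) (hP : ∀ x ∈ P, r < ‖x‖ ∧ ∀ᶠ y in 𝓝 x, y ∈ Z → y = x) :
    ∃ Γ : Cycle, ∀ z ∈ Z, z ∉ Γ.K ∧
      (‖z‖ < r ∨ z ∈ P → Γ.wind z = 2 * Real.pi * Complex.I) ∧
      (¬ (‖z‖ < r ∨ z ∈ P) → Γ.wind z = 0) := by
  induction P using Finset.induction_on with
  | empty =>
    refine ⟨Cycle.circle 0 r, fun z hz => ⟨fun h => ?_, fun h => ?_, fun h => ?_⟩⟩
    · exact hrZ z hz (mem_sphere_zero_iff_norm.1 (Cycle.circle_K_subset 0 hr.le h))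
    · exact Cycle.wind_circle_of_mem (mem_ball_zero_iff.2 (by simpa using h))
    · refine Cycle.wind_circle_of_notMem hr.le fun h' => h (Or.inl ?_)
      exact lt_of_le_of_ne (mem_closedBall_zero_iff.1 h') (hrZ z hz)
  | insert x P hx ih =>
    obtain ⟨Γ, hΓ⟩ := ih fun y hy => hP y (Finset.mem_insert_of_mem hy)
    obtain ⟨hxr, hiso⟩ := hP x (Finset.mem_insert_self _ _)
    -- A closed disc about x without other points of Z; adding its boundary circle changes the
    -- winding number at x only.
    obtain ⟨ε, hε, hεx⟩ := Metric.nhds_basis_closedBall.mem_iff.1 hiso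
    have hK : ∀ z ∈ Z, z ∉ (Cycle.circle x ε).K := by
      intro z hz h
      have h1 := Cycle.circle_K_subset x hε.le h
      have h2 : z = x := hεx (sphere_subset_closedBall h1) hz
      rw [h2, mem_sphere, dist_self] at h1
      exact hε.ne h1
    refine ⟨Γ.add (Cycle.circle x ε), fun z hz => ⟨fun h => ?_, ?_, ?_⟩⟩
    · rcases h with h | h
      exacts [(hΓ z hz).1 h, hK z hz h]
    all_goals
      rw [Cycle.wind_add _ _ (hΓ z hz).1 (hK z hz)]
      by_cases hzx : z = x
    · subst hzx
      intro _
      rw [(hΓ z hz).2.2 (by rintro (h | h); exacts [h.not_gt hxr, hx h]),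
        Cycle.wind_circle_of_mem (mem_ball_self hε), zero_add]
    · have h0 : (Cycle.circle x ε).wind z = 0 :=
        Cycle.wind_circle_of_notMem hε.le fun h => hzx (hεx h hz)
      rw [h0, add_zero, Finset.mem_insert]
      simp only [hzx, false_or]
      exact (hΓ z hz).2.1
    · subst hzx
      intro h
      exact absurd (Or.inr (Finset.mem_insert_self _ _)) h
    · have h0 : (Cycle.circle x ε).wind z = 0 :=
        Cycle.wind_circle_of_notMem hε.le fun h => hzx (hεx h hz)
      rw [h0, add_zero, Finset.mem_insert]
      simp only [hzx, false_or]
      exact (hΓ z hz).2.2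

/-- Take a circle about 0 of radius smaller than all |b_j| and different from the moduli of the
inner poles. It encloses 0 and all but finitely many inner poles, and no outer pole. Each inner pole
outside it receives a small circle of its own; `hab` says that such a pole is never an outer one. -/
theorem exists_good {ι : Type*} [Finite ι] {p : ℂ} (hp : ‖p‖ < 1) (hp0 : p ≠ 0) {a b : ι → ℂ}
    (hb : ∀ j, b j ≠ 0) (hab : ∀ i j (k m : ℕ), a i * p ^ k ≠ b j * p⁻¹ ^ m) :
    ∃ Γ, Good p a b Γ := by
  set Zi : Set ℂ := {x | ∃ j, ∃ k : ℕ, a j * p ^ k = x} with hZi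
  set Zo : Set ℂ := {x | ∃ j, ∃ k : ℕ, b j * p⁻¹ ^ k = x} with hZo
  set Z : Set ℂ := {0} ∪ (Zi ∪ Zo) with hZ
  have hp0' : 0 < ‖p‖ := norm_pos_iff.2 hp0
  obtain ⟨δ, hδ, hδb⟩ : ∃ δ : ℝ, 0 < δ ∧ ∀ j, δ ≤ ‖b j‖ := by
    have : ∀ᶠ δ in 𝓝[>] (0 : ℝ), ∀ j, δ ≤ ‖b j‖ := by
      rw [eventually_all]
      exact fun j => mem_nhdsWithin_of_mem_nhds (ge_mem_nhds (norm_pos_iff.2 (hb j)))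
    obtain ⟨δ, h1, h2⟩ := (this.and self_mem_nhdsWithin).exists
    exact ⟨δ, h2, h1⟩
  have hcount : (norm '' Zi).Countable := by
    refine Set.Countable.image ?_ _
    have : Zi = ⋃ j, Set.range fun k : ℕ => a j * p ^ k := by
      ext x; simp [hZi]
    rw [this]
    exact countable_iUnion fun j => countable_range _
  obtain ⟨r, hr, hr0, hrδ⟩ := (hcount.dense_compl ℝ).exists_between hδ
  have hout : ∀ x ∈ Zo, r < ‖x‖ := by
    rintro x ⟨j, k, rfl⟩
    rw [norm_mul, norm_pow, norm_inv]
    have : 1 ≤ ‖p‖⁻¹ ^ k := one_le_pow₀ ((one_le_inv₀ hp0').2 hp.le)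
    calc r < ‖b j‖ := hrδ.trans_le (hδb j)
      _ ≤ ‖b j‖ * ‖p‖⁻¹ ^ k := le_mul_of_one_le_right (norm_nonneg _) this
  have hrZ : ∀ z ∈ Z, ‖z‖ ≠ r := by
    rintro z (rfl | hz | hz)
    · rw [norm_zero]; exact hr0.ne
    · exact fun h => hr ⟨z, hz, h⟩
    · exact (hout z hz).ne'
  have hfin := finite_inner hp a hr0
  obtain ⟨Γ, hΓ⟩ := exists_cycle_of_isolated hr0 hrZ hfin.toFinset (by
    intro x hx
    rw [Set.Finite.mem_toFinset] at hx
    have hxr : r < ‖x‖ := lt_of_le_of_ne hx.1 (hrZ x (Or.inr (Or.inl hx.2))).symm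
    have hx0 : 0 < ‖x‖ := hr0.trans hxr
    refine ⟨hxr, ?_⟩
    -- Near x only inner poles of modulus at least |x|/2 and outer poles of modulus at most 2|x|
    -- occur, and these are finitely many; hence x is isolated in Z.
    have hF := ((finite_inner hp a (half_pos hx0)).union (finite_outer hp hp0 hb (2 * ‖x‖))).sdiff (t := {x})
    have h1 := hF.isClosed.isOpen_compl.mem_nhds (x := x) (by simp)
    have h2 : ∀ᶠ y in 𝓝 x, ‖x‖ / 2 < ‖y‖ :=
      continuous_norm.continuousAt.eventually (lt_mem_nhds (half_lt_self hx0))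
    have h3 : ∀ᶠ y in 𝓝 x, ‖y‖ < 2 * ‖x‖ :=
      continuous_norm.continuousAt.eventually (gt_mem_nhds (by linarith))
    filter_upwards [h1, h2, h3] with y hy1 hy2 hy3 hyZ
    by_contra hne
    rcases hyZ with hy | hy | hy
    · rw [mem_singleton_iff.1 hy, norm_zero] at hy2; linarith
    · exact hy1 ⟨Or.inl ⟨hy2.le, hy⟩, hne⟩
    · exact hy1 ⟨Or.inr ⟨hy3.le, hy⟩, hne⟩)
  refine ⟨Γ, ?_, fun j k => ?_, fun j k => ?_⟩
  · have := hΓ 0 (Or.inl rfl)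
    exact ⟨this.1, this.2.1 (Or.inl (by simpa using hr0))⟩
  · have hz : a j * p ^ k ∈ Zi := ⟨j, k, rfl⟩
    have := hΓ _ (Or.inr (Or.inl hz))
    refine ⟨this.1, this.2.1 ?_⟩
    rcases lt_or_ge ‖a j * p ^ k‖ r with h | h
    · exact Or.inl h
    · exact Or.inr (hfin.mem_toFinset.2 ⟨h, hz⟩)
  · have hz : b j * p⁻¹ ^ k ∈ Zo := ⟨j, k, rfl⟩
    have := hΓ _ (Or.inr (Or.inr hz))
    refine ⟨this.1, this.2.2 ?_⟩
    rintro (h | h)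
    · exact h.not_gt (hout _ hz)
    · obtain ⟨-, i, m, him⟩ := hfin.mem_toFinset.1 h
      exact hab i j m k him

end
end SmirnovIntegral

namespace SmirnovIntegral
open scoped BigOperators Topology
noncomputable section

open Polynomial

/-! ### Alternating forms on `ℂ[X] / (A)` -/

/-- The arguments are replaced one at a time. This is how a form is regarded as living on a quotient
without constructing that quotient. -/
lemma altMap_congr {n : ℕ} (ω : ℂ[X] [⋀^Fin n]→ₗ[ℂ] ℂ) {W : Set ℂ[X]}
    (hω : ∀ v : Fin n → ℂ[X], ∀ i, v i ∈ W → ω v = 0) {v v' : Fin n → ℂ[X]}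
    (h : ∀ i, v i - v' i ∈ W) : ω v = ω v' := by
  have key : ∀ s : Finset (Fin n), ω (s.piecewise v v') = ω v' := by
    intro s
    induction s using Finset.induction_on with
    | empty => simp
    | insert i s hi ih =>
      rw [Finset.piecewise_insert, ← ih]
      have h1 : v i = (v i - v' i) + v' i := by ring
      have h2 : Function.update (s.piecewise v v') i (v' i) = s.piecewise v v' := by
        rw [Function.update_eq_self_iff, Finset.piecewise_eq_of_notMem _ _ _ hi]
      rw [h1, AlternatingMap.map_update_add, h2, add_eq_right]
      refine hω _ i ?_
      rw [Function.update_self]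
      exact h i
  simpa using key Finset.univ

/-- The pull-back of ω along the linear map sending the standard basis of ℂⁿ to e is a multiple of
the determinant. -/
lemma altMap_matrix {n : ℕ} (ω : ℂ[X] [⋀^Fin n]→ₗ[ℂ] ℂ) (e : Fin n → ℂ[X])
    (N : Matrix (Fin n) (Fin n) ℂ) : ω (fun i => ∑ j, N i j • e j) = N.det * ω e := by
  have h := AlternatingMap.eq_smul_basis_det (Pi.basisFun ℂ (Fin n))
    (ω.compLinearMap (Fintype.linearCombination ℂ e))
  rw [Pi.basisFun_det] at h
  have h1 := congrArg (fun f => f fun i => N i) h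
  simp only [AlternatingMap.smul_apply, smul_eq_mul] at h1
  have h2 : (ω.compLinearMap (Fintype.linearCombination ℂ e)) (fun i => N i) =
      ω (fun i => ∑ j, N i j • e j) := by
    simp only [AlternatingMap.compLinearMap_apply, Fintype.linearCombination_apply]
  have h3 : (ω.compLinearMap (Fintype.linearCombination ℂ e)) (Pi.basisFun ℂ (Fin n)) = ω e := by
    rw [AlternatingMap.compLinearMap_apply]
    congr 1
    ext1 i
    simp [Fintype.linearCombination_apply, Pi.single_apply]
  rw [← h2, h1, h3, mul_comm]
  rfl

/-- An alternating form takes the same value on all monic triangular families. -/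
lemma altMap_monic {n : ℕ} (ω : ℂ[X] [⋀^Fin n]→ₗ[ℂ] ℂ) {T : Fin n → ℂ[X]}
    (hT : ∀ i, (T i).Monic) (hd : ∀ i, (T i).natDegree = i) :
    ω T = ω fun i => X ^ (i : ℕ) := by
  have h1 : T = fun i => ∑ j : Fin n, (Matrix.of fun i j : Fin n => (T i).coeff j) i j •
      (X : ℂ[X]) ^ (j : ℕ) := by
    ext1 i
    conv_lhs => rw [(T i).as_sum_range' n (by rw [hd]; exact i.2)]
    rw [Finset.sum_range]
    refine Finset.sum_congr rfl fun j _ => ?_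
    rw [Matrix.of_apply, smul_eq_C_mul, C_mul_X_pow_eq_monomial]
  conv_lhs => rw [h1]
  rw [altMap_matrix, Matrix.det_of_isLowerTriangular]
  · have : ∀ i : Fin n, (Matrix.of fun i j : Fin n => (T i).coeff j) i i = 1 := by
      intro i
      have := hT i
      rw [Monic, leadingCoeff, hd] at this
      exact this
    simp only [this, Finset.prod_const_one, one_mul]
  · intro i j hij
    refine coeff_eq_zero_of_natDegree_lt ?_
    rw [hd]
    exact hij

/-- The Newton basis. -/
def newton {n : ℕ} (α : Fin n → ℂ) (k : ℕ) : ℂ[X] :=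
  ∏ i ∈ Finset.univ.filter fun i : Fin n => (i : ℕ) < k, (X - C (α i))

lemma newton_succ {n : ℕ} (α : Fin n → ℂ) {k : ℕ} (hk : k < n) :
    newton α (k + 1) = newton α k * (X - C (α ⟨k, hk⟩)) := by
  unfold newton
  have : (Finset.univ.filter fun i : Fin n => (i : ℕ) < k + 1) =
      insert ⟨k, hk⟩ (Finset.univ.filter fun i : Fin n => (i : ℕ) < k) := by
    ext i
    simp only [Finset.mem_filter, Finset.mem_univ, true_and, Finset.mem_insert, Fin.ext_iff]
    omega
  rw [this, Finset.prod_insert (by simp), mul_comm]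

lemma newton_top {n : ℕ} (α : Fin n → ℂ) : newton α n = ∏ i, (X - C (α i)) := by
  unfold newton
  congr 1
  ext i
  simp

/-- Writing D = D(α_m) + (X − α_m)E and repeating with E shows that multiplication by D is
triangular in the Newton basis modulo ∏(X − α_i), with diagonal entries D(α_m). Unlike an
eigenvector argument this allows coinciding α_i. -/
lemma newton_expansion {n : ℕ} (α : Fin n → ℂ) (d m : ℕ) (hm : m + d = n) (D : ℂ[X]) :
    ∃ c : Fin n → ℂ, (∀ j : Fin n, (j : ℕ) < m → c j = 0) ∧
      (∀ j : Fin n, (j : ℕ) = m → c j = D.eval (α j)) ∧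
      (∏ i, (X - C (α i))) ∣ newton α m * D - ∑ j : Fin n, c j • newton α j := by
  induction d generalizing m D with
  | zero =>
    obtain rfl : m = n := by omega
    refine ⟨0, fun _ _ => rfl, fun j hj => absurd hj j.2.ne, ?_⟩
    simp [newton_top]
  | succ d ih =>
    have hmn : m < n := by omega
    obtain ⟨E, hE⟩ : X - C (α ⟨m, hmn⟩) ∣ D - C (D.eval (α ⟨m, hmn⟩)) := X_sub_C_dvd_sub_C_eval
    obtain ⟨c, hc1, -, hc3⟩ := ih (m + 1) (by omega) E
    refine ⟨Function.update c ⟨m, hmn⟩ (D.eval (α ⟨m, hmn⟩)), fun j hj => ?_, fun j hj => ?_, ?_⟩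
    · rw [Function.update_of_ne (by rintro rfl; simp at hj)]
      exact hc1 j (by omega)
    · obtain rfl : j = ⟨m, hmn⟩ := Fin.ext hj
      rw [Function.update_self]
    · have h1 : ∑ j : Fin n, Function.update c ⟨m, hmn⟩ (D.eval (α ⟨m, hmn⟩)) j • newton α j =
          D.eval (α ⟨m, hmn⟩) • newton α m + ∑ j : Fin n, c j • newton α j := by
        rw [← Finset.add_sum_erase _ _ (Finset.mem_univ (⟨m, hmn⟩ : Fin n)),
          ← Finset.add_sum_erase _ (fun j => c j • newton α j) (Finset.mem_univ (⟨m, hmn⟩ : Fin n)),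
          Function.update_self, hc1 ⟨m, hmn⟩ (by simp), zero_smul, zero_add]
        congr 1
        refine Finset.sum_congr rfl fun j hj => ?_
        rw [Function.update_of_ne (Finset.ne_of_mem_erase hj)]
      have h2 : newton α m * D - (D.eval (α ⟨m, hmn⟩) • newton α m + ∑ j : Fin n, c j • newton α j) =
          newton α (m + 1) * E - ∑ j : Fin n, c j • newton α j := by
        rw [newton_succ α hmn, mul_assoc, ← hE, smul_eq_C_mul]
        ring
      rw [h1, h2]
      exact hc3

/-- The determinant of multiplication by `D` on `ℂ[X] / (A)`. -/
theorem altMap_mul {n : ℕ} (ω : ℂ[X] [⋀^Fin n]→ₗ[ℂ] ℂ) (α : Fin n → ℂ)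
    (hω : ∀ v : Fin n → ℂ[X], ∀ i, (∏ i, (X - C (α i))) ∣ v i → ω v = 0) (D : ℂ[X])
    (T : Fin n → ℂ[X]) : ω (fun i => D * T i) = (∏ i, D.eval (α i)) * ω T := by
  set e : Fin n → ℂ[X] := fun j => newton α j with he
  have hcongr := fun v v' => altMap_congr ω (W := {P | (∏ i, (X - C (α i))) ∣ P}) hω
    (v := v) (v' := v')
  -- N holds the Newton coordinates of the T i. The matrix M below is that of multiplication by D;
  -- being triangular, it has determinant ∏ D(α_i).
  choose N hN using fun i => newton_expansion α n 0 (by omega) (T i)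
  have h0 : newton α 0 = 1 := by simp [newton]
  have hT : ω T = (Matrix.of N).det * ω e := by
    rw [← altMap_matrix]
    refine hcongr _ _ fun i => ?_
    have := (hN i).2.2
    rwa [h0, one_mul] at this
  have hDT : ω (fun i => D * T i) = (Matrix.of N).det * ω fun j => e j * D := by
    rw [← altMap_matrix]
    refine hcongr _ _ fun i => ?_
    have := (hN i).2.2.mul_right D
    rw [h0, one_mul, sub_mul, Finset.sum_mul] at this
    simpa [he, mul_comm D, smul_mul_assoc] using this
  choose M hM using fun k : Fin n => newton_expansion α (n - k) k (by omega) D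
  have hD : ω (fun j => e j * D) = (∏ i, D.eval (α i)) * ω e := by
    have h1 : (Matrix.of M).det = ∏ i, D.eval (α i) := by
      rw [Matrix.det_of_isUpperTriangular]
      · exact Finset.prod_congr rfl fun i _ => (hM i).2.1 i rfl
      · intro i j hij
        exact (hM i).1 j hij
    rw [← h1, ← altMap_matrix]
    exact hcongr _ _ fun i => (hM i).2.2
  rw [hDT, hD, hT]
  ring

/-! ### Difference quotients of polynomials -/

/-- The dilation `P(x) ↦ P(s x)`. -/
def dil (s : ℂ) (P : ℂ[X]) : ℂ[X] := P.comp (C s * X)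

lemma dil_add (s : ℂ) (P Q : ℂ[X]) : dil s (P + Q) = dil s P + dil s Q := add_comp
lemma dil_sub (s : ℂ) (P Q : ℂ[X]) : dil s (P - Q) = dil s P - dil s Q := sub_comp
lemma dil_mul (s : ℂ) (P Q : ℂ[X]) : dil s (P * Q) = dil s P * dil s Q := mul_comp _ _ _
lemma dil_C (s a : ℂ) : dil s (C a) = C a := C_comp
lemma dil_X (s : ℂ) : dil s X = C s * X := X_comp
lemma dil_dil (s t : ℂ) (P : ℂ[X]) : dil s (dil t P) = dil (t * s) P := by
  unfold dil
  rw [comp_assoc]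
  congr 1
  simp [mul_assoc]

lemma dil_prod {ι : Type*} (s : ℂ) (S : Finset ι) (P : ι → ℂ[X]) :
    dil s (∏ i ∈ S, P i) = ∏ i ∈ S, dil s (P i) := prod_comp _ _ _

lemma eval_dil (s x : ℂ) (P : ℂ[X]) : (dil s P).eval x = P.eval (s * x) := by
  simp [dil, eval_comp]

/-- The difference quotient `(P(s x) - P(x)) / x`. -/
def dq (s : ℂ) (P : ℂ[X]) : ℂ[X] := (dil s P - P).divX

lemma X_mul_dq (s : ℂ) (P : ℂ[X]) : X * dq s P = dil s P - P := by
  have h := divX_mul_X_add (dil s P - P)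
  have h0 : (dil s P - P).coeff 0 = 0 := by
    rw [coeff_zero_eq_eval_zero, eval_sub, eval_dil, mul_zero, sub_self]
  rw [h0, C_0, add_zero] at h
  rw [mul_comm]
  exact h

lemma eq_of_X_mul_eq {P Q : ℂ[X]} (h : X * P = X * Q) : P = Q := mul_left_cancel₀ X_ne_zero h

lemma dq_C (s a : ℂ) : dq s (C a) = 0 := by
  refine eq_of_X_mul_eq ?_
  rw [X_mul_dq, dil_C, sub_self, mul_zero]

lemma dq_add (s : ℂ) (P Q : ℂ[X]) : dq s (P + Q) = dq s P + dq s Q := by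
  refine eq_of_X_mul_eq ?_
  rw [mul_add, X_mul_dq, X_mul_dq, X_mul_dq, dil_add]
  ring

lemma dq_C_mul (s a : ℂ) (P : ℂ[X]) : dq s (C a * P) = C a * dq s P := by
  refine eq_of_X_mul_eq ?_
  rw [X_mul_dq, mul_left_comm, X_mul_dq, dil_mul, dil_C]
  ring

/-! ### The forms attached to `(T, Q)` -/

/-- The polynomial `A · (Q(σ⁻¹ x) - Q(x)) / x - B · (T(σ x) - T(x)) / x`. -/
def form (σ : ℂ) (A B T Q : ℂ[X]) : ℂ[X] := A * dq σ⁻¹ Q - B * dq σ T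

lemma X_mul_form (σ : ℂ) (A B T Q : ℂ[X]) :
    X * form σ A B T Q = A * (dil σ⁻¹ Q - Q) - B * (dil σ T - T) := by
  unfold form
  rw [← X_mul_dq, ← X_mul_dq]
  ring

lemma divByMonic_add' {A : ℂ[X]} (hA : A.Monic) (P Q : ℂ[X]) : (P + Q) /ₘ A = P /ₘ A + Q /ₘ A := by
  refine (div_modByMonic_unique _ (P %ₘ A + Q %ₘ A) hA ⟨?_, ?_⟩).1
  · have h1 := modByMonic_add_div P A
    have h2 := modByMonic_add_div Q A
    linear_combination h1 + h2
  · exact (degree_add_le _ _).trans_lt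
      (max_lt (degree_modByMonic_lt _ hA) (degree_modByMonic_lt _ hA))

lemma divByMonic_C_mul {A : ℂ[X]} (hA : A.Monic) (a : ℂ) (P : ℂ[X]) :
    (C a * P) /ₘ A = C a * (P /ₘ A) := by
  refine (div_modByMonic_unique _ (C a * (P %ₘ A)) hA ⟨?_, ?_⟩).1
  · have h1 := modByMonic_add_div P A
    linear_combination C a * h1
  · refine (degree_mul_le _ _).trans_lt ?_
    calc (C a).degree + (P %ₘ A).degree ≤ 0 + (P %ₘ A).degree := by gcongr; exact degree_C_le
      _ < A.degree := by rw [zero_add]; exact degree_modByMonic_lt _ hA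

/-- The form attached to `T` with `Q` the quotient of `B T` by `A`. -/
def stdForm (σ : ℂ) {A : ℂ[X]} (hA : A.Monic) (B : ℂ[X]) : ℂ[X] →ₗ[ℂ] ℂ[X] where
  toFun T := form σ A B T ((B * T) /ₘ A)
  map_add' T T' := by
    unfold form
    rw [mul_add, divByMonic_add' hA, dq_add, dq_add]
    ring
  map_smul' a T := by
    unfold form
    simp only [smul_eq_C_mul, RingHom.id_apply]
    rw [mul_left_comm, divByMonic_C_mul hA, dq_C_mul, dq_C_mul]
    ring

/-- If two choices of Q satisfy the degree bound, A times their difference has degree at most deg A.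
So they differ by a constant, which `dq` kills. -/
lemma form_eq_stdForm (σ : ℂ) {A : ℂ[X]} (hA : A.Monic) (B : ℂ[X]) {T Q : ℂ[X]}
    (h : (B * T - A * Q).natDegree ≤ A.natDegree) : form σ A B T Q = stdForm σ hA B T := by
  have h1 := modByMonic_add_div (B * T) A
  have h2 : A * ((B * T) /ₘ A - Q) = (B * T - A * Q) - (B * T) %ₘ A := by
    linear_combination h1
  have h3 : ((B * T) %ₘ A).natDegree ≤ A.natDegree :=
    natDegree_le_natDegree (degree_modByMonic_lt _ hA).le
  have h4 : (A * ((B * T) /ₘ A - Q)).natDegree ≤ A.natDegree := by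
    rw [h2]
    exact (natDegree_sub_le _ _).trans (max_le h h3)
  have h5 : ((B * T) /ₘ A - Q).natDegree = 0 := by
    by_cases h0 : (B * T) /ₘ A - Q = 0
    · rw [h0, natDegree_zero]
    · rw [hA.natDegree_mul' h0] at h4
      omega
  obtain ⟨c, hc⟩ := natDegree_eq_zero.1 h5
  have h6 : (B * T) /ₘ A = Q + C c := by rw [hc]; ring
  change _ = form σ A B T ((B * T) /ₘ A)
  unfold form
  rw [h6, dq_add, dq_C, add_zero]

/-- The exact polynomials. -/
def IsExact (σ : ℂ) (A B P : ℂ[X]) : Prop :=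
  ∃ r, X * P = A * dil σ⁻¹ (B * r) - B * dil σ (A * r)

/-- For T = Ar and Q = Br the undilated terms AQ and BT coincide and cancel, leaving a total
difference. -/
lemma isExact_form (σ : ℂ) (A B r : ℂ[X]) : IsExact σ A B (form σ A B (A * r) (B * r)) := by
  refine ⟨r, ?_⟩
  rw [X_mul_form]
  ring

end
end SmirnovIntegral

/-! ### Forms vanishing on exact polynomials, and their values on convenient families. -/

namespace SmirnovIntegral
open scoped BigOperators Topology
noncomputable section

open Polynomial

/-- Closed forms for an alternating form which vanishes on exact polynomials. -/
def KillsExact (σ : ℂ) {n : ℕ} (A B : ℂ[X]) (J : ℂ[X] [⋀^Fin n]→ₗ[ℂ] ℂ) : Prop :=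
  ∀ P : Fin n → ℂ[X], ∀ i, IsExact σ A B (P i) → J P = 0

section

variable {n : ℕ} (α : Fin n → ℂ)

lemma monic_prod_X_sub_C' : (∏ i, (X - C (α i))).Monic := monic_prod_X_sub_C _ _

lemma natDegree_prod_X_sub_C : (∏ i, (X - C (α i))).natDegree = n := by
  rw [natDegree_prod_of_monic _ _ fun i _ => monic_X_sub_C _]
  simp

/-- The value of `J` on the forms attached to the monomials. -/
def baseVal (σ : ℂ) {A : ℂ[X]} (hA : A.Monic) (B : ℂ[X]) (J : ℂ[X] [⋀^Fin n]→ₗ[ℂ] ℂ) : ℂ :=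
  J fun i => stdForm σ hA B (X ^ (i : ℕ))

/-- Consequently T ↦ J(`stdForm` T) factors through ℂ[X]/(A). When deg A = n, alternating n-forms
there make up a line, and `baseVal` is the coordinate on it. -/
lemma KillsExact.comp {σ : ℂ} {A B : ℂ[X]} {J : ℂ[X] [⋀^Fin n]→ₗ[ℂ] ℂ} (hJ : KillsExact σ A B J)
    (hA : A.Monic) (v : Fin n → ℂ[X]) (i : Fin n) (h : A ∣ v i) :
    J.compLinearMap (stdForm σ hA B) v = 0 := by
  obtain ⟨r, hr⟩ := h
  refine hJ _ i ?_
  rw [hr, ← form_eq_stdForm σ hA B (T := A * r) (Q := B * r)]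
  · exact isExact_form σ A B r
  · rw [show B * (A * r) - A * (B * r) = 0 by ring, natDegree_zero]
    exact Nat.zero_le _

lemma map_form_eq {σ : ℂ} {A B : ℂ[X]} (J : ℂ[X] [⋀^Fin n]→ₗ[ℂ] ℂ)
    (hA : A.Monic) {T Q : Fin n → ℂ[X]}
    (hTQ : ∀ i, (B * T i - A * Q i).natDegree ≤ A.natDegree) :
    J (fun i => form σ A B (T i) (Q i)) = J.compLinearMap (stdForm σ hA B) T := by
  rw [AlternatingMap.compLinearMap_apply]
  congr 1
  ext1 i
  exact form_eq_stdForm σ hA B (hTQ i)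

/-- Applied to `headPoly` and `phiPoly`, this removes the explicit polynomials of Δ from the
problem. -/
lemma map_form_monic {σ : ℂ} {A B : ℂ[X]} (J : ℂ[X] [⋀^Fin n]→ₗ[ℂ] ℂ)
    (hA : A.Monic) {T Q : Fin n → ℂ[X]} (hT : ∀ i, (T i).Monic) (hd : ∀ i, (T i).natDegree = i)
    (hTQ : ∀ i, (B * T i - A * Q i).natDegree ≤ A.natDegree) :
    J (fun i => form σ A B (T i) (Q i)) = baseVal σ hA B J := by
  rw [map_form_eq J hA hTQ, altMap_monic _ hT hd]
  rfl

/-- Modulo A the T i represent X^i/D, so `altMap_mul` compares their value with that of the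
monomials. -/
lemma map_form_inverse {σ : ℂ} {B : ℂ[X]} {J : ℂ[X] [⋀^Fin n]→ₗ[ℂ] ℂ}
    (hJ : KillsExact σ (∏ i, (X - C (α i))) B J) (D : ℂ[X]) {T Q : Fin n → ℂ[X]}
    (hT : ∀ i : Fin n, (∏ i, (X - C (α i))) ∣ D * T i - X ^ (i : ℕ))
    (hTQ : ∀ i, (B * T i - (∏ i, (X - C (α i))) * Q i).natDegree ≤ n) :
    baseVal σ (monic_prod_X_sub_C' α) B J = (∏ i, D.eval (α i)) *
      J (fun i => form σ (∏ i, (X - C (α i))) B (T i) (Q i)) := by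
  have hA := monic_prod_X_sub_C' α
  rw [map_form_eq J hA (by simpa only [natDegree_prod_X_sub_C] using hTQ),
    ← altMap_mul _ α (hJ.comp hA) D T]
  exact (altMap_congr _ (W := {P | (∏ i, (X - C (α i))) ∣ P}) (hJ.comp hA) hT).symm

/-- With the first argument fixed at 1 and the others restricted to multiples of X − w, ω becomes an
m-form on ℂ[X]/∏(X − γ_j), to which `altMap_mul` applies. Then 1, (X − w)X^k is a monic triangular
family. -/
lemma altMap_cons_mul {m : ℕ} (ω : ℂ[X] [⋀^Fin (m + 1)]→ₗ[ℂ] ℂ) (γ : Fin m → ℂ) (w : ℂ)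
    (hω : ∀ v : Fin (m + 1) → ℂ[X], ∀ i, ((X - C w) * ∏ j, (X - C (γ j))) ∣ v i → ω v = 0)
    (D : ℂ[X]) :
    ω (Matrix.vecCons 1 fun k : Fin m => (X - C w) * (D * X ^ (k : ℕ))) =
      (∏ j, D.eval (γ j)) * ω fun i => X ^ (i : ℕ) := by
  have happ : ∀ v : Fin m → ℂ[X],
      ((ω.curryLeft 1).compLinearMap (LinearMap.mulLeft ℂ (X - C w))) v =
        ω (Matrix.vecCons 1 fun k => (X - C w) * v k) := fun v => by
    rw [AlternatingMap.compLinearMap_apply, AlternatingMap.curryLeft_apply_apply]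
    rfl
  have h := altMap_mul ((ω.curryLeft 1).compLinearMap (LinearMap.mulLeft ℂ (X - C w))) γ
    (fun v k hk => by
      rw [happ]
      refine hω _ k.succ ?_
      rw [Matrix.cons_val_succ]
      exact mul_dvd_mul_left _ hk) D fun k => X ^ (k : ℕ)
  rw [happ, happ] at h
  rw [h]
  congr 1
  refine altMap_monic ω (fun i => ?_) (fun i => ?_)
  · refine Fin.cases ?_ (fun k => ?_) i
    · exact monic_one
    · exact (monic_X_sub_C w).mul (monic_X_pow _)
  · refine Fin.cases ?_ (fun k => ?_) i
    · exact natDegree_one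
    · rw [Matrix.cons_val_succ, (monic_X_sub_C w).natDegree_mul (monic_X_pow _),
        natDegree_X_sub_C, natDegree_X_pow, Fin.val_succ, add_comm]

lemma map_form_cons {m : ℕ} {σ : ℂ} {B : ℂ[X]} {J : ℂ[X] [⋀^Fin (m + 1)]→ₗ[ℂ] ℂ} (γ : Fin m → ℂ)
    (w : ℂ) {A : ℂ[X]} (hA : A.Monic) (hAγ : A = (X - C w) * ∏ j, (X - C (γ j)))
    (hJ : KillsExact σ A B J) (D : ℂ[X])
    {Q₀ : ℂ[X]} {Q : Fin m → ℂ[X]} (hQ₀ : (B - A * Q₀).natDegree ≤ m + 1)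
    (hQ : ∀ k : Fin m, (B * ((X - C w) * (D * X ^ (k : ℕ))) - A * Q k).natDegree ≤ m + 1) :
    J (Matrix.vecCons (form σ A B 1 Q₀) fun k =>
        form σ A B ((X - C w) * (D * X ^ (k : ℕ))) (Q k)) =
      (∏ j, D.eval (γ j)) * baseVal σ hA B J := by
  have hdeg : A.natDegree = m + 1 := by
    rw [hAγ, (monic_X_sub_C w).natDegree_mul (monic_prod_X_sub_C' γ), natDegree_prod_X_sub_C,
      natDegree_X_sub_C, add_comm]
  have h1 : (Matrix.vecCons (form σ A B 1 Q₀) fun k : Fin m =>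
      form σ A B ((X - C w) * (D * X ^ (k : ℕ))) (Q k)) = fun i =>
      stdForm σ hA B ((Matrix.vecCons 1 fun k : Fin m => (X - C w) * (D * X ^ (k : ℕ))) i) := by
    ext1 i
    refine Fin.cases ?_ (fun k => ?_) i
    · simp only [Matrix.cons_val_zero]
      exact form_eq_stdForm σ hA B (by rw [mul_one, hdeg]; exact hQ₀)
    · simp only [Matrix.cons_val_succ]
      exact form_eq_stdForm σ hA B (by rw [hdeg]; exact hQ k)
  rw [h1]
  exact altMap_cons_mul (J.compLinearMap (stdForm σ hA B)) γ w
    (fun v i hv => hJ.comp hA v i (by rw [hAγ]; exact hv)) D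

end

/-! ### Families depending polynomially on a parameter -/

/-- Families of polynomials in `x` depending polynomially, of degree at most `d`, on `w`. -/
def PolyFam (d : ℕ) (v : ℂ → ℂ[X]) : Prop :=
  ∃ c : ℕ → ℂ[X], ∀ w, v w = ∑ i ∈ Finset.range (d + 1), C (w ^ i) * c i

lemma PolyFam.zero (d : ℕ) : PolyFam d fun _ => 0 := ⟨0, by simp⟩

lemma PolyFam.add {d : ℕ} {v v' : ℂ → ℂ[X]} (h : PolyFam d v) (h' : PolyFam d v') :
    PolyFam d fun w => v w + v' w := by
  obtain ⟨c, hc⟩ := h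
  obtain ⟨c', hc'⟩ := h'
  refine ⟨fun i => c i + c' i, fun w => ?_⟩
  simp only [hc, hc', mul_add, Finset.sum_add_distrib]

lemma PolyFam.sum {ι : Type*} {d : ℕ} (s : Finset ι) {v : ι → ℂ → ℂ[X]}
    (h : ∀ i ∈ s, PolyFam d (v i)) : PolyFam d fun w => ∑ i ∈ s, v i w := by
  classical
  induction s using Finset.induction_on with
  | empty => simpa using PolyFam.zero d
  | insert a s ha ih =>
    simp only [Finset.sum_insert ha]
    exact (h a (Finset.mem_insert_self _ _)).add (ih fun i hi => h i (Finset.mem_insert_of_mem hi))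

lemma PolyFam.const_mul {d : ℕ} {v : ℂ → ℂ[X]} (h : PolyFam d v) (P : ℂ[X]) :
    PolyFam d fun w => P * v w := by
  obtain ⟨c, hc⟩ := h
  refine ⟨fun i => P * c i, fun w => ?_⟩
  simp only [hc, Finset.mul_sum]
  exact Finset.sum_congr rfl fun i _ => by ring

lemma PolyFam.monomial {d i : ℕ} (hi : i ≤ d) (P : ℂ[X]) : PolyFam d fun w => C (w ^ i) * P := by
  refine ⟨fun k => if k = i then P else 0, fun w => ?_⟩
  rw [Finset.sum_eq_single_of_mem i (Finset.mem_range.2 (by omega))]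
  · simp
  · intro k _ hk
    simp [hk]

lemma PolyFam.X_sub_C_mul {d : ℕ} {v : ℂ → ℂ[X]} (h : PolyFam d v) :
    PolyFam (d + 1) fun w => (X - C w) * v w := by
  obtain ⟨c, hc⟩ := h
  have h1 : (fun w => (X - C w) * v w) = fun w =>
      ∑ i ∈ Finset.range (d + 1), (C (w ^ i) * (X * c i) + C (w ^ (i + 1)) * (-c i)) := by
    ext1 w
    rw [hc, Finset.mul_sum]
    refine Finset.sum_congr rfl fun i _ => ?_
    simp only [map_pow]
    ring
  rw [h1]
  refine PolyFam.sum _ fun i hi => ?_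
  have := Finset.mem_range.1 hi
  exact (PolyFam.monomial (by omega) _).add (PolyFam.monomial (by omega) _)

lemma PolyFam.linear (P Q : ℂ[X]) : PolyFam 1 fun w => P - C w * Q :=
  ⟨fun i => if i = 0 then P else -Q, fun w => by simp [Finset.sum_range_succ, sub_eq_add_neg]⟩

/-- A multilinear form evaluated at polynomial families is a polynomial in the parameter. -/
lemma exists_polynomial_of_polyFam {n : ℕ} (J : ℂ[X] [⋀^Fin n]→ₗ[ℂ] ℂ) (d : Fin n → ℕ)
    {v : Fin n → ℂ → ℂ[X]} (h : ∀ k, PolyFam (d k) (v k)) :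
    ∃ p : ℂ[X], p.natDegree ≤ ∑ k, d k ∧ ∀ w, p.eval w = J fun k => v k w := by
  choose c hc using h
  refine ⟨∑ r : (k : Fin n) → Fin (d k + 1), C (J fun k => c k (r k)) * X ^ (∑ k, (r k : ℕ)),
    ?_, fun w => ?_⟩
  · refine natDegree_sum_le_of_forall_le _ _ fun r _ => ?_
    refine (natDegree_C_mul_X_pow_le _ _).trans ?_
    exact Finset.sum_le_sum fun k _ => Nat.lt_succ_iff.1 (r k).2
  · have h1 : (fun k => v k w) = fun k => ∑ i : Fin (d k + 1), (w ^ (i : ℕ)) • c k i := by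
      ext1 k
      rw [hc, Finset.sum_range]
      simp only [smul_eq_C_mul]
    have h2 := J.toMultilinearMap.map_sum
      (g := fun k (i : Fin (d k + 1)) => (w ^ (i : ℕ)) • c k i)
    have h3 : J (fun k => ∑ i : Fin (d k + 1), (w ^ (i : ℕ)) • c k i) =
      ∑ r : (k : Fin n) → Fin (d k + 1), J fun k => (w ^ (r k : ℕ)) • c k (r k) := h2
    rw [h1, h3, eval_finsetSum]
    refine Finset.sum_congr rfl fun r _ => ?_
    have h4 : J (fun k => (w ^ (r k : ℕ)) • c k (r k)) =
        (∏ k, w ^ (r k : ℕ)) • J fun k => c k (r k) :=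
      J.toMultilinearMap.map_smul_univ (fun k => w ^ (r k : ℕ)) fun k => c k (r k)
    rw [h4, eval_mul, eval_C, eval_pow, eval_X, Finset.prod_pow_eq_pow_sum, smul_eq_mul, mul_comm]

/-- Lagrange interpolation over a finite type of nodes. -/
lemma eval_eq_lagrange {ι : Type*} [Fintype ι] [DecidableEq ι] {x : ι → ℂ}
    (hx : Function.Injective x) {p : ℂ[X]} (hp : p.natDegree < Fintype.card ι) (y : ℂ) :
    p.eval y = ∑ i, p.eval (x i) * ∏ j ∈ Finset.univ.erase i, (y - x j) / (x i - x j) := by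
  have h : p.degree < (Finset.univ : Finset ι).card :=
    degree_le_natDegree.trans_lt (by exact_mod_cast hp)
  conv_lhs => rw [Lagrange.eq_interpolate (s := Finset.univ) hx.injOn h]
  rw [Lagrange.interpolate_apply, eval_finsetSum]
  refine Finset.sum_congr rfl fun i _ => ?_
  rw [eval_mul, eval_C, Lagrange.basis, eval_prod]
  congr 1
  refine Finset.prod_congr rfl fun j _ => ?_
  simp [Lagrange.basisDivisor, div_eq_inv_mul]

/-! ### The forms for a shift of one of the `b`-variables -/

/-- The family interpolating between the unshifted and the shifted forms. -/
def vB (τ : ℂ) (M D T K : ℂ[X]) (w : ℂ) : ℂ[X] :=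
  (M * (C (τ⁻¹ ^ 4) * dil (τ ^ 2)⁻¹ K - K) - D * (dil (τ ^ 2) T - T)) -
    C w * (M * dq (τ ^ 2)⁻¹ K - D * dq (τ ^ 2) T)

lemma X_mul_vB {τ : ℂ} (hτ : τ ≠ 0) (M D T K : ℂ[X]) (w : ℂ) :
    X * vB τ M D T K w = M * (C (τ⁻¹ ^ 4) * (X - C (w * τ ^ 4)) * dil (τ ^ 2)⁻¹ K - (X - C w) * K) -
      (X - C w) * D * (dil (τ ^ 2) T - T) := by
  have h1 := X_mul_dq (τ ^ 2)⁻¹ K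
  have h2 := X_mul_dq (τ ^ 2) T
  have h3 : C (τ⁻¹ ^ 4) * C (w * τ ^ 4) = C w := by
    rw [← C_mul]; congr 1; field_simp
  unfold vB
  linear_combination (-C w * M) * h1 + C w * D * h2 + M * dil (τ ^ 2)⁻¹ K * h3

lemma dil_quadratic {τ : ℂ} (hτ : τ ≠ 0) (w : ℂ) (K : ℂ[X]) :
    dil (τ ^ 2)⁻¹ ((X - C (w * τ ^ 2)) * (X - C w) * K) =
      C (τ⁻¹ ^ 4) * (X - C (w * τ ^ 4)) * (X - C (w * τ ^ 2)) * dil (τ ^ 2)⁻¹ K := by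
  simp only [dil_mul, dil_sub, dil_X, dil_C]
  have h1 : C (w * τ ^ 2) = C ((τ ^ 2)⁻¹) * C (w * τ ^ 4) := by
    rw [← C_mul]; congr 1; field_simp
  have h2 : C w = C ((τ ^ 2)⁻¹) * C (w * τ ^ 2) := by
    rw [← C_mul]; congr 1; field_simp
  have h3 : C (τ⁻¹ ^ 4) = C ((τ ^ 2)⁻¹) * C ((τ ^ 2)⁻¹) := by
    rw [← C_mul]; congr 1; field_simp
  linear_combination (-(C ((τ ^ 2)⁻¹) * X - C w) * dil (τ ^ 2)⁻¹ K) * h1 -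
    (C ((τ ^ 2)⁻¹) * (X - C (w * τ ^ 4)) * dil (τ ^ 2)⁻¹ K) * h2 -
    ((X - C (w * τ ^ 4)) * (X - C (w * τ ^ 2)) * dil (τ ^ 2)⁻¹ K) * h3

/-- The quadratic factor of Q is chosen so that it and its dilation by τ⁻² share X − wτ². Absorbing
this factor into M = A(X − wτ²) leaves an expression affine in w when M is held fixed. -/
lemma form_eq_vB {τ : ℂ} (hτ : τ ≠ 0) (A D T K : ℂ[X]) (w : ℂ) :
    form (τ ^ 2) A ((X - C w) * D) T ((X - C (w * τ ^ 2)) * (X - C w) * K) =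
      vB τ (A * (X - C (w * τ ^ 2))) D T K w := by
  refine eq_of_X_mul_eq ?_
  rw [X_mul_form, X_mul_vB hτ, dil_quadratic hτ]
  ring

/-- After the shift B contains X − wτ², so the whole form is divisible by it. Exchanging this factor
for X − w, as the comparison of J' with J prescribes, gives again `vB`, now with M = A(X − w). -/
lemma exists_form_shifted_B {τ : ℂ} (hτ : τ ≠ 0) (A D T K : ℂ[X]) (w : ℂ) :
    ∃ G, form (τ ^ 2) A ((X - C (w * τ ^ 2)) * D) T ((X - C (w * τ ^ 2)) * (X - C w) * K) =
        (X - C (w * τ ^ 2)) * G ∧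
      (X - C w) * G = vB τ (A * (X - C w)) D T K w := by
  set R : ℂ[X] := C (τ⁻¹ ^ 4) * (X - C (w * τ ^ 4)) * dil (τ ^ 2)⁻¹ K - (X - C w) * K with hR
  -- R has no constant term because τ⁻⁴·wτ⁴ = w.
  have hR0 : X * R.divX = R := by
    have h := divX_mul_X_add R
    have h0 : R.coeff 0 = 0 := by
      rw [coeff_zero_eq_eval_zero, hR]
      simp only [eval_sub, eval_mul, eval_C, eval_X, eval_dil, mul_zero]
      field_simp
      ring
    rw [h0, C_0, add_zero] at h
    rw [mul_comm]; exact h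
  refine ⟨A * R.divX - D * dq (τ ^ 2) T, eq_of_X_mul_eq ?_, eq_of_X_mul_eq ?_⟩
  · rw [X_mul_form, dil_quadratic hτ]
    have h2 := X_mul_dq (τ ^ 2) T
    linear_combination (-(X - C (w * τ ^ 2)) * A) * hR0 + (X - C (w * τ ^ 2)) * D * h2 -
      (X - C (w * τ ^ 2)) * A * hR
  · rw [X_mul_vB hτ]
    have h2 := X_mul_dq (τ ^ 2) T
    linear_combination ((X - C w) * A) * hR0 - (X - C w) * D * h2 + (X - C w) * A * hR

section

variable {n : ℕ} {τ : ℂ} (α : Fin n → ℂ) {D : ℂ[X]} {T K : Fin n → ℂ[X]}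

lemma natDegree_X_sub_C_mul_X_pow_le (c : ℂ) (k : Fin n) :
    ((X - C c) * X ^ (k : ℕ)).natDegree ≤ n := by
  rw [(monic_X_sub_C c).natDegree_mul (monic_X_pow _), natDegree_X_sub_C, natDegree_X_pow]
  have := k.2
  omega

/-- The unshifted form, for the division with `y` among the `b`-variables; `w = y / τ`. -/
theorem baseVal_B (hτ : τ ≠ 0) (w : ℂ) {J : ℂ[X] [⋀^Fin n]→ₗ[ℂ] ℂ} {B : ℂ[X]}
    (hB : B = (X - C w) * D)
    (hJ : KillsExact (τ ^ 2) (∏ i, (X - C (α i))) B J)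
    (hTK : ∀ k : Fin n, D * T k - (∏ i, (X - C (α i))) * (X - C (w * τ ^ 2)) * K k = X ^ (k : ℕ)) :
    baseVal (τ ^ 2) (monic_prod_X_sub_C' α) B J = (∏ i, D.eval (α i)) *
      J (fun k => vB τ ((∏ i, (X - C (α i))) * (X - C (w * τ ^ 2))) D (T k) (K k) w) := by
  subst hB
  rw [map_form_inverse α hJ D (T := T) (Q := fun k => (X - C (w * τ ^ 2)) * (X - C w) * K k)]
  · simp only [form_eq_vB hτ]
  · exact fun k => ⟨(X - C (w * τ ^ 2)) * K k, by linear_combination hTK k⟩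
  · intro k
    have : (X - C w) * D * T k - (∏ i, (X - C (α i))) * ((X - C (w * τ ^ 2)) * (X - C w) * K k) =
        (X - C w) * X ^ (k : ℕ) := by linear_combination (X - C w) * hTK k
    rw [this]
    exact natDegree_X_sub_C_mul_X_pow_le w k

/-- The shifted form; `w = y τ`. -/
theorem baseVal_shifted_B (hτ : τ ≠ 0) (w : ℂ) {J J' : ℂ[X] [⋀^Fin n]→ₗ[ℂ] ℂ} {B : ℂ[X]}
    (hB : B = (X - C (w * τ ^ 2)) * D)
    (hJ' : KillsExact (τ ^ 2) (∏ i, (X - C (α i))) B J')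
    (hJJ' : ∀ G : Fin n → ℂ[X], J' (fun k => (X - C (w * τ ^ 2)) * G k) =
      J fun k => (X - C w) * G k)
    (hTK : ∀ k : Fin n, D * T k - (∏ i, (X - C (α i))) * (X - C w) * K k = X ^ (k : ℕ)) :
    baseVal (τ ^ 2) (monic_prod_X_sub_C' α) B J' = (∏ i, D.eval (α i)) *
      J (fun k => vB τ ((∏ i, (X - C (α i))) * (X - C w)) D (T k) (K k) w) := by
  subst hB
  choose G hG hG' using fun k => exists_form_shifted_B hτ (∏ i, (X - C (α i))) D (T k) (K k) w
  rw [map_form_inverse α hJ' D (T := T) (Q := fun k => (X - C (w * τ ^ 2)) * (X - C w) * K k)]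
  · simp only [hG, hJJ', hG']
  · exact fun k => ⟨(X - C w) * K k, by linear_combination hTK k⟩
  · intro k
    have : (X - C (w * τ ^ 2)) * D * T k -
        (∏ i, (X - C (α i))) * ((X - C (w * τ ^ 2)) * (X - C w) * K k) =
        (X - C (w * τ ^ 2)) * X ^ (k : ℕ) := by linear_combination (X - C (w * τ ^ 2)) * hTK k
    rw [this]
    exact natDegree_X_sub_C_mul_X_pow_le _ k

end

lemma exists_polynomial_vB {n : ℕ} (J : ℂ[X] [⋀^Fin n]→ₗ[ℂ] ℂ) (τ : ℂ) (M D : ℂ[X])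
    (T K : Fin n → ℂ[X]) :
    ∃ p : ℂ[X], p.natDegree ≤ n ∧ ∀ w, p.eval w = J fun k => vB τ M D (T k) (K k) w := by
  obtain ⟨p, hp, hpw⟩ := exists_polynomial_of_polyFam J (fun _ => 1)
    (v := fun k w => vB τ M D (T k) (K k) w) fun k => PolyFam.linear _ _
  exact ⟨p, by simpa using hp, hpw⟩

end
end SmirnovIntegral

namespace SmirnovIntegral
open scoped BigOperators Topology
noncomputable section

open Polynomial

/-! ### The forms for a shift of one of the `a`-variables -/

lemma PolyFam.map {d : ℕ} {v : ℂ → ℂ[X]} (h : PolyFam d v) (f : ℂ[X] →ₗ[ℂ] ℂ[X]) :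
    PolyFam d fun w => f (v w) := by
  obtain ⟨c, hc⟩ := h
  refine ⟨fun i => f (c i), fun w => ?_⟩
  simp only [hc, map_sum, ← smul_eq_C_mul, map_smul]

lemma PolyFam.mono {d e : ℕ} (hde : d ≤ e) {v : ℂ → ℂ[X]} (h : PolyFam d v) : PolyFam e v := by
  obtain ⟨c, hc⟩ := h
  have h1 : v = fun w => ∑ i ∈ Finset.range (d + 1), C (w ^ i) * c i := funext hc
  rw [h1]
  refine PolyFam.sum _ fun i hi => PolyFam.monomial ?_ _
  have := Finset.mem_range.1 hi
  omega

/-- The difference quotient as a linear map. -/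
def dqLin (s : ℂ) : ℂ[X] →ₗ[ℂ] ℂ[X] where
  toFun := dq s
  map_add' := dq_add s
  map_smul' a P := by simp only [smul_eq_C_mul, dq_C_mul, RingHom.id_apply]

lemma dqLin_apply (s : ℂ) (P : ℂ[X]) : dqLin s P = dq s P := rfl

/-- Q is the quotient of X^(j+2) by (X − w)(X − wt), of degree j in w. Its top term in w is constant
in X and is killed by `dq`; the factor X − w only makes up for the degree thus lost. This saving of
one gives the bound l − 1 in the second equation. -/
lemma exists_quotient_monomial (t s : ℂ) (P : ℂ[X]) (j : ℕ) :
    ∃ (Q : ℂ → ℂ[X]) (a b : ℂ), PolyFam j Q ∧ PolyFam j (fun w => (X - C w) * (P * dq s (Q w))) ∧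
      ∀ w, X ^ (j + 2) = (X - C w) * (X - C (w * t)) * Q w + C (w ^ (j + 1) * a) * X +
        C (w ^ (j + 2) * b) := by
  induction j with
  | zero =>
    refine ⟨fun _ => 1, 1 + t, -t, by simpa using PolyFam.monomial le_rfl (i := 0) 1, ?_,
      fun w => ?_⟩
    · have : dq s (1 : ℂ[X]) = 0 := dq_C s 1
      simpa only [this, mul_zero] using PolyFam.zero 0
    · simp only [map_mul, map_pow, map_add, map_one, map_neg]
      ring
  | succ j ih =>
    obtain ⟨Q, a, b, hQ, -, h⟩ := ih
    refine ⟨fun w => X * Q w + C (w ^ (j + 1)) * C a, a * (1 + t) + b, -(a * t), ?_, ?_,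
      fun w => ?_⟩
    · exact ((hQ.const_mul X).mono (Nat.le_succ j)).add (PolyFam.monomial le_rfl _)
    · have h1 : (fun w => (X - C w) * (P * dq s (X * Q w + C (w ^ (j + 1)) * C a))) =
          fun w => (X - C w) * (P * dqLin s (X * Q w)) := by
        ext1 w
        rw [dq_add, ← C_mul, dq_C, add_zero, dqLin_apply]
      rw [h1]
      exact (((hQ.const_mul X).map (dqLin s)).const_mul P).X_sub_C_mul
    · have h1 := h w
      simp only [map_mul, map_pow, map_add, map_one, map_neg] at h1 ⊢
      linear_combination X * h1

lemma exists_quotient (t s : ℂ) (P q : ℂ[X]) (e : ℕ) (hq : q.natDegree ≤ e + 2) :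
    ∃ Q : ℂ → ℂ[X], PolyFam e (fun w => (X - C w) * (P * dq s (Q w))) ∧
      ∀ w, (q - (X - C w) * (X - C (w * t)) * Q w).natDegree ≤ 1 := by
  choose Q a b _ hQ' h using exists_quotient_monomial t s P
  refine ⟨fun w => ∑ k ∈ Finset.range (e + 1), C (q.coeff (k + 2)) * Q k w, ?_, fun w => ?_⟩
  · have h1 : (fun w => (X - C w) * (P * dq s (∑ k ∈ Finset.range (e + 1),
        C (q.coeff (k + 2)) * Q k w))) = fun w => ∑ k ∈ Finset.range (e + 1),
          C (q.coeff (k + 2)) * ((X - C w) * (P * dq s (Q k w))) := by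
      ext1 w
      rw [← dqLin_apply, map_sum, Finset.mul_sum, Finset.mul_sum]
      refine Finset.sum_congr rfl fun k _ => ?_
      rw [dqLin_apply, dq_C_mul]
      ring
    rw [h1]
    refine PolyFam.sum _ fun k hk => ((hQ' k).mono ?_).const_mul _
    have := Finset.mem_range.1 hk
    omega
  · have h1 : q = (∑ k ∈ Finset.range (e + 1), C (q.coeff (k + 2)) * X ^ (k + 2)) +
        C (q.coeff 1) * X + C (q.coeff 0) := by
      conv_lhs => rw [q.as_sum_range_C_mul_X_pow' (n := e + 1 + 1 + 1) (by omega)]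
      rw [Finset.sum_range_succ', Finset.sum_range_succ']
      simp
    have h2 : q - (X - C w) * (X - C (w * t)) *
        (∑ k ∈ Finset.range (e + 1), C (q.coeff (k + 2)) * Q k w) =
        (∑ k ∈ Finset.range (e + 1), C (q.coeff (k + 2)) *
          (C (w ^ (k + 1) * a k) * X + C (w ^ (k + 2) * b k))) +
        C (q.coeff 1) * X + C (q.coeff 0) := by
      conv_lhs => rw [h1]
      rw [Finset.mul_sum, add_sub_right_comm, add_sub_right_comm, ← Finset.sum_sub_distrib]
      congr 2
      · refine Finset.sum_congr rfl fun k _ => ?_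
        rw [← h1]
        linear_combination C (q.coeff (k + 2)) * h k w
    rw [h2]
    refine (natDegree_add_C).le.trans ((natDegree_add_le _ _).trans (max_le ?_ ?_))
    · refine natDegree_sum_le_of_forall_le _ _ fun k _ => ?_
      refine (natDegree_C_mul_le _ _).trans ?_
      compute_degree
    · compute_degree

/-- The family interpolating between the unshifted and the shifted forms. -/
def vC (τ : ℂ) (M D S K : ℂ[X]) (w : ℂ) : ℂ[X] :=
  (D * (dil (τ ^ 2)⁻¹ S - S) - M * (C (τ ^ 4) * dil (τ ^ 2) K - K)) -
    C w * (D * dq (τ ^ 2)⁻¹ S - M * dq (τ ^ 2) K)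

lemma X_mul_vC {τ : ℂ} (hτ : τ ≠ 0) (M D S K : ℂ[X]) (w : ℂ) :
    X * vC τ M D S K w = (X - C w) * D * (dil (τ ^ 2)⁻¹ S - S) -
      M * (C (τ ^ 4) * (X - C (w * τ⁻¹ ^ 4)) * dil (τ ^ 2) K - (X - C w) * K) := by
  have h1 := X_mul_dq (τ ^ 2)⁻¹ S
  have h2 := X_mul_dq (τ ^ 2) K
  have h3 : C (τ ^ 4) * C (w * τ⁻¹ ^ 4) = C w := by
    rw [← C_mul]; congr 1; field_simp
  unfold vC
  linear_combination (-C w * D) * h1 + C w * M * h2 - M * dil (τ ^ 2) K * h3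

lemma dil_quadratic' {τ : ℂ} (hτ : τ ≠ 0) (w : ℂ) (K : ℂ[X]) :
    dil (τ ^ 2) ((X - C (w * τ⁻¹ ^ 2)) * (X - C w) * K) =
      C (τ ^ 4) * (X - C (w * τ⁻¹ ^ 4)) * (X - C (w * τ⁻¹ ^ 2)) * dil (τ ^ 2) K := by
  have h := dil_quadratic (inv_ne_zero hτ) w K
  simpa only [inv_pow, inv_inv] using h

lemma form_eq_vC {τ : ℂ} (hτ : τ ≠ 0) (B D S K : ℂ[X]) (w : ℂ) :
    form (τ ^ 2) ((X - C w) * D) B ((X - C (w * τ⁻¹ ^ 2)) * (X - C w) * K) S =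
      vC τ (B * (X - C (w * τ⁻¹ ^ 2))) D S K w := by
  refine eq_of_X_mul_eq ?_
  rw [X_mul_form, X_mul_vC hτ, dil_quadratic' hτ]
  ring

/-- As for a shift of a `b`-variable, with the roles of A and B, and of τ and τ⁻¹, exchanged. -/
lemma exists_form_shifted_C {τ : ℂ} (hτ : τ ≠ 0) (B D S K : ℂ[X]) (w : ℂ) :
    ∃ G, form (τ ^ 2) ((X - C (w * τ⁻¹ ^ 2)) * D) B ((X - C (w * τ⁻¹ ^ 2)) * (X - C w) * K) S =
        (X - C (w * τ⁻¹ ^ 2)) * G ∧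
      (X - C w) * G = vC τ (B * (X - C w)) D S K w := by
  set R : ℂ[X] := C (τ ^ 4) * (X - C (w * τ⁻¹ ^ 4)) * dil (τ ^ 2) K - (X - C w) * K with hR
  have hR0 : X * R.divX = R := by
    have h := divX_mul_X_add R
    have h0 : R.coeff 0 = 0 := by
      rw [coeff_zero_eq_eval_zero, hR]
      simp only [eval_sub, eval_mul, eval_C, eval_X, eval_dil, mul_zero]
      field_simp
      ring
    rw [h0, C_0, add_zero] at h
    rw [mul_comm]; exact h
  have h2 := X_mul_dq (τ ^ 2)⁻¹ S
  refine ⟨D * dq (τ ^ 2)⁻¹ S - B * R.divX, eq_of_X_mul_eq ?_, eq_of_X_mul_eq ?_⟩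
  · rw [X_mul_form, dil_quadratic' hτ]
    linear_combination (X - C (w * τ⁻¹ ^ 2)) * B * hR0 - (X - C (w * τ⁻¹ ^ 2)) * D * h2 +
      (X - C (w * τ⁻¹ ^ 2)) * B * hR
  · rw [X_mul_vC hτ]
    linear_combination (-(X - C w) * B) * hR0 + (X - C w) * D * h2 - (X - C w) * B * hR

section

variable {m : ℕ} (γ : Fin m → ℂ) {A B M : ℂ[X]}

lemma natDegree_sub_mul_divByMonic_le (P : ℂ[X]) :
    (P - (∏ j, (X - C (γ j))) * (P /ₘ ∏ j, (X - C (γ j)))).natDegree ≤ m := by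
  have hγ := monic_prod_X_sub_C' γ
  rw [show P - (∏ j, (X - C (γ j))) * (P /ₘ ∏ j, (X - C (γ j))) = P %ₘ ∏ j, (X - C (γ j)) from
    (modByMonic_eq_sub_mul_div _ _).symm]
  exact (natDegree_le_natDegree (degree_modByMonic_lt _ hγ).le).trans
    (natDegree_prod_X_sub_C γ).le

lemma natDegree_X_sub_C_mul_le {P : ℂ[X]} {d : ℕ} (c : ℂ) (h : P.natDegree ≤ d) :
    ((X - C c) * P).natDegree ≤ d + 1 :=
  natDegree_mul_le.trans (by rw [natDegree_X_sub_C]; omega)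

lemma natDegree_le_of_X_sub_C_mul {P : ℂ[X]} {d : ℕ} (c : ℂ)
    (h : ((X - C c) * P).natDegree ≤ d) : P.natDegree ≤ d := by
  by_cases hP : P = 0
  · simp [hP]
  · rw [(monic_X_sub_C c).natDegree_mul' hP, natDegree_X_sub_C] at h
    omega

/-- Divide M by ∏(X − γ_j): the remainder has degree at most m, and the quotient, reduced by the
quadratic factor, contributes at most m + 1, the degree of A. -/
lemma natDegree_quotient_le (t w : ℂ) {Q : ℂ[X]}
    (hQ : (M /ₘ (∏ j, (X - C (γ j))) - (X - C w) * (X - C (w * t)) * Q).natDegree ≤ 1) :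
    (M - (∏ j, (X - C (γ j))) * ((X - C w) * (X - C (w * t)) * Q)).natDegree ≤ m + 1 := by
  set Cp := ∏ j, (X - C (γ j)) with hCp
  have h1 : M - Cp * ((X - C w) * (X - C (w * t)) * Q) =
      (M - Cp * (M /ₘ Cp)) + Cp * (M /ₘ Cp - (X - C w) * (X - C (w * t)) * Q) := by ring
  rw [h1]
  refine (natDegree_add_le _ _).trans (max_le ?_ ?_)
  · exact (natDegree_sub_mul_divByMonic_le γ M).trans (Nat.le_succ m)
  · refine natDegree_mul_le.trans ?_
    have : Cp.natDegree = m := natDegree_prod_X_sub_C γ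
    omega

/-- The unshifted form, for the division with `y` among the `a`-variables; `w = y τ`. -/
theorem baseVal_C {τ : ℂ} (hτ : τ ≠ 0) (w : ℂ) {J : ℂ[X] [⋀^Fin (m + 1)]→ₗ[ℂ] ℂ}
    (hA : A.Monic) (hAγ : A = (X - C w) * ∏ j, (X - C (γ j)))
    (hM : M = B * (X - C (w * τ⁻¹ ^ 2))) (hJ : KillsExact (τ ^ 2) A B J) {Q : ℂ[X]}
    (hQ : (M /ₘ (∏ j, (X - C (γ j))) - (X - C w) * (X - C (w * τ⁻¹ ^ 2)) * Q).natDegree ≤ 1) :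
    J (Matrix.vecCons ((X - C w) * ((∏ j, (X - C (γ j))) * dq (τ ^ 2)⁻¹ Q)) fun k : Fin m =>
      vC τ M (∏ j, (X - C (γ j))) ((M * X ^ (k : ℕ)) /ₘ ∏ j, (X - C (γ j))) (X ^ (k : ℕ)) w) =
      (∏ j, (γ j - w * τ⁻¹ ^ 2)) * baseVal (τ ^ 2) hA B J := by
  have hQ' := natDegree_quotient_le γ _ w hQ
  -- The representatives are T = 1 and T = (X − w)(X − wτ⁻²)X^k. For the latter BT = (X − w)MX^k, so
  -- dividing MX^k by ∏(X − γ_j) gives an admissible Q. The bounds for T = 1 are checked after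
  -- multiplication by X − wτ⁻², which turns B into M.
  have h := map_form_cons γ w hA hAγ hJ (X - C (w * τ⁻¹ ^ 2)) (Q₀ := Q)
    (Q := fun k : Fin m => (M * X ^ (k : ℕ)) /ₘ ∏ j, (X - C (γ j))) ?_ ?_
  · simp only [eval_sub, eval_X, eval_C] at h
    rw [← h]
    have h1 : form (τ ^ 2) A B 1 Q = (X - C w) * ((∏ j, (X - C (γ j))) * dq (τ ^ 2)⁻¹ Q) := by
      unfold form
      have : dq (τ ^ 2) (1 : ℂ[X]) = 0 := dq_C _ 1
      rw [this, hAγ, mul_zero, sub_zero, mul_assoc]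
    rw [h1]
    congr 2
    ext1 k
    rw [hM, ← form_eq_vC hτ, ← hAγ]
    congr 1
    ring
  · refine natDegree_le_of_X_sub_C_mul (w * τ⁻¹ ^ 2) ?_
    convert hQ' using 2
    rw [hM, hAγ]
    ring
  · intro k
    convert natDegree_X_sub_C_mul_le w (natDegree_sub_mul_divByMonic_le γ (M * X ^ (k : ℕ))) using 2
    rw [hM, hAγ]
    ring

/-- The shifted form; `w = y / τ`. -/
theorem baseVal_shifted_C {τ : ℂ} (hτ : τ ≠ 0) (w : ℂ) {J J' : ℂ[X] [⋀^Fin (m + 1)]→ₗ[ℂ] ℂ}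
    (hA : A.Monic) (hAγ : A = (X - C (w * τ⁻¹ ^ 2)) * ∏ j, (X - C (γ j)))
    (hM : M = B * (X - C w)) (hJ' : KillsExact (τ ^ 2) A B J')
    (hJJ' : ∀ G : Fin (m + 1) → ℂ[X], J' (fun k => (X - C (w * τ⁻¹ ^ 2)) * G k) =
      J fun k => (X - C w) * G k) {Q : ℂ[X]}
    (hQ : (M /ₘ (∏ j, (X - C (γ j))) - (X - C w) * (X - C (w * τ⁻¹ ^ 2)) * Q).natDegree ≤ 1) :
    J (Matrix.vecCons ((X - C w) * ((∏ j, (X - C (γ j))) * dq (τ ^ 2)⁻¹ Q)) fun k : Fin m =>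
      vC τ M (∏ j, (X - C (γ j))) ((M * X ^ (k : ℕ)) /ₘ ∏ j, (X - C (γ j))) (X ^ (k : ℕ)) w) =
      (∏ j, (γ j - w)) * baseVal (τ ^ 2) hA B J' := by
  have hQ' := natDegree_quotient_le γ _ w hQ
  have h := map_form_cons γ (w * τ⁻¹ ^ 2) hA hAγ hJ' (X - C w) (Q₀ := Q)
    (Q := fun k : Fin m => (M * X ^ (k : ℕ)) /ₘ ∏ j, (X - C (γ j))) ?_ ?_
  · simp only [eval_sub, eval_X, eval_C] at h
    rw [← h]
    choose G hG hG' using fun k : Fin m => exists_form_shifted_C hτ B (∏ j, (X - C (γ j)))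
      ((M * X ^ (k : ℕ)) /ₘ ∏ j, (X - C (γ j))) (X ^ (k : ℕ)) w
    -- Every row is divisible by X − wτ⁻², so `hJJ'` exchanges this factor for X − w in all rows at
    -- once.
    have h1 : (Matrix.vecCons (form (τ ^ 2) A B 1 Q) fun k : Fin m =>
        form (τ ^ 2) A B ((X - C (w * τ⁻¹ ^ 2)) * ((X - C w) * X ^ (k : ℕ)))
          ((M * X ^ (k : ℕ)) /ₘ ∏ j, (X - C (γ j)))) = fun i => (X - C (w * τ⁻¹ ^ 2)) *
        (Matrix.vecCons ((∏ j, (X - C (γ j))) * dq (τ ^ 2)⁻¹ Q) G : Fin (m + 1) → ℂ[X]) i := by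
      ext1 i
      refine Fin.cases ?_ (fun k => ?_) i
      · simp only [Matrix.cons_val_zero]
        unfold form
        have : dq (τ ^ 2) (1 : ℂ[X]) = 0 := dq_C _ 1
        rw [this, hAγ, mul_zero, sub_zero, mul_assoc]
      · simp only [Matrix.cons_val_succ]
        rw [← hG, hAγ, mul_assoc (X - C (w * τ⁻¹ ^ 2)) (X - C w)]
    rw [h1, hJJ']
    congr 1
    ext1 i
    refine Fin.cases ?_ (fun k => ?_) i
    · simp only [Matrix.cons_val_zero]
    · simp only [Matrix.cons_val_succ]
      rw [hG', hM]
  · refine natDegree_le_of_X_sub_C_mul w ?_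
    convert hQ' using 2
    rw [hM, hAγ]
    ring
  · intro k
    convert natDegree_X_sub_C_mul_le (w * τ⁻¹ ^ 2)
      (natDegree_sub_mul_divByMonic_le γ (M * X ^ (k : ℕ))) using 2
    rw [hM, hAγ]
    ring

end

lemma exists_polynomial_vC {m : ℕ} (J : ℂ[X] [⋀^Fin (m + 1)]→ₗ[ℂ] ℂ) (τ : ℂ) (M D : ℂ[X])
    (S K : Fin m → ℂ[X]) {e : ℕ} {v : ℂ → ℂ[X]} (hv : PolyFam e v) :
    ∃ p : ℂ[X], p.natDegree ≤ e + m ∧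
      ∀ w, p.eval w = J (Matrix.vecCons (v w) fun k => vC τ M D (S k) (K k) w) := by
  obtain ⟨p, hp, hpw⟩ := exists_polynomial_of_polyFam J (Fin.cons e fun _ => 1)
    (v := fun k w => (Matrix.vecCons (v w) fun k => vC τ M D (S k) (K k) w : Fin (m + 1) → ℂ[X]) k)
    fun k => by
      refine Fin.cases ?_ (fun k => ?_) k
      · simpa using hv
      · exact PolyFam.linear _ _
  refine ⟨p, hp.trans ?_, hpw⟩
  rw [Fin.sum_univ_succ]
  simp

end
end SmirnovIntegral

namespace SmirnovIntegral
open scoped BigOperators Topology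
noncomputable section

open Polynomial

/-! ### The polynomials in the determinant as forms -/

section

variable {m : ℕ} (a : Fin m → ℂ)

lemma sigma_of_lt {κ : ℕ} (h : m < κ) : sigma κ a = 0 := by
  unfold sigma
  rw [Finset.powersetCard_eq_empty.2 (by simpa using h), Finset.sum_empty]

lemma sigma_zero : sigma 0 a = 1 := by simp [sigma]

lemma coeff_prod_one_sub (κ : ℕ) :
    PowerSeries.coeff κ (∏ j, (1 - PowerSeries.C (a j) * PowerSeries.X : PowerSeries ℂ)) =
      (-1) ^ κ * sigma κ a := by
  have h1 : ∀ j, (1 - PowerSeries.C (a j) * PowerSeries.X : PowerSeries ℂ) =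
      1 + PowerSeries.C (-a j) * PowerSeries.X := fun j => by rw [map_neg]; ring
  simp only [h1]
  rw [Finset.prod_one_add, map_sum, sigma, Finset.powersetCard_eq_filter, Finset.sum_filter,
    Finset.mul_sum]
  refine Finset.sum_congr rfl fun t _ => ?_
  rw [Finset.prod_mul_distrib, Finset.prod_const, ← map_prod, PowerSeries.coeff_C_mul,
    PowerSeries.coeff_X_pow, Finset.prod_neg]
  by_cases h : t.card = κ
  · simp [h]
  · simp [h, Ne.symm h]

lemma coeff_prod_X_sub_C (c : ℂ) {κ : ℕ} (h : κ ≤ m) :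
    (∏ j, (X - C (a j * c))).coeff (m - κ) = (-c) ^ κ * sigma κ a := by
  have h1 : ∀ j, X - C (a j * c) = X + C (a j * -c) := fun j => by
    rw [mul_neg, C_neg, sub_eq_add_neg]
  simp only [h1]
  rw [Finset.prod_X_add_C_coeff _ _ (by simp), Finset.card_univ, Fintype.card_fin,
    Nat.sub_sub_self h, sigma, Finset.mul_sum]
  refine Finset.sum_congr rfl fun t ht => ?_
  rw [Finset.prod_mul_distrib, Finset.prod_const, (Finset.mem_powersetCard.1 ht).2, mul_comm]

/-- The power series with coefficients `c ^ κ * σ_κ(a)`. -/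
def sigmaSeries (c : ℂ) : PowerSeries ℂ := PowerSeries.mk fun κ => c ^ κ * sigma κ a

/-- Reversing the coefficients turns statements about top-degree terms into identities of power
series. -/
lemma coe_reflect_prod_X_sub_C (c : ℂ) :
    ((reflect m (∏ j, (X - C (a j * c))) : ℂ[X]) : PowerSeries ℂ) = sigmaSeries a (-c) := by
  ext κ
  rw [Polynomial.coeff_coe, coeff_reflect, sigmaSeries, PowerSeries.coeff_mk]
  by_cases h : κ ≤ m
  · rw [revAt_le h, coeff_prod_X_sub_C a c h]
  · rw [revAt_eq_self_of_lt (not_le.1 h), sigma_of_lt a (not_le.1 h), mul_zero]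
    refine coeff_eq_zero_of_natDegree_lt ?_
    rw [natDegree_prod_X_sub_C]
    exact not_le.1 h

/-- The power series with coefficients `c ^ κ * σ̃_κ(a)`. -/
def sigmaTildeSeries (c : ℂ) : PowerSeries ℂ := PowerSeries.mk fun κ => c ^ κ * sigmaTilde κ a

lemma sigmaSeries_mul_sigmaTildeSeries (c : ℂ) :
    sigmaSeries a (-c) * sigmaTildeSeries a c = 1 := by
  have h1 : sigmaSeries a (-c) = PowerSeries.rescale c
      (∏ j, (1 - PowerSeries.C (a j) * PowerSeries.X : PowerSeries ℂ)) := by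
    ext κ
    rw [PowerSeries.coeff_rescale, coeff_prod_one_sub, sigmaSeries, PowerSeries.coeff_mk, ← mul_assoc,
      ← mul_pow]
    simp
  have h2 : sigmaTildeSeries a c = PowerSeries.rescale c
      (∏ j, (1 - PowerSeries.C (a j) * PowerSeries.X : PowerSeries ℂ)⁻¹) := by
    ext κ
    rw [PowerSeries.coeff_rescale, sigmaTildeSeries, PowerSeries.coeff_mk, sigmaTilde]
  rw [h1, h2, ← map_mul, ← Finset.prod_mul_distrib, Finset.prod_eq_one, map_one]
  intro j _
  exact PowerSeries.mul_inv_cancel _ (by simp)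

/-- The truncation of `sigmaSeries` at order `k`. -/
def headSeries (c : ℂ) (k : ℕ) : PowerSeries ℂ :=
  PowerSeries.mk fun κ => if κ ≤ k then c ^ κ * sigma κ a else 0

/-- The polynomial of degree `k` with leading coefficients those of `∏ (x - a_j c)`. -/
def headPoly (c : ℂ) (k : ℕ) : ℂ[X] :=
  ∑ κ ∈ Finset.range (k + 1), C ((-c) ^ κ * sigma κ a) * X ^ (k - κ)

end

lemma coeff_descending (k : ℕ) (f : ℕ → ℂ) {κ : ℕ} (h : κ ≤ k) :
    (∑ κ ∈ Finset.range (k + 1), C (f κ) * X ^ (k - κ)).coeff (k - κ) = f κ := by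
  rw [finsetSum_coeff, Finset.sum_eq_single_of_mem κ (Finset.mem_range.2 (by omega))]
  · simp
  · intro i hi hne
    have := Finset.mem_range.1 hi
    rw [coeff_C_mul_X_pow, if_neg (by omega)]

lemma natDegree_descending (k : ℕ) (f : ℕ → ℂ) :
    (∑ κ ∈ Finset.range (k + 1), C (f κ) * X ^ (k - κ)).natDegree ≤ k :=
  natDegree_sum_le_of_forall_le _ _ fun _ _ => (natDegree_C_mul_X_pow_le _ _).trans (by omega)

lemma coeff_reflect_descending (k : ℕ) (f : ℕ → ℂ) (κ : ℕ) :
    (reflect k (∑ κ ∈ Finset.range (k + 1), C (f κ) * X ^ (k - κ))).coeff κ =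
      if κ ≤ k then f κ else 0 := by
  rw [coeff_reflect]
  split_ifs with h
  · rw [revAt_le h, coeff_descending k f h]
  · rw [revAt_eq_self_of_lt (not_le.1 h)]
    exact coeff_eq_zero_of_natDegree_lt ((natDegree_descending k f).trans_lt (not_le.1 h))

lemma X_mul_dq_descending (s : ℂ) (k : ℕ) (f : ℕ → ℂ) :
    dq s (∑ κ ∈ Finset.range (k + 1), C (f κ) * X ^ (k - κ)) =
      ∑ κ ∈ Finset.range k, C ((s ^ (k - κ) - 1) * f κ) * X ^ (k - 1 - κ) := by
  refine eq_of_X_mul_eq ?_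
  rw [X_mul_dq, Finset.sum_range_succ, Finset.mul_sum, dil_add]
  unfold dil
  rw [Polynomial.sum_comp]
  simp only [Nat.sub_self, pow_zero, mul_one, C_comp]
  rw [add_sub_add_right_eq_sub, ← Finset.sum_sub_distrib]
  refine Finset.sum_congr rfl fun κ hκ => ?_
  have hκ := Finset.mem_range.1 hκ
  obtain ⟨e, he⟩ : ∃ e, k - κ = e + 1 := ⟨k - κ - 1, by omega⟩
  rw [show k - 1 - κ = e by omega, he]
  simp only [mul_comp, C_comp, pow_comp, X_comp, map_mul, map_sub, map_pow, map_one]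
  ring

/-! ### The generating series of φ, and the rows of Δ as difference quotients. -/

section

variable {n l : ℕ} (τ : ℂ) (a : Fin n → ℂ) (b : Fin l → ℂ) (k : ℕ)

/-- The polynomial of degree `l - n + k` with coefficients `(-τ⁻¹) ^ κ * φ`. -/
def phiPoly : ℂ[X] :=
  ∑ κ ∈ Finset.range (l - n + k + 1), C ((-τ⁻¹) ^ κ * phi τ (k + 1) κ a b) * X ^ (l - n + k - κ)

/-- The generating series of the `φ`. -/
def phiSeries : PowerSeries ℂ := PowerSeries.mk fun κ => (-τ⁻¹) ^ κ * phi τ (k + 1) κ a b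

variable {τ}

/-- The condition λ ≤ α keeps only the tail of the σ(a)-series, so the double sum in φ is a product
of three series. The signs and powers of τ distribute as −τ for a and −τ⁻¹ for b. -/
lemma phiSeries_eq (hτ : τ ≠ 0) : phiSeries τ a b k = sigmaSeries b (-τ⁻¹) -
    (sigmaSeries a (-τ) - headSeries a (-τ) k) * sigmaTildeSeries a τ * sigmaSeries b (-τ⁻¹) := by
  ext κ
  rw [map_sub, PowerSeries.coeff_mul, Finset.Nat.sum_antidiagonal_eq_sum_range_succ_mk]
  simp only [PowerSeries.coeff_mul, Finset.Nat.sum_antidiagonal_eq_sum_range_succ_mk]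
  simp only [phiSeries, sigmaSeries, headSeries, sigmaTildeSeries, PowerSeries.coeff_mk, map_sub, phi]
  rw [mul_sub, Finset.mul_sum]
  congr 1
  simp only [Finset.mul_sum, Finset.sum_mul]
  have h1 : ∀ β ∈ Finset.range κ.succ, ∀ α ∈ Finset.range β.succ,
      ((-τ) ^ α * sigma α a - if α ≤ k then (-τ) ^ α * sigma α a else 0) *
        (τ ^ (β - α) * sigmaTilde (β - α) a) * ((-τ⁻¹) ^ (κ - β) * sigma (κ - β) b) =
      if k + 1 ≤ α then (-τ⁻¹) ^ κ * ((-1) ^ (β - α) * τ ^ (2 * β) * sigma (κ - β) b *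
        sigma α a * sigmaTilde (β - α) a) else 0 := by
    intro β hβ α hα
    have hβ := Finset.mem_range_succ_iff.1 hβ
    have hα := Finset.mem_range_succ_iff.1 hα
    by_cases h : α ≤ k
    · rw [if_pos h, if_neg (by omega), sub_self, zero_mul, zero_mul]
    · rw [if_neg h, if_pos (by omega)]
      obtain ⟨γ, rfl⟩ := Nat.exists_eq_add_of_le hα
      obtain ⟨δ, rfl⟩ := Nat.exists_eq_add_of_le hβ
      simp only [Nat.add_sub_cancel_left]
      have h2 : (-τ) ^ α * τ ^ γ * (-τ⁻¹) ^ δ =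
          (-τ⁻¹) ^ (α + γ + δ) * ((-1) ^ γ * τ ^ (2 * (α + γ))) := by
        have h3 : -τ = (-τ⁻¹) * τ ^ 2 := by field_simp
        have h4 : τ = (-τ⁻¹) * (-1) * τ ^ 2 := by field_simp
        have h5 : τ ^ γ = ((-τ⁻¹) * (-1) * τ ^ 2) ^ γ := by rw [← h4]
        rw [h3, h5]
        simp only [mul_pow, pow_add, ← pow_mul, mul_add]
        ring
      linear_combination (sigma α a * sigmaTilde γ a * sigma δ b) * h2
  rw [Finset.sum_congr rfl fun β hβ => Finset.sum_congr rfl (h1 β hβ)]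
  simp only [← Finset.sum_filter]
  refine Finset.sum_comm' fun α β => ?_
  simp only [Finset.mem_Icc, Finset.mem_filter, Finset.mem_range]
  omega

/-- The σ̃-series inverts the σ(a)-series, and the tail cancels: at infinity φ is the expansion of
B·`headPoly` divided by A. -/
lemma sigmaSeries_mul_phiSeries (hτ : τ ≠ 0) :
    sigmaSeries a (-τ) * phiSeries τ a b k = sigmaSeries b (-τ⁻¹) * headSeries a (-τ) k := by
  rw [phiSeries_eq a b k hτ]
  linear_combination ((headSeries a (-τ) k - sigmaSeries a (-τ)) * sigmaSeries b (-τ⁻¹)) *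
    sigmaSeries_mul_sigmaTildeSeries a τ

/-- In degrees above n the products involve only coefficients which the truncation in `phiPoly` has
kept, so the power series identity applies. -/
lemma natDegree_headPoly_phiPoly (hτ : τ ≠ 0) (hnl : n < l) :
    ((∏ i, (X - C (b i * τ⁻¹))) * headPoly a τ k -
      (∏ j, (X - C (a j * τ))) * phiPoly τ a b k).natDegree ≤ n := by
  rw [natDegree_le_iff_coeff_eq_zero]
  intro N hN
  set d := l - n + k with hd
  have hB : (∏ i, (X - C (b i * τ⁻¹))).natDegree ≤ l := (natDegree_prod_X_sub_C _).le
  have hA : (∏ j, (X - C (a j * τ))).natDegree ≤ n := (natDegree_prod_X_sub_C _).le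
  have hT : (headPoly a τ k).natDegree ≤ k := natDegree_descending _ _
  have hQ : (phiPoly τ a b k).natDegree ≤ d := natDegree_descending _ _
  by_cases hNl : N ≤ l + k
  · have h1 : ∀ P : ℂ[X], P.coeff N = (reflect (l + k) P).coeff (l + k - N) := fun P => by
      rw [coeff_reflect, revAt_le (by omega), Nat.sub_sub_self hNl]
    rw [coeff_sub, h1, h1, reflect_mul _ _ hB hT]
    conv_lhs => rw [show l + k = n + d by omega]
    rw [reflect_mul _ _ hA hQ, ← Polynomial.coeff_coe, ← Polynomial.coeff_coe, Polynomial.coe_mul,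
      Polynomial.coe_mul, coe_reflect_prod_X_sub_C, coe_reflect_prod_X_sub_C]
    have h2 : ((reflect k (headPoly a τ k) : ℂ[X]) : PowerSeries ℂ) = headSeries a (-τ) k := by
      ext κ
      rw [Polynomial.coeff_coe, headPoly, coeff_reflect_descending, headSeries, PowerSeries.coeff_mk]
    rw [h2, ← sigmaSeries_mul_phiSeries a b k hτ, PowerSeries.coeff_mul, PowerSeries.coeff_mul,
      sub_eq_zero]
    refine Finset.sum_congr rfl fun x hx => ?_
    have hx := Finset.HasAntidiagonal.mem_antidiagonal.1 hx
    rw [Polynomial.coeff_coe, phiPoly, coeff_reflect_descending, if_pos (by omega), phiSeries,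
      PowerSeries.coeff_mk]
  · refine coeff_eq_zero_of_natDegree_lt ((natDegree_sub_le _ _).trans_lt (max_lt ?_ ?_))
    · exact (natDegree_mul_le_of_le hB hT).trans_lt (by omega)
    · exact (natDegree_mul_le_of_le hA hQ).trans_lt (by omega)

/-- Here k = λ − 1. With d = l − n + k and e = d − κ, the identity (1 − τ^(2e))(−τ)^κ =
τ^(2d)(τ^(−2e) − 1)(−τ⁻¹)^κ makes f_λ a multiple of the difference quotient of `phiPoly` for x ↦
τ⁻²x; g_λ is minus that of `headPoly` for x ↦ τ²x. -/
lemma APoly_eq (hτ : τ ≠ 0) (x : ℂ) : APoly τ (k + 1) x a b = τ ^ (2 * (l - n + k)) *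
    (form (τ ^ 2) (∏ j, (X - C (a j * τ))) (∏ i, (X - C (b i * τ⁻¹))) (headPoly a τ k)
      (phiPoly τ a b k)).eval x := by
  unfold APoly form headPoly phiPoly fPoly gPoly
  rw [X_mul_dq_descending, X_mul_dq_descending]
  rw [show l - n + (k + 1) - 1 = l - n + k by omega, show k + 1 - 1 = k by omega]
  rw [eval_sub, eval_mul, eval_mul, eval_prod, eval_prod, eval_finsetSum, eval_finsetSum]
  simp only [eval_mul, eval_C, eval_pow, eval_X, eval_sub]
  have h1 : ∑ κ ∈ Finset.range (l - n + k), (1 - τ ^ (2 * (l - n + k - κ))) * (-τ) ^ κ *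
      phi τ (k + 1) κ a b * x ^ (l - n + (k + 1) - 2 - κ) = τ ^ (2 * (l - n + k)) *
      ∑ κ ∈ Finset.range (l - n + k), ((τ ^ 2)⁻¹ ^ (l - n + k - κ) - 1) *
        ((-τ⁻¹) ^ κ * phi τ (k + 1) κ a b) * x ^ (l - n + k - 1 - κ) := by
    rw [Finset.mul_sum]
    refine Finset.sum_congr rfl fun κ hκ => ?_
    have hκ := Finset.mem_range.1 hκ
    obtain ⟨e, he⟩ := Nat.exists_eq_add_of_le hκ.le
    rw [show l - n + (k + 1) - 2 - κ = l - n + k - 1 - κ by omega, he, Nat.add_sub_cancel_left]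
    have h2 : (1 - τ ^ (2 * e)) * (-τ) ^ κ =
        τ ^ (2 * (κ + e)) * ((τ ^ 2)⁻¹ ^ e - 1) * (-τ⁻¹) ^ κ := by
      have h3 : -τ = (-τ⁻¹) * τ ^ 2 := by field_simp
      rw [h3, mul_pow, inv_pow, ← pow_mul, ← pow_mul]
      have : τ ^ (2 * e) ≠ 0 := pow_ne_zero _ hτ
      rw [mul_add, pow_add]
      field_simp
    linear_combination (phi τ (k + 1) κ a b * x ^ (κ + e - 1 - κ)) * h2
  have h2 : ∑ κ ∈ Finset.range k, (1 - τ ^ (2 * (k - κ))) * (-τ) ^ κ * sigma κ a *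
      x ^ (k + 1 - 2 - κ) = -∑ κ ∈ Finset.range k, ((τ ^ 2) ^ (k - κ) - 1) *
        ((-τ) ^ κ * sigma κ a) * x ^ (k - 1 - κ) := by
    rw [← Finset.sum_neg_distrib]
    refine Finset.sum_congr rfl fun κ hκ => ?_
    rw [show k + 1 - 2 - κ = k - 1 - κ by omega, ← pow_mul]
    ring
  rw [h1, h2]
  ring

lemma natDegree_headPoly : (headPoly a τ k).natDegree = k ∧ (headPoly a τ k).Monic := by
  have h0 : (headPoly a τ k).coeff k = 1 := by
    have := coeff_descending k (fun κ => (-τ) ^ κ * sigma κ a) (Nat.zero_le k)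
    simpa [headPoly, sigma_zero] using this
  have h1 : (headPoly a τ k).natDegree ≤ k := natDegree_descending _ _
  have h2 : (headPoly a τ k).natDegree = k := by
    refine h1.antisymm (le_natDegree_of_ne_zero ?_)
    rw [h0]; exact one_ne_zero
  exact ⟨h2, by rw [Monic, leadingCoeff, h2, h0]⟩

end

/-- The determinant `Δ` paired with an alternating form. -/
theorem Delta_eq {n l : ℕ} {τ : ℂ} (hτ : τ ≠ 0) (a x : Fin n → ℂ) (b : Fin l → ℂ) :
    Delta τ x a b = (∏ k : Fin n, τ ^ (2 * (l - n + (k : ℕ)))) *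
      detEval x fun k : Fin n => form (τ ^ 2) (∏ j, (X - C (a j * τ))) (∏ i, (X - C (b i * τ⁻¹)))
        (headPoly a τ k) (phiPoly τ a b k) := by
  rw [detEval_apply, ← Matrix.det_mul_column, Delta]
  congr 1
  ext i j
  simp only [Matrix.of_apply]
  exact APoly_eq a b i hτ (x j)

end
end SmirnovIntegral

namespace SmirnovIntegral
open scoped BigOperators Topology
noncomputable section

/-! ### Analyticity of the integrand -/

section

variable {E : Type*} [NormedAddCommGroup E] [NormedSpace ℂ E] {e : E} {n l : ℕ}
  {a : E → Fin n → ℂ} {b : E → Fin l → ℂ}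

lemma analyticAt_sigma (ha : ∀ j, AnalyticAt ℂ (fun e => a e j) e) (κ : ℕ) :
    AnalyticAt ℂ (fun e => sigma κ (a e)) e :=
  Finset.analyticAt_fun_sum _ fun _ _ => Finset.analyticAt_fun_prod _ fun j _ => ha j

lemma coeff_inv_one_sub (c : ℂ) (k : ℕ) :
    PowerSeries.coeff k ((1 - PowerSeries.C c * PowerSeries.X : PowerSeries ℂ)⁻¹) = c ^ k := by
  have h : (1 - PowerSeries.C c * PowerSeries.X : PowerSeries ℂ)⁻¹ =
      PowerSeries.rescale c (PowerSeries.mk 1) := by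
    rw [PowerSeries.inv_eq_iff_mul_eq_one (by simp)]
    have := congrArg (PowerSeries.rescale c) (PowerSeries.mk_one_mul_one_sub_eq_one ℂ)
    rw [map_mul, map_sub, map_one, PowerSeries.rescale_X] at this
    exact this
  rw [h, PowerSeries.coeff_rescale, PowerSeries.coeff_mk, Pi.one_apply, mul_one]

lemma analyticAt_sigmaTilde (ha : ∀ j, AnalyticAt ℂ (fun e => a e j) e) (κ : ℕ) :
    AnalyticAt ℂ (fun e => sigmaTilde κ (a e)) e := by
  simp only [sigmaTilde, PowerSeries.coeff_prod, coeff_inv_one_sub]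
  exact Finset.analyticAt_fun_sum _ fun r _ => Finset.analyticAt_fun_prod _ fun j _ =>
    (ha j).fun_pow _

lemma analyticAt_phi (ha : ∀ j, AnalyticAt ℂ (fun e => a e j) e)
    (hb : ∀ j, AnalyticAt ℂ (fun e => b e j) e) (τ : ℂ) (lam κ : ℕ) :
    AnalyticAt ℂ (fun e => phi τ lam κ (a e) (b e)) e := by
  unfold phi
  have h1 := analyticAt_sigma ha
  have h2 := analyticAt_sigma hb
  have h3 := analyticAt_sigmaTilde ha
  refine (h2 κ).fun_sub (Finset.analyticAt_fun_sum _ fun α _ => Finset.analyticAt_fun_sum _ fun β _ => ?_)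
  exact ((analyticAt_const.fun_mul (h2 _)).fun_mul (h1 _)).fun_mul (h3 _)

lemma analyticAt_APoly (ha : ∀ j, AnalyticAt ℂ (fun e => a e j) e)
    (hb : ∀ j, AnalyticAt ℂ (fun e => b e j) e) {x : E → ℂ} (hx : AnalyticAt ℂ x e) (τ : ℂ)
    (lam : ℕ) : AnalyticAt ℂ (fun e => APoly τ lam (x e) (a e) (b e)) e := by
  unfold APoly fPoly gPoly
  refine AnalyticAt.fun_add (AnalyticAt.fun_mul ?_ ?_) (AnalyticAt.fun_mul
    (AnalyticAt.fun_mul analyticAt_const ?_) ?_)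
  · exact Finset.analyticAt_fun_prod _ fun j _ => hx.fun_sub ((ha j).fun_mul analyticAt_const)
  · exact Finset.analyticAt_fun_sum _ fun κ _ => (analyticAt_const.fun_mul
      (analyticAt_phi ha hb τ lam κ)).fun_mul (hx.fun_pow _)
  · exact Finset.analyticAt_fun_prod _ fun j _ => hx.fun_sub ((hb j).fun_mul analyticAt_const)
  · exact Finset.analyticAt_fun_sum _ fun κ _ => (analyticAt_const.fun_mul
      (analyticAt_sigma ha κ)).fun_mul (hx.fun_pow _)

lemma analyticAt_FRat {x : E → Fin n → ℂ} {z : E → Fin n ⊕ Fin l → ℂ}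
    (hx : ∀ μ, AnalyticAt ℂ (fun e => x e μ) e) (hz : ∀ s, AnalyticAt ℂ (fun e => z e s) e) {τ : ℂ}
    (h : ∀ (j : Fin n) (i : Fin l), z e (Sum.inr i) ≠ z e (Sum.inl j) * τ ^ 2) :
    AnalyticAt ℂ (fun e => FRat τ (x e) (z e)) e := by
  unfold FRat Delta
  refine AnalyticAt.fun_div ?_ ?_ ?_
  · simp only [Matrix.det_apply']
    refine Finset.analyticAt_fun_sum _ fun σ _ => analyticAt_const.fun_mul ?_
    exact Finset.analyticAt_fun_prod _ fun μ _ =>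
      analyticAt_APoly (fun j => hz _) (fun i => hz _) (hx μ) τ _
  · exact Finset.analyticAt_fun_prod _ fun j _ => Finset.analyticAt_fun_prod _ fun i _ =>
      (hz _).fun_sub ((hz _).fun_mul analyticAt_const)
  · exact Finset.prod_ne_zero_iff.2 fun j _ => Finset.prod_ne_zero_iff.2 fun i _ =>
      sub_ne_zero.2 (h j i)

end

/-! ### The integral over a good cycle -/

section

variable {q : ℂ} {ι : Type*}

lemma zOf_ne_zero (u : ι → ℂ) (j : ι) : zOf u j ≠ 0 := Complex.exp_ne_zero _

lemma zOf_comp {ι' : Type*} (u : ι → ℂ) (f : ι' → ι) (j : ι') : zOf (u ∘ f) j = zOf u (f j) := rfl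

/-- A cycle which is admissible for `z = exp u`. -/
def IsGood (q : ℂ) (u : ι → ℂ) (Γ : Cycle) : Prop :=
  Good (q ^ 4) (fun j => zOf u j * q) (fun j => zOf u j * q⁻¹) Γ

lemma IsGood.comp {u : ι → ℂ} {Γ : Cycle} (h : IsGood q u Γ) (σ : ι → ι) : IsGood q (u ∘ σ) Γ :=
  ⟨h.zero, fun j => h.inner (σ j), fun j => h.outer (σ j)⟩

end

section

variable {q : ℂ} {n : ℕ} {ι : Type*} [Fintype ι] {θ : (Fin n → ℂ) → (ι → ℂ) → ℂ}

/-- The dictionary with the abstract kernel: p = q⁴, inner poles z_jτ⁻¹p^k and outer poles z_jτp⁻ᵏ,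
which are the encircled and the excluded points. -/
lemma Psi_eq (q : ℂ) (θ : (Fin n → ℂ) → (ι → ℂ) → ℂ) (x : Fin n → ℂ) (u : ι → ℂ) :
    Psi q θ x u =
      kern (q ^ 4) (fun j => zOf u j * q) (fun j => zOf u j * q⁻¹) (fun x => θ x u) x := by
  unfold Psi kern ker
  congr 1
  refine Finset.prod_congr rfl fun μ _ => Finset.prod_congr rfl fun j _ => ?_
  unfold psi kfac
  rw [one_div]
  congr 3
  · rw [div_mul_eq_div_div, div_inv_eq_mul]
  · rw [inv_div, div_mul_eq_mul_div]

/-- The set of `u` such that `θ` is holomorphic in `x`. -/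
def xRegular (θ : (Fin n → ℂ) → (ι → ℂ) → ℂ) : Set (ι → ℂ) :=
  {u | AnalyticOnNhd ℂ (fun x => θ x u) {x | ∀ μ, x μ ≠ 0}}

lemma regularSet_subset : regularSet θ ⊆ xRegular θ := by
  rintro u ⟨W, hW, h⟩ x hx
  exact (h (x, u) ⟨hx, mem_of_mem_nhds hW⟩).comp (f := fun x : Fin n → ℂ => (x, u))
    (analyticAt_id.prod analyticAt_const)

lemma isOpen_ne_zero : IsOpen {x : Fin n → ℂ | ∀ μ, x μ ≠ 0} := by
  simp only [Set.ofPred_forall]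
  exact isOpen_iInter_of_finite fun μ => isOpen_ne_fun (continuous_apply μ) continuous_const

lemma continuousOn_Psi (hq0 : q ≠ 0) (hq1 : ‖q‖ < 1) {u : ι → ℂ} {Γ : Cycle} (h : IsGood q u Γ)
    (hu : u ∈ xRegular θ) :
    ContinuousOn (fun x => Psi q θ x u) (Cycle.box fun _ : Fin n => Γ) := by
  simp only [Psi_eq]
  refine Good.continuousOn_kern h hu ?_ (pow_ne_zero 4 hq0)
    fun j => mul_ne_zero (zOf_ne_zero u j) (inv_ne_zero hq0)
  rw [norm_pow]
  exact pow_lt_one₀ (norm_nonneg q) hq1 (by norm_num)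

variable [DecidableEq ι]

lemma IsTheta.comp_mem {L : ℂ} (hθ : IsTheta q L θ) {u : ι → ℂ} (hu : u ∈ xRegular θ)
    (σ : Equiv.Perm ι) : u ∘ σ ∈ xRegular θ := by
  have h : AnalyticOnNhd ℂ (fun x => θ x u) {x | ∀ μ, x μ ≠ 0} := hu
  exact h.congr isOpen_ne_zero fun x hx => (hθ.symm σ x u hx).symm

lemma IsTheta.Psi_comp {L : ℂ} (hθ : IsTheta q L θ) {x : Fin n → ℂ} (hx : ∀ μ, x μ ≠ 0) (u : ι → ℂ)
    (σ : Equiv.Perm ι) : Psi q θ x (u ∘ σ) = Psi q θ x u := by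
  unfold Psi
  rw [hθ.symm σ x u hx]
  congr 1
  refine Finset.prod_congr rfl fun μ _ => ?_
  simp only [zOf_comp]
  exact Equiv.prod_comp σ fun j => psi q (x μ / zOf u j)

end

end
end SmirnovIntegral

namespace SmirnovIntegral
open scoped BigOperators Topology
noncomputable section

open Polynomial

lemma altInt_congr {n : ℕ} {Γ : Cycle} {k k' : (Fin n → ℂ) → ℂ}
    {hk : ContinuousOn k (Cycle.box fun _ : Fin n => Γ)}
    {hk' : ContinuousOn k' (Cycle.box fun _ : Fin n => Γ)}
    (h : ∀ x ∈ Cycle.box fun _ : Fin n => Γ, k x = k' x) : altInt Γ k hk = altInt Γ k' hk' := by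
  ext P
  rw [altInt_apply, altInt_apply]
  exact Cycle.multi_congr _ fun x hx => by rw [h x hx]

/-! ### The alternating form attached to `ϑ` -/

lemma zOf_update {ι : Type*} [DecidableEq ι] (u : ι → ℂ) (i : ι) (c : ℂ) :
    zOf (Function.update u i c) = Function.update (zOf u) i (Complex.exp c) := by
  ext j
  by_cases h : j = i
  · subst h; simp [zOf]
  · simp [zOf, h]

lemma exp_sub_four_mul {q L : ℂ} (hL : Complex.exp L = q) (c : ℂ) :
    Complex.exp (c - 4 * L) = Complex.exp c * q⁻¹ ^ 4 := by
  have h := Complex.exp_nat_mul L 4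
  rw [hL] at h
  rw [Complex.exp_sub, div_eq_mul_inv, inv_pow, ← h]
  norm_num

lemma norm_pow_four_lt {q : ℂ} (hq1 : ‖q‖ < 1) : ‖q ^ 4‖ < 1 := by
  rw [norm_pow]
  exact pow_lt_one₀ (norm_nonneg q) hq1 (by norm_num)

section

variable {q : ℂ} {n : ℕ} {ι : Type*} [Fintype ι] {θ : (Fin n → ℂ) → (ι → ℂ) → ℂ}
  (hq0 : q ≠ 0) (hq1 : ‖q‖ < 1) {u : ι → ℂ} {Γ : Cycle}

/-- The integral of `det (P_λ(x_μ)) Ψ(x | exp u)` over the `n`-th power of a cycle. -/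
def thetaForm (h : IsGood q u Γ) (hu : u ∈ xRegular θ) : ℂ[X] [⋀^Fin n]→ₗ[ℂ] ℂ :=
  altInt Γ (fun x => Psi q θ x u) (continuousOn_Psi hq0 hq1 h hu)

lemma thetaForm_eq_kern (h : IsGood q u Γ) (hu : u ∈ xRegular θ) :
    thetaForm hq0 hq1 h hu =
      altInt Γ (kern (q ^ 4) (fun j => zOf u j * q) (fun j => zOf u j * q⁻¹) fun x => θ x u)
        (Good.continuousOn_kern h hu (norm_pow_four_lt hq1) (pow_ne_zero 4 hq0)
          fun j => mul_ne_zero (zOf_ne_zero u j) (inv_ne_zero hq0)) :=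
  altInt_congr fun x _ => Psi_eq q θ x u

variable [DecidableEq ι] {L : ℂ}

lemma thetaForm_comp (hθ : IsTheta q L θ) (h : IsGood q u Γ) (hu : u ∈ xRegular θ)
    (σ : Equiv.Perm ι) :
    thetaForm hq0 hq1 (h.comp σ) (hθ.comp_mem hu σ) = thetaForm hq0 hq1 h hu :=
  altInt_congr fun _ hx => hθ.Psi_comp (fun μ => Good.ne_zero h (hx μ)) u σ

/-- With y = z_i, the shift moves the outer poles from yτ to yτ⁵ and the inner ones from yτ⁻¹ to
yτ³. The factor x − yτ removes the first outer pole before the shift, x − yτ³ the first inner pole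
after it, and both kernels then have inner poles from yτ⁻¹ and outer poles from yτ⁵. -/
theorem thetaForm_shift (hL : Complex.exp L = q) (hθ : IsTheta q L θ) (i : ι) (h : IsGood q u Γ)
    (hu : u ∈ xRegular θ) {Γ' : Cycle} {u' : ι → ℂ} (huu' : u' = Function.update u i (u i - 4 * L))
    (h' : IsGood q u' Γ') (hu' : u' ∈ xRegular θ) (G : Fin n → ℂ[X]) :
    thetaForm hq0 hq1 h' hu' (fun l => (X - C (zOf u i * q⁻¹ ^ 3)) * G l) =
      thetaForm hq0 hq1 h hu (fun l => (X - C (zOf u i * q⁻¹)) * G l) := by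
  subst huu'
  have hz := zOf_update u i (u i - 4 * L)
  rw [exp_sub_four_mul hL] at hz
  rw [thetaForm_eq_kern, thetaForm_eq_kern]
  have key := Good.altInt_shift i h h' (norm_pow_four_lt hq1) (pow_ne_zero 4 hq0)
    (fun j => mul_ne_zero (zOf_ne_zero u j) (inv_ne_zero hq0)) ?_ ?_
    (fun j => mul_ne_zero (zOf_ne_zero _ j) (inv_ne_zero hq0)) hu hu' ?_ G
  · rw [← key]
    congr 1
    ext1 l
    rw [hz, Function.update_self]
    congr 3
    unfold zOf
    field_simp
  · ext j
    rw [hz]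
    by_cases hj : j = i
    · subst hj
      rw [Function.update_self, Function.update_self]
      unfold zOf
      field_simp
    · rw [Function.update_of_ne hj, Function.update_of_ne hj]
  · ext j
    rw [hz]
    by_cases hj : j = i
    · subst hj
      rw [Function.update_self, Function.update_self]
      unfold zOf
      field_simp
    · rw [Function.update_of_ne hj, Function.update_of_ne hj]
  · intro x hx
    rw [hθ.shift_z i x u hx]
    simp only [neg_mul]

end

lemma dil_prod_X_sub_C {m : ℕ} {s : ℂ} (hs : s ≠ 0) (α : Fin m → ℂ) :
    dil s (∏ j, (X - C (α j))) = C (s ^ m) * ∏ j, (X - C (α j * s⁻¹)) := by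
  rw [dil_prod]
  have h : ∀ j, dil s (X - C (α j)) = C s * (X - C (α j * s⁻¹)) := fun j => by
    rw [dil_sub, dil_X, dil_C, mul_sub, ← C_mul, mul_comm s, inv_mul_cancel_right₀ hs]
  simp only [h]
  rw [Finset.prod_mul_distrib, Finset.prod_const, Finset.card_univ, Fintype.card_fin, C_pow]

section

variable {q L : ℂ} {n l : ℕ} {θ : (Fin n → ℂ) → (Fin n ⊕ Fin l → ℂ) → ℂ}
  (hq0 : q ≠ 0) (hq1 : ‖q‖ < 1) {u : Fin n ⊕ Fin l → ℂ} {Γ : Cycle}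

/-- The polynomial `∏ (x - z_j τ)` over the left group. -/
def polyA (q : ℂ) (u : Fin n ⊕ Fin l → ℂ) : ℂ[X] := ∏ j : Fin n, (X - C (zOf u (Sum.inl j) * q⁻¹))

/-- The polynomial `∏ (x - z_j τ⁻¹)` over the right group. -/
def polyB (q : ℂ) (u : Fin n ⊕ Fin l → ℂ) : ℂ[X] :=
  ∏ i : Fin l, (X - C (zOf u (Sum.inr i) * q⁻¹⁻¹))

/-- An exact polynomial has two dilations by τ^(±2), whereas the kernel has a single one by τ⁴.
Passing from r to q^(2l)·r(τ⁻²x) translates between them: dilating B by τ⁻² gives q^(2l)∏(x − z_iτ),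
dilating A by τ² gives τ^(2n)∏(x − z_jτ⁻¹). -/
theorem thetaForm_killsExact (hθ : IsTheta q L θ) (h : IsGood q u Γ) (hu : u ∈ xRegular θ) :
    KillsExact (q⁻¹ ^ 2) (polyA q u) (polyB q u) (thetaForm hq0 hq1 h hu) := by
  rintro P k ⟨r, hr⟩
  rw [thetaForm_eq_kern]
  refine Good.altInt_exact hq0 (zOf_ne_zero u) (norm_pow_four_lt hq1) h hu
    (fun i x hx => hθ.shift_x i x u hx) _ k (C (q ^ (2 * l)) * dil (q⁻¹ ^ 2)⁻¹ r) ?_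
  rw [hr, dil_mul, dil_mul]
  unfold polyA polyB
  have hs : q⁻¹ ^ 2 ≠ 0 := pow_ne_zero 2 (inv_ne_zero hq0)
  rw [dil_prod_X_sub_C hs, dil_prod_X_sub_C (inv_ne_zero hs), Fintype.prod_sum_type,
    Fintype.prod_sum_type]
  have h1 : ∀ i : Fin l, zOf u (Sum.inr i) * q⁻¹⁻¹ * (q⁻¹ ^ 2)⁻¹⁻¹ = zOf u (Sum.inr i) * q⁻¹ := by
    intro i; field_simp
  have h2 : ∀ j : Fin n, zOf u (Sum.inl j) * q⁻¹ * (q⁻¹ ^ 2)⁻¹ = zOf u (Sum.inl j) * q := by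
    intro i; field_simp
  have h3 : ((C (q ^ (2 * l)) * dil (q⁻¹ ^ 2)⁻¹ r).comp (C (q⁻¹ ^ 4) * X)) =
      C (q ^ (2 * l)) * dil (q⁻¹ ^ 2) r := by
    rw [mul_comp, C_comp]
    change _ * dil (q⁻¹ ^ 4) _ = _
    rw [dil_dil]
    congr 2
    field_simp
  have h4 : q⁻¹ ^ (2 * Fintype.card (Fin n ⊕ Fin l)) = (q⁻¹ ^ 2) ^ n * q⁻¹ ^ (2 * l) := by
    rw [Fintype.card_sum, Fintype.card_fin, Fintype.card_fin, mul_add, pow_add, pow_mul]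
  have h5 : C (q⁻¹ ^ (2 * l)) * C (q ^ (2 * l)) = (1 : ℂ[X]) := by
    rw [← C_mul, ← mul_pow, inv_mul_cancel₀ hq0, one_pow, C_1]
  have h6 : (q⁻¹ ^ 2)⁻¹ ^ l = q ^ (2 * l) := by
    rw [← inv_pow, inv_inv, ← pow_mul]
  simp only [h1, h2, h6]
  simp only [inv_inv]
  rw [h3, h4, C_mul]
  linear_combination ((∏ i : Fin l, (X - C (zOf u (Sum.inr i) * q))) *
    (∏ j : Fin n, (X - C (zOf u (Sum.inl j) * q))) * C ((q⁻¹ ^ 2) ^ n) * dil (q⁻¹ ^ 2) r) * h5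

end

end
end SmirnovIntegral

namespace SmirnovIntegral
open scoped BigOperators Topology
noncomputable section

open Polynomial

/-! ### The integral as a function of `log z` -/

section

variable {q L : ℂ} {n l : ℕ} {θ : (Fin n → ℂ) → (Fin n ⊕ Fin l → ℂ) → ℂ}

/-- The polynomials whose determinant is `Δ`, up to a constant. -/
def rowPoly (q : ℂ) (u : Fin n ⊕ Fin l → ℂ) (k : Fin n) : ℂ[X] :=
  form (q⁻¹ ^ 2) (polyA q u) (polyB q u) (headPoly (fun j => zOf u (Sum.inl j)) q⁻¹ k)
    (phiPoly q⁻¹ (fun j => zOf u (Sum.inl j)) (fun i => zOf u (Sum.inr i)) k)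

/-- The product of the leading powers of `τ` in the rows of `Δ`. -/
def prefactor (q : ℂ) (n l : ℕ) : ℂ := ∏ k : Fin n, q⁻¹ ^ (2 * (l - n + (k : ℕ)))

/-- The denominator of `F`. -/
def denom (q : ℂ) (u : Fin n ⊕ Fin l → ℂ) : ℂ :=
  ∏ j : Fin n, ∏ i : Fin l, (zOf u (Sum.inr i) - zOf u (Sum.inl j) * q⁻¹ ^ 2)

lemma FRat_eq (hq0 : q ≠ 0) (u : Fin n ⊕ Fin l → ℂ) (x : Fin n → ℂ) :
    FRat q⁻¹ x (zOf u) = prefactor q n l / denom q u * detEval x (rowPoly q u) := by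
  unfold FRat
  rw [Delta_eq (inv_ne_zero hq0), div_mul_eq_mul_div]
  rfl

open Classical in
/-- The integral `∏_μ ∮ dx_μ F(x | z) Ψ(x | z)` over any good cycle. -/
def smirnovH (q : ℂ) (θ : (Fin n → ℂ) → (Fin n ⊕ Fin l → ℂ) → ℂ) (u : Fin n ⊕ Fin l → ℂ) : ℂ :=
  -- A good cycle exists at every point of `domain`, so the value 0 is not taken there by default.
  -- Working with cycles makes the existence of a simple contour unnecessary.
  if h : ∃ Γ, IsGood q u Γ then
    Cycle.multi (fun _ => h.choose) fun x => FRat q⁻¹ x (zOf u) * Psi q θ x u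
  else 0

variable (hq0 : q ≠ 0) (hq1 : ‖q‖ < 1) {u : Fin n ⊕ Fin l → ℂ} {Γ : Cycle}

include hq0 hq1 in
theorem smirnovH_eq (h : IsGood q u Γ) (hu : u ∈ xRegular θ) :
    smirnovH q θ u = Cycle.multi (fun _ => Γ) fun x => FRat q⁻¹ x (zOf u) * Psi q θ x u := by
  have hex : ∃ Γ, IsGood q u Γ := ⟨Γ, h⟩
  unfold smirnovH
  rw [dif_pos hex]
  have h1 : (fun x => FRat q⁻¹ x (zOf u) * Psi q θ x u) =
      kern (q ^ 4) (fun j => zOf u j * q) (fun j => zOf u j * q⁻¹)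
        fun x => prefactor q n l / denom q u * detEval x (rowPoly q u) * θ x u := by
    ext x
    rw [FRat_eq hq0, Psi_eq]
    unfold kern
    ring
  rw [h1]
  refine Good.multi_eq hex.choose_spec h (norm_pow_four_lt hq1) (pow_ne_zero 4 hq0)
    (fun j => mul_ne_zero (zOf_ne_zero u j) (inv_ne_zero hq0)) fun x hx => ?_
  exact (analyticAt_const.fun_mul (analyticAt_detEval _ x)).fun_mul (hu x hx)

/-- From here on the explicit polynomials of Δ are no longer used; only the class of the form on
ℂ[X]/(A) matters. -/
theorem smirnovH_eq_baseVal (hnl : n < l) (h : IsGood q u Γ) (hu : u ∈ xRegular θ) :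
    smirnovH q θ u = prefactor q n l / denom q u *
      baseVal (q⁻¹ ^ 2) (monic_prod_X_sub_C' fun j : Fin n => zOf u (Sum.inl j) * q⁻¹) (polyB q u)
        (thetaForm hq0 hq1 h hu) := by
  have hτ := inv_ne_zero hq0
  rw [smirnovH_eq hq0 hq1 h hu, ← map_form_monic
    (T := fun k : Fin n => headPoly (fun j => zOf u (Sum.inl j)) q⁻¹ k)
    (Q := fun k : Fin n => phiPoly q⁻¹ (fun j => zOf u (Sum.inl j)) (fun i => zOf u (Sum.inr i)) k)
    _ _ (fun i => (natDegree_headPoly _ _).2)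
    (fun i => (natDegree_headPoly _ _).1) (fun i => by
      rw [natDegree_prod_X_sub_C]
      exact natDegree_headPoly_phiPoly _ _ _ hτ hnl)]
  change _ = _ * thetaForm hq0 hq1 h hu (rowPoly q u)
  unfold thetaForm
  rw [altInt_apply, ← Cycle.multi_const_mul]
  refine Cycle.multi_congr _ fun x _ => ?_
  rw [FRat_eq hq0]
  ring

-- A coincidence z_iτ^(−1−4k) = z_jτ^(1+4m) of an inner with an outer pole means z_i =
-- z_jτ^(2+4(k+m)), which `domain` excludes.
include hq0 hq1 in
lemma exists_isGood (hu : u ∈ domain q θ) : ∃ Γ, IsGood q u Γ := by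
  refine exists_good (norm_pow_four_lt hq1) (pow_ne_zero 4 hq0)
    (fun j => mul_ne_zero (zOf_ne_zero u j) (inv_ne_zero hq0)) fun i j k m heq => ?_
  refine hu.2 i j (k + m) ?_
  have h1 : q ^ (1 + 4 * k) ≠ 0 := pow_ne_zero _ hq0
  refine mul_right_cancel₀ h1 ?_
  calc zOf u i * q ^ (1 + 4 * k) = zOf u i * q * (q ^ 4) ^ k := by ring
    _ = zOf u j * q⁻¹ * (q ^ 4)⁻¹ ^ m := heq
    _ = zOf u j * q⁻¹ ^ (1 + 4 * m) * (q⁻¹ * q) ^ (1 + 4 * k) := by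
        rw [inv_mul_cancel₀ hq0, one_pow, ← inv_pow]
        ring
    _ = zOf u j * q⁻¹ ^ (2 + 4 * (k + m)) * q ^ (1 + 4 * k) := by
        rw [mul_pow]
        ring

include hq0 hq1 in
theorem smirnovH_eq_contour (hnl : n < l) (hu : u ∈ domain q θ) {γ : ℝ → ℂ}
    (hγ : IsContour q (zOf u) γ) : smirnovH q θ u = smirnovIntegral q θ γ u := by
  have : Nonempty (Fin n ⊕ Fin l) := ⟨Sum.inr ⟨0, by omega⟩⟩
  rw [smirnovH_eq hq0 hq1 (hγ.good hq1) (regularSet_subset hu.1)]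
  exact Cycle.multi_ofPath _

lemma sigma_comp {m : ℕ} (a : Fin m → ℂ) (σ : Equiv.Perm (Fin m)) (κ : ℕ) :
    sigma κ (a ∘ σ) = sigma κ a := by
  have h1 := coeff_prod_one_sub (a ∘ σ) κ
  have h2 := coeff_prod_one_sub a κ
  have h3 : ∏ j, (1 - PowerSeries.C ((a ∘ σ) j) * PowerSeries.X : PowerSeries ℂ) =
      ∏ j, (1 - PowerSeries.C (a j) * PowerSeries.X) :=
    Equiv.prod_comp σ fun j => (1 - PowerSeries.C (a j) * PowerSeries.X : PowerSeries ℂ)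
  rw [h3, h2] at h1
  exact (mul_left_cancel₀ (pow_ne_zero _ (neg_ne_zero.2 one_ne_zero)) h1).symm

lemma sigmaTilde_comp {m : ℕ} (a : Fin m → ℂ) (σ : Equiv.Perm (Fin m)) (κ : ℕ) :
    sigmaTilde κ (a ∘ σ) = sigmaTilde κ a := by
  unfold sigmaTilde
  congr 1
  exact Equiv.prod_comp σ fun j => (1 - PowerSeries.C (a j) * PowerSeries.X : PowerSeries ℂ)⁻¹

lemma FRat_comp (τ : ℂ) (x : Fin n → ℂ) (z : Fin n ⊕ Fin l → ℂ) (σ : Equiv.Perm (Fin n))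
    (ρ : Equiv.Perm (Fin l)) : FRat τ x (z ∘ Equiv.sumCongr σ ρ) = FRat τ x z := by
  have h1 : ∀ (k : ℕ) (y : ℂ), APoly τ k y
      ((fun j => z (Sum.inl j)) ∘ σ) ((fun i => z (Sum.inr i)) ∘ ρ) =
      APoly τ k y (fun j => z (Sum.inl j)) fun i => z (Sum.inr i) := by
    intro k y
    simp only [APoly, fPoly, gPoly, phi, sigma_comp, sigmaTilde_comp]
    congr 2
    · exact Equiv.prod_comp σ fun j => (y - z (Sum.inl j) * τ)
    · congr 1
      exact Equiv.prod_comp ρ fun i => (y - z (Sum.inr i) * τ⁻¹)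
  unfold FRat
  congr 1
  · unfold Delta
    congr 1
    ext k μ
    exact h1 _ _
  · calc _ = ∏ j : Fin n, ∏ i : Fin l, (z (Sum.inr i) - z (Sum.inl (σ j)) * τ ^ 2) :=
        Finset.prod_congr rfl fun j _ =>
          Equiv.prod_comp ρ fun i => (z (Sum.inr i) - z (Sum.inl (σ j)) * τ ^ 2)
      _ = _ := Equiv.prod_comp σ fun j => ∏ i : Fin l, (z (Sum.inr i) - z (Sum.inl j) * τ ^ 2)

include hq0 hq1 in
theorem smirnovH_comp (hθ : IsTheta q L θ) (hu : u ∈ domain q θ) (σ : Equiv.Perm (Fin n))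
    (ρ : Equiv.Perm (Fin l)) : smirnovH q θ (u ∘ Equiv.sumCongr σ ρ) = smirnovH q θ u := by
  obtain ⟨Γ, h⟩ := exists_isGood hq0 hq1 hu
  have hx := regularSet_subset hu.1
  rw [smirnovH_eq hq0 hq1 h hx,
    smirnovH_eq hq0 hq1 (h.comp (Equiv.sumCongr σ ρ)) (hθ.comp_mem hx (Equiv.sumCongr σ ρ))]
  refine Cycle.multi_congr _ fun x hx => ?_
  rw [hθ.Psi_comp fun μ => Good.ne_zero h (hx μ)]
  congr 1
  exact FRat_comp q⁻¹ x (zOf u) σ ρ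

-- A cycle good at u₀ stays good nearby, so H is locally an integral over one fixed compact box of
-- an integrand analytic in (x, u) jointly.
include hq0 hq1 in
theorem differentiableOn_smirnovH : DifferentiableOn ℂ (smirnovH q θ) (domain q θ) := by
  intro u₀ hu₀
  refine DifferentiableAt.differentiableWithinAt ?_
  obtain ⟨Γ, h⟩ := exists_isGood hq0 hq1 hu₀
  obtain ⟨⟨W, hW, hθW⟩, hdom⟩ := hu₀
  have hb : ∀ j, zOf u₀ j * q⁻¹ ≠ 0 := fun j => mul_ne_zero (zOf_ne_zero u₀ j) (inv_ne_zero hq0)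
  have hgood : ∀ᶠ u in 𝓝 u₀, IsGood q u Γ := by
    have hc : ContinuousAt (fun u : Fin n ⊕ Fin l → ℂ =>
        ((fun j => zOf u j * q), fun j => zOf u j * q⁻¹)) u₀ := by
      unfold zOf
      fun_prop
    exact hc.eventually (Good.eventually h (norm_pow_four_lt hq1) (pow_ne_zero 4 hq0) hb)
  have hreg : ∀ᶠ u in 𝓝 u₀, u ∈ xRegular θ := by
    filter_upwards [eventually_eventually_nhds.2 hW] with u hu
    exact regularSet_subset ⟨W, hu, hθW⟩
  have heq : smirnovH q θ =ᶠ[𝓝 u₀] fun u => Cycle.multi (fun _ => Γ)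
      fun x => FRat q⁻¹ x (zOf u) * Psi q θ x u := by
    filter_upwards [hgood, hreg] with u h1 h2
    exact smirnovH_eq hq0 hq1 h1 h2
  refine DifferentiableAt.congr_of_eventuallyEq ?_ heq
  refine Cycle.differentiableAt_multi (fun _ => Γ)
    (F := fun p : (Fin n → ℂ) × (Fin n ⊕ Fin l → ℂ) => FRat q⁻¹ p.1 (zOf p.2) * Psi q θ p.1 p.2)
    fun x hx => ?_
  have hx0 : ∀ μ, x μ ≠ 0 := fun μ => Good.ne_zero h (hx μ)
  have hz : ∀ j, AnalyticAt ℂ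
      (fun p : (Fin n → ℂ) × (Fin n ⊕ Fin l → ℂ) => zOf p.2 j) (x, u₀) := fun j =>
    (((ContinuousLinearMap.proj (R := ℂ) (φ := fun _ : Fin n ⊕ Fin l => ℂ) j).comp
      (ContinuousLinearMap.snd ℂ (Fin n → ℂ) (Fin n ⊕ Fin l → ℂ))).analyticAt (x, u₀)).cexp
  have hxμ : ∀ μ, AnalyticAt ℂ
      (fun p : (Fin n → ℂ) × (Fin n ⊕ Fin l → ℂ) => p.1 μ) (x, u₀) := fun μ =>
    ((ContinuousLinearMap.proj (R := ℂ) (φ := fun _ : Fin n => ℂ) μ).comp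
      (ContinuousLinearMap.fst ℂ (Fin n → ℂ) (Fin n ⊕ Fin l → ℂ))).analyticAt (x, u₀)
  refine (analyticAt_FRat hxμ hz fun j i => ?_).fun_mul ?_
  · exact hdom (Sum.inr i) (Sum.inl j) 0
  · simp only [Psi_eq]
    unfold kern
    refine AnalyticAt.fun_mul (hθW _ ⟨hx0, mem_of_mem_nhds hW⟩) ?_
    refine Finset.analyticAt_fun_prod _ fun μ _ => ?_
    exact analyticAt_ker (norm_pow_four_lt hq1) (fun j => (hz j).fun_mul analyticAt_const)
      (fun j => (hz j).fun_mul analyticAt_const) (hxμ μ) (hx0 μ) hb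
      (Good.ne_outer h (pow_ne_zero 4 hq0) (hx μ)) (Good.ne_inner h (hx μ))

end

end
end SmirnovIntegral

namespace SmirnovIntegral
open scoped BigOperators Topology
noncomputable section

open Polynomial

/-! ### The first reduced cyclicity equation -/

section

variable {q L : ℂ} {n l : ℕ} {θ : (Fin n → ℂ) → (Fin n ⊕ Fin l → ℂ) → ℂ}

/-- The product `∏ (x - z_j τ⁻¹)` over the right group without the `i`-th variable. -/
def polyBErase (q : ℂ) (u : Fin n ⊕ Fin l → ℂ) (i : Fin l) : ℂ[X] :=
  ∏ i' ∈ Finset.univ.erase i, (X - C (zOf u (Sum.inr i') * q⁻¹⁻¹))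

lemma polyB_eq (q : ℂ) (u : Fin n ⊕ Fin l → ℂ) (i : Fin l) :
    polyB q u = (X - C (zOf u (Sum.inr i) * q⁻¹⁻¹)) * polyBErase q u i :=
  (Finset.mul_prod_erase _ _ (Finset.mem_univ i)).symm

/-- The product of the values of D at the roots of A cancels the denominator of F except for the
factors containing the `i`-th right variable. -/
lemma prod_eval_polyBErase_div (hq0 : q ≠ 0) {u : Fin n ⊕ Fin l → ℂ}
    (hnv : ∀ s t, zOf u s ≠ zOf u t * q⁻¹ ^ 2) (i : Fin l) :
    (∏ j : Fin n, (polyBErase q u i).eval (zOf u (Sum.inl j) * q⁻¹)) / denom q u =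
      ((-q) ^ (l - 1)) ^ n /
        ∏ j : Fin n, (zOf u (Sum.inr i) - zOf u (Sum.inl j) * q⁻¹ ^ 2) := by
  have h1 : ∀ j : Fin n, (polyBErase q u i).eval (zOf u (Sum.inl j) * q⁻¹) = (-q) ^ (l - 1) *
      ∏ i' ∈ Finset.univ.erase i, (zOf u (Sum.inr i') - zOf u (Sum.inl j) * q⁻¹ ^ 2) := by
    intro j
    unfold polyBErase
    rw [eval_prod]
    have h2 : ∀ i' : Fin l, (X - C (zOf u (Sum.inr i') * q⁻¹⁻¹)).eval (zOf u (Sum.inl j) * q⁻¹) =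
        -q * (zOf u (Sum.inr i') - zOf u (Sum.inl j) * q⁻¹ ^ 2) := by
      intro i'
      rw [eval_sub, eval_X, eval_C]
      field_simp
      ring
    simp only [h2]
    rw [Finset.prod_mul_distrib, Finset.prod_const, Finset.card_erase_of_mem (Finset.mem_univ i),
      Finset.card_univ, Fintype.card_fin]
  have h3 : denom q u = (∏ j : Fin n, (zOf u (Sum.inr i) - zOf u (Sum.inl j) * q⁻¹ ^ 2)) *
      ∏ j : Fin n, ∏ i' ∈ Finset.univ.erase i,
        (zOf u (Sum.inr i') - zOf u (Sum.inl j) * q⁻¹ ^ 2) := by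
    rw [← Finset.prod_mul_distrib]
    exact Finset.prod_congr rfl fun j _ => (Finset.mul_prod_erase _ _ (Finset.mem_univ i)).symm
  have h4 : ∏ j : Fin n, ∏ i' ∈ Finset.univ.erase i,
      (zOf u (Sum.inr i') - zOf u (Sum.inl j) * q⁻¹ ^ 2) ≠ 0 :=
    Finset.prod_ne_zero_iff.2 fun j _ => Finset.prod_ne_zero_iff.2 fun i' _ =>
      sub_ne_zero.2 (hnv _ _)
  simp only [h1]
  rw [Finset.prod_mul_distrib, Finset.prod_const, Finset.card_univ, Fintype.card_fin, h3,
    mul_div_mul_right _ _ h4]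

variable (hq0 : q ≠ 0) (hq1 : ‖q‖ < 1) {u : Fin n ⊕ Fin l → ℂ} {Γ : Cycle}

/-- M, D, T and K enter through equations only, so that the same ones serve for u and for its images
under exchanges of z_i with a left variable. Besides u in the form, only w and the final product
then change. -/
theorem smirnovH_eq_vB (hnl : n < l) (hθ : IsTheta q L θ) (h : IsGood q u Γ) (hu : u ∈ xRegular θ)
    (hnv : ∀ s t, zOf u s ≠ zOf u t * q⁻¹ ^ 2) (i : Fin l) {M D : ℂ[X]} {T K : Fin n → ℂ[X]}
    (hM : M = polyA q u * (X - C (zOf u (Sum.inr i) * q⁻¹))) (hD : D = polyBErase q u i)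
    (hTK : ∀ k : Fin n, D * T k - M * K k = X ^ (k : ℕ)) :
    smirnovH q θ u = prefactor q n l * ((-q) ^ (l - 1)) ^ n *
      (thetaForm hq0 hq1 h hu fun k => vB q⁻¹ M D (T k) (K k) (zOf u (Sum.inr i) * q)) /
        ∏ j : Fin n, (zOf u (Sum.inr i) - zOf u (Sum.inl j) * q⁻¹ ^ 2) := by
  have hw : zOf u (Sum.inr i) * q * q⁻¹ ^ 2 = zOf u (Sum.inr i) * q⁻¹ := by field_simp
  rw [← hw] at hM
  subst hM hD
  rw [smirnovH_eq_baseVal hq0 hq1 hnl h hu,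
    baseVal_B (fun j : Fin n => zOf u (Sum.inl j) * q⁻¹) (inv_ne_zero hq0)
      (zOf u (Sum.inr i) * q) (by rw [polyB_eq q u i, inv_inv])
      (thetaForm_killsExact hq0 hq1 hθ h hu) hTK,
    div_mul_eq_mul_div, mul_div_assoc, mul_div_right_comm, prod_eval_polyBErase_div hq0 hnv i]
  unfold polyA
  ring

theorem smirnovH_shifted_eq_vB (hL : Complex.exp L = q) (hnl : n < l) (hθ : IsTheta q L θ)
    (h : IsGood q u Γ) (hu : u ∈ xRegular θ) (i : Fin l) {Γ' : Cycle} {u' : Fin n ⊕ Fin l → ℂ}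
    (huu' : u' = Function.update u (Sum.inr i) (u (Sum.inr i) - 4 * L)) (h' : IsGood q u' Γ')
    (hu' : u' ∈ xRegular θ) (hnv : ∀ s t, zOf u' s ≠ zOf u' t * q⁻¹ ^ 2)
    {M D : ℂ[X]} {T K : Fin n → ℂ[X]}
    (hM : M = polyA q u * (X - C (zOf u (Sum.inr i) * q⁻¹))) (hD : D = polyBErase q u i)
    (hTK : ∀ k : Fin n, D * T k - M * K k = X ^ (k : ℕ)) :
    smirnovH q θ u' = prefactor q n l * ((-q) ^ (l - 1)) ^ n *
      (thetaForm hq0 hq1 h hu fun k => vB q⁻¹ M D (T k) (K k) (zOf u (Sum.inr i) * q⁻¹)) /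
        ∏ j : Fin n, (zOf u (Sum.inr i) * q⁻¹ ^ 4 - zOf u (Sum.inl j) * q⁻¹ ^ 2) := by
  have hz := zOf_update u (Sum.inr i) (u (Sum.inr i) - 4 * L)
  rw [exp_sub_four_mul hL, ← huu'] at hz
  have hzi : zOf u' (Sum.inr i) = zOf u (Sum.inr i) * q⁻¹ ^ 4 := by
    rw [hz, Function.update_self]; rfl
  have hza : ∀ j : Fin n, zOf u' (Sum.inl j) = zOf u (Sum.inl j) := fun j => by
    rw [hz, Function.update_of_ne (by simp)]
  have hzb : ∀ i' ∈ Finset.univ.erase i, zOf u' (Sum.inr i') = zOf u (Sum.inr i') := fun i' hi' => by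
    rw [hz, Function.update_of_ne (by simpa using Finset.ne_of_mem_erase hi')]
  have hA : polyA q u' = polyA q u := by simp only [polyA, hza]
  have hD' : D = polyBErase q u' i := by
    rw [hD]
    exact Finset.prod_congr rfl fun i' hi' => by rw [hzb i' hi']
  have hw : zOf u (Sum.inr i) * q⁻¹ * q⁻¹ ^ 2 = zOf u (Sum.inr i) * q⁻¹ ^ 3 := by ring
  have hJ := thetaForm_shift hq0 hq1 hL hθ (Sum.inr i) h hu huu' h' hu'
  rw [← hw] at hJ
  rw [← hA] at hM
  have hB : polyB q u' = (X - C (zOf u (Sum.inr i) * q⁻¹ * q⁻¹ ^ 2)) * D := by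
    have e : zOf u (Sum.inr i) * q⁻¹ ^ 4 * q⁻¹⁻¹ = zOf u (Sum.inr i) * q⁻¹ * q⁻¹ ^ 2 := by
      field_simp
    rw [polyB_eq q u' i, hzi, hD', e]
  have hkey := baseVal_shifted_B (fun j : Fin n => zOf u' (Sum.inl j) * q⁻¹) (inv_ne_zero hq0)
    (zOf u (Sum.inr i) * q⁻¹) (D := D) (T := T) (K := K) hB
    (thetaForm_killsExact hq0 hq1 hθ h' hu') hJ (by intro k; rw [← hTK k, hM]; rfl)
  rw [smirnovH_eq_baseVal hq0 hq1 hnl h' hu', hkey, hD',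
    div_mul_eq_mul_div, mul_div_assoc, mul_div_right_comm, prod_eval_polyBErase_div hq0 hnv i, hzi,
    ← hD', hM]
  simp only [hza]
  unfold polyA
  simp only [hza]
  ring

lemma isCoprime_prod_X_sub_C {ι κ : Type*} {s : Finset ι} {t : Finset κ} {α : ι → ℂ} {β : κ → ℂ}
    (h : ∀ i ∈ s, ∀ j ∈ t, α i ≠ β j) :
    IsCoprime (∏ i ∈ s, (X - C (α i))) (∏ j ∈ t, (X - C (β j))) :=
  IsCoprime.prod_left fun i hi => IsCoprime.prod_right fun j hj =>
    isCoprime_X_sub_C_of_isUnit_sub (sub_ne_zero.2 (h i hi j hj)).isUnit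

lemma exists_mul_sub_mul_eq {A B : ℂ[X]} (h : IsCoprime A B) (n : ℕ) :
    ∃ T K : Fin n → ℂ[X], ∀ k : Fin n, A * T k - B * K k = X ^ (k : ℕ) := by
  obtain ⟨a, b, hab⟩ := h
  refine ⟨fun k => a * X ^ (k : ℕ), fun k => -b * X ^ (k : ℕ), fun k => ?_⟩
  linear_combination X ^ (k : ℕ) * hab

section

variable {ι κ : Type*} [DecidableEq ι] [DecidableEq κ] (z : ι ⊕ κ → ℂ)
  (i : κ) (j : ι)

lemma comp_swap_inr : (z ∘ Equiv.swap (Sum.inr i) (Sum.inl j)) (Sum.inr i) = z (Sum.inl j) := by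
  simp

lemma comp_swap_inl (k : ι) : (z ∘ Equiv.swap (Sum.inr i) (Sum.inl j)) (Sum.inl k) =
    if k = j then z (Sum.inr i) else z (Sum.inl k) := by
  split_ifs with h
  · subst h; simp
  · rw [Function.comp_apply, Equiv.swap_apply_of_ne_of_ne (by simp) (by simpa using h)]

lemma prod_comp_swap [Fintype ι] {R : Type*} [CommMonoid R] (f : ℂ → R) :
    ∏ k, f ((z ∘ Equiv.swap (Sum.inr i) (Sum.inl j)) (Sum.inl k)) =
      f (z (Sum.inr i)) * ∏ k ∈ Finset.univ.erase j, f (z (Sum.inl k)) := by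
  rw [← Finset.mul_prod_erase _ _ (Finset.mem_univ j)]
  congr 1
  · rw [comp_swap_inl, if_pos rfl]
  · refine Finset.prod_congr rfl fun k hk => ?_
    rw [comp_swap_inl, if_neg (Finset.ne_of_mem_erase hk)]

end

/-- All the values of `H` in the first equation in terms of one polynomial. -/
theorem exists_polynomial_smirnovH_B (hq0 : q ≠ 0) (hq1 : ‖q‖ < 1) (hL : Complex.exp L = q)
    (hnl : n < l) (hθ : IsTheta q L θ)
    (hu : u ∈ domain q θ) (i : Fin l)
    (hu' : Function.update u (Sum.inr i) (u (Sum.inr i) - 4 * L) ∈ domain q θ) :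
    ∃ (p : ℂ[X]) (c : ℂ), p.natDegree ≤ n ∧
      smirnovH q θ u = c * p.eval (zOf u (Sum.inr i) * q) /
        ∏ j : Fin n, (zOf u (Sum.inr i) - zOf u (Sum.inl j) * q⁻¹ ^ 2) ∧
      (∀ j : Fin n, smirnovH q θ (u ∘ Equiv.swap (Sum.inr i) (Sum.inl j)) =
        c * p.eval (zOf u (Sum.inl j) * q) /
          ((zOf u (Sum.inl j) - zOf u (Sum.inr i) * q⁻¹ ^ 2) *
            ∏ k ∈ Finset.univ.erase j, (zOf u (Sum.inl j) - zOf u (Sum.inl k) * q⁻¹ ^ 2))) ∧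
      smirnovH q θ (Function.update u (Sum.inr i) (u (Sum.inr i) - 4 * L)) =
        c * p.eval (zOf u (Sum.inr i) * q⁻¹) /
          ∏ j : Fin n, (zOf u (Sum.inr i) * q⁻¹ ^ 4 - zOf u (Sum.inl j) * q⁻¹ ^ 2) := by
  obtain ⟨Γ, h⟩ := exists_isGood hq0 hq1 hu
  obtain ⟨Γ', h'⟩ := exists_isGood hq0 hq1 hu'
  have hx := regularSet_subset hu.1
  have hnv : ∀ s t, zOf u s ≠ zOf u t * q⁻¹ ^ 2 := fun s t => hu.2 s t 0
  set M : ℂ[X] := polyA q u * (X - C (zOf u (Sum.inr i) * q⁻¹)) with hM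
  set D : ℂ[X] := polyBErase q u i with hD
  have hne : ∀ s t, zOf u s * q⁻¹⁻¹ ≠ zOf u t * q⁻¹ := by
    intro s t heq
    refine hnv s t (mul_right_cancel₀ hq0 ?_)
    rw [inv_inv] at heq
    rw [heq]
    field_simp
  have hcop : IsCoprime D M := by
    refine IsCoprime.mul_right ?_ ?_
    · exact isCoprime_prod_X_sub_C fun _ _ _ _ => hne _ _
    · have := isCoprime_prod_X_sub_C (s := Finset.univ.erase i) (t := {()})
        (α := fun i' : Fin l => zOf u (Sum.inr i') * q⁻¹⁻¹)
        (β := fun _ => zOf u (Sum.inr i) * q⁻¹) fun _ _ _ _ => hne _ _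
      rwa [Finset.prod_singleton] at this
  obtain ⟨T, K, hTK⟩ := exists_mul_sub_mul_eq hcop n
  -- Each of the n rows is affine in w, which gives the degree bound n.
  obtain ⟨p, hp, hpw⟩ := exists_polynomial_vB (thetaForm hq0 hq1 h hx) q⁻¹ M D T K
  refine ⟨p, prefactor q n l * ((-q) ^ (l - 1)) ^ n, hp, ?_, fun j => ?_, ?_⟩
  · rw [hpw]
    exact smirnovH_eq_vB hq0 hq1 hnl hθ h hx hnv i hM hD hTK
  -- The exchange preserves M, D and the form `thetaForm`; only the point w at which p is evaluated
  -- changes.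
  · set σ := Equiv.swap (Sum.inr i : Fin n ⊕ Fin l) (Sum.inl j) with hσ
    have h1 : M = polyA q (u ∘ σ) * (X - C (zOf (u ∘ σ) (Sum.inr i) * q⁻¹)) := by
      have e1 : polyA q (u ∘ σ) = (X - C (zOf u (Sum.inr i) * q⁻¹)) *
          ∏ k ∈ Finset.univ.erase j, (X - C (zOf u (Sum.inl k) * q⁻¹)) :=
        prod_comp_swap (zOf u) i j fun y => X - C (y * q⁻¹)
      have e2 : zOf (u ∘ σ) (Sum.inr i) = zOf u (Sum.inl j) := comp_swap_inr (zOf u) i j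
      have e3 : polyA q u = (X - C (zOf u (Sum.inl j) * q⁻¹)) *
          ∏ k ∈ Finset.univ.erase j, (X - C (zOf u (Sum.inl k) * q⁻¹)) :=
        (Finset.mul_prod_erase _ _ (Finset.mem_univ j)).symm
      rw [e1, e2, hM, e3]
      ring
    have h2 : D = polyBErase q (u ∘ σ) i := by
      refine Finset.prod_congr rfl fun i' hi' => ?_
      rw [zOf_comp, hσ, Equiv.swap_apply_of_ne_of_ne _ (by simp)]
      simpa using Finset.ne_of_mem_erase hi'
    rw [smirnovH_eq_vB hq0 hq1 hnl hθ (h.comp σ) (hθ.comp_mem hx σ) (fun s t => hnv (σ s) (σ t)) i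
      h1 h2 hTK, thetaForm_comp hq0 hq1 hθ h hx σ]
    have e2 : zOf (u ∘ σ) (Sum.inr i) = zOf u (Sum.inl j) := comp_swap_inr (zOf u) i j
    rw [e2, ← hpw]
    congr 1
    exact prod_comp_swap (zOf u) i j fun y => zOf u (Sum.inl j) - y * q⁻¹ ^ 2
  · rw [hpw]
    exact smirnovH_shifted_eq_vB hq0 hq1 hL hnl hθ h hx i rfl h' (regularSet_subset hu'.1)
      (fun s t => hu'.2 s t 0) hM hD hTK

end

end
end SmirnovIntegral

/-! ### Lagrange interpolation and the two equations. -/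

namespace SmirnovIntegral
open scoped BigOperators Topology
noncomputable section

open Polynomial

section

variable {n : ℕ}

/-- Lagrange interpolation with a distinguished node. -/
lemma eval_eq_lagrange_option {x₀ : ℂ} {x : Fin n → ℂ} (hx : Function.Injective x)
    (hx₀ : ∀ j, x₀ ≠ x j) {p : ℂ[X]} (hp : p.natDegree ≤ n) (y : ℂ) :
    p.eval y = p.eval x₀ * ∏ j, (y - x j) / (x₀ - x j) +
      ∑ j, p.eval (x j) * ((y - x₀) / (x j - x₀) *
        ∏ k ∈ Finset.univ.erase j, (y - x k) / (x j - x k)) := by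
  have hinj : Function.Injective fun o : Option (Fin n) => o.elim x₀ x := by
    rintro (_ | j) (_ | k) h
    · rfl
    · exact absurd h (hx₀ k)
    · exact absurd h.symm (hx₀ j)
    · exact congrArg some (hx h)
  rw [eval_eq_lagrange hinj (by simpa using Nat.lt_succ_of_le hp) y, Fintype.sum_option]
  congr 1
  · congr 1
    have : Finset.univ.erase (none : Option (Fin n)) = Finset.univ.map Function.Embedding.some := by
      ext o
      cases o <;> simp
    rw [this, Finset.prod_map]
    rfl
  · refine Finset.sum_congr rfl fun j _ => ?_
    congr 1
    have : Finset.univ.erase (some j : Option (Fin n)) =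
        insert none ((Finset.univ.erase j).map Function.Embedding.some) := by
      ext o
      cases o <;> simp
    rw [this, Finset.prod_insert (by simp), Finset.prod_map]
    rfl

variable {τ : ℂ} (hτ : τ ≠ 0) {a : Fin n → ℂ} {y : ℂ} (ha : Function.Injective a)
  (hy : ∀ j, y ≠ a j) {p : ℂ[X]} (c : ℂ)

-- Interpolation of p at the n + 1 nodes yτ⁻¹, a_jτ⁻¹, evaluated at yτ. With S = τⁿ/∏(yτ⁴ − a_jτ²),
-- the Lagrange weights times S are the coefficients of the equation divided by the denominators of
-- H.
include hτ ha hy in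
lemma lagrange_B (hp : p.natDegree ≤ n) (h1 : ∀ j, y ≠ a j * τ ^ 2) (h2 : ∀ j, a j ≠ y * τ ^ 2)
    (h3 : ∀ j k, a j ≠ a k * τ ^ 2) :
    τ ^ n * (c * p.eval (y * τ) / ∏ j, (y * τ ^ 4 - a j * τ ^ 2)) =
      (∏ j, (y - a j * τ ^ 2) / ((y - a j) * τ)) *
        (c * p.eval (y * τ⁻¹) / ∏ j, (y - a j * τ ^ 2)) -
      ∑ j, (1 - τ ^ 2) * y / ((y - a j) * τ) *
        (∏ k ∈ Finset.univ.erase j, (a j - a k * τ ^ 2) / ((a j - a k) * τ)) *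
        (c * p.eval (a j * τ⁻¹) / ((a j - y * τ ^ 2) *
          ∏ k ∈ Finset.univ.erase j, (a j - a k * τ ^ 2))) := by
  have d1 : ∀ j, y - a j ≠ 0 := fun j => sub_ne_zero.2 (hy j)
  have d2 : ∀ j, y - a j * τ ^ 2 ≠ 0 := fun j => sub_ne_zero.2 (h1 j)
  have d3 : ∀ j, y * τ ^ 2 - a j ≠ 0 := fun j => sub_ne_zero.2 (h2 j).symm
  have d4 : ∀ j k, a j - a k * τ ^ 2 ≠ 0 := fun j k => sub_ne_zero.2 (h3 j k)
  have d5 : ∀ j, ∀ k ∈ Finset.univ.erase j, a j - a k ≠ 0 := fun j k hk =>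
    sub_ne_zero.2 fun h => Finset.ne_of_mem_erase hk (ha h).symm
  set S : ℂ := ∏ j, (τ * (y * τ ^ 2 - a j))⁻¹ with hS
  have e0 : τ ^ n / ∏ j, (y * τ ^ 4 - a j * τ ^ 2) = S := by
    have : τ ^ n = ∏ _j : Fin n, τ := by simp
    rw [this, ← Finset.prod_div_distrib]
    refine Finset.prod_congr rfl fun j _ => ?_
    have : y * τ ^ 4 - a j * τ ^ 2 = τ ^ 2 * (y * τ ^ 2 - a j) := by ring
    rw [this]
    have := d3 j
    field_simp
  have e1 : S * ∏ j, (y * τ - a j * τ⁻¹) / (y * τ⁻¹ - a j * τ⁻¹) =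
      (∏ j, (y - a j * τ ^ 2) / ((y - a j) * τ)) / ∏ j, (y - a j * τ ^ 2) := by
    rw [hS, ← Finset.prod_mul_distrib, ← Finset.prod_div_distrib]
    refine Finset.prod_congr rfl fun j _ => ?_
    have t1 := d1 j
    have t2 : y - τ ^ 2 * a j ≠ 0 := by rw [mul_comm]; exact d2 j
    have t3 : τ ^ 2 * y - a j ≠ 0 := by rw [mul_comm]; exact d3 j
    have t4 : y * τ - a j * τ⁻¹ = (y * τ ^ 2 - a j) * τ⁻¹ := by field_simp
    have t5 : y * τ⁻¹ - a j * τ⁻¹ = (y - a j) * τ⁻¹ := by ring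
    rw [t4, t5]
    field_simp
  have e2 : ∀ j, S * ((y * τ - y * τ⁻¹) / (a j * τ⁻¹ - y * τ⁻¹) *
      ∏ k ∈ Finset.univ.erase j, (y * τ - a k * τ⁻¹) / (a j * τ⁻¹ - a k * τ⁻¹)) =
      -((1 - τ ^ 2) * y / ((y - a j) * τ) *
        (∏ k ∈ Finset.univ.erase j, (a j - a k * τ ^ 2) / ((a j - a k) * τ)) /
        ((a j - y * τ ^ 2) * ∏ k ∈ Finset.univ.erase j, (a j - a k * τ ^ 2))) := by
    intro j
    have f1 : S = (τ * (y * τ ^ 2 - a j))⁻¹ *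
        ∏ k ∈ Finset.univ.erase j, (τ * (y * τ ^ 2 - a k))⁻¹ :=
      (Finset.mul_prod_erase _ _ (Finset.mem_univ j)).symm
    have f2 : (∏ k ∈ Finset.univ.erase j, (τ * (y * τ ^ 2 - a k))⁻¹) *
        ∏ k ∈ Finset.univ.erase j, (y * τ - a k * τ⁻¹) / (a j * τ⁻¹ - a k * τ⁻¹) =
        (∏ k ∈ Finset.univ.erase j, (a j - a k * τ ^ 2) / ((a j - a k) * τ)) /
          ∏ k ∈ Finset.univ.erase j, (a j - a k * τ ^ 2) := by
      rw [← Finset.prod_mul_distrib, ← Finset.prod_div_distrib]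
      refine Finset.prod_congr rfl fun k hk => ?_
      have t1 := d5 j k hk
      have t2 : a j - τ ^ 2 * a k ≠ 0 := by rw [mul_comm]; exact d4 j k
      have t3 : τ ^ 2 * y - a k ≠ 0 := by rw [mul_comm]; exact d3 k
      have t4 : y * τ - a k * τ⁻¹ = (y * τ ^ 2 - a k) * τ⁻¹ := by field_simp
      have t5 : a j * τ⁻¹ - a k * τ⁻¹ = (a j - a k) * τ⁻¹ := by ring
      rw [t4, t5]
      field_simp
    have f3 : (τ * (y * τ ^ 2 - a j))⁻¹ * ((y * τ - y * τ⁻¹) / (a j * τ⁻¹ - y * τ⁻¹)) =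
        -((1 - τ ^ 2) * y / ((y - a j) * τ) / (a j - y * τ ^ 2)) := by
      have t1 := d1 j
      have t3 := d3 j
      have t4 : y * τ - y * τ⁻¹ = (y * τ ^ 2 - y) * τ⁻¹ := by field_simp
      have t5 : a j * τ⁻¹ - y * τ⁻¹ = -(y - a j) * τ⁻¹ := by ring
      have t6 : a j - y * τ ^ 2 = -(y * τ ^ 2 - a j) := by ring
      rw [t4, t5, t6]
      field_simp
      ring
    rw [f1, mul_mul_mul_comm, f2, f3, neg_mul, div_mul_div_comm]
  have hinj : Function.Injective fun j => a j * τ⁻¹ := fun j k h =>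
    ha (mul_right_cancel₀ (inv_ne_zero hτ) h)
  have key := eval_eq_lagrange_option hinj (x₀ := y * τ⁻¹)
    (fun j h => hy j (mul_right_cancel₀ (inv_ne_zero hτ) h)) hp (y * τ)
  have hL : τ ^ n * (c * p.eval (y * τ) / ∏ j, (y * τ ^ 4 - a j * τ ^ 2)) =
      c * (S * p.eval (y * τ)) := by
    rw [← e0]; ring
  rw [hL, key, mul_add, mul_left_comm S, e1, Finset.mul_sum, mul_add, Finset.mul_sum,
    sub_eq_add_neg ((∏ j, (y - a j * τ ^ 2) / ((y - a j) * τ)) * _), ← Finset.sum_neg_distrib]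
  congr 1
  · ring
  · refine Finset.sum_congr rfl fun j _ => ?_
    rw [mul_left_comm S, e2 j]
    ring

-- Since deg p ≤ n − 1, the polynomial X·p can be interpolated at the same n + 1 nodes. The extra
-- factor X replaces y by a_j in the coefficients of the sum and accounts for τ² on the left.
include hτ ha hy in
lemma lagrange_C (hp : p.natDegree + 1 ≤ n) (hy0 : y ≠ 0) (h1 : ∀ j, y ≠ a j * τ ^ 2)
    (h2 : ∀ j, a j ≠ y * τ ^ 2) (h3 : ∀ j k, a j ≠ a k * τ ^ 2) :
    τ ^ n * τ ^ 2 * (c * p.eval (y * τ) / ∏ j, (a j - y * τ ^ 2)) =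
      (∏ j, (y - a j * τ ^ 2) / ((y - a j) * τ)) *
        (c * p.eval (y * τ⁻¹) / ∏ j, (a j - y * τ⁻¹ ^ 2)) -
      ∑ j, (1 - τ ^ 2) * a j / ((y - a j) * τ) *
        (∏ k ∈ Finset.univ.erase j, (a j - a k * τ ^ 2) / ((a j - a k) * τ)) *
        (c * p.eval (a j * τ⁻¹) / ((y - a j * τ⁻¹ ^ 2) *
          ∏ k ∈ Finset.univ.erase j, (a k - a j * τ⁻¹ ^ 2))) := by
  have d1 : ∀ j, y - a j ≠ 0 := fun j => sub_ne_zero.2 (hy j)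
  have d2 : ∀ j, y - a j * τ ^ 2 ≠ 0 := fun j => sub_ne_zero.2 (h1 j)
  have d3 : ∀ j, a j - y * τ ^ 2 ≠ 0 := fun j => sub_ne_zero.2 (h2 j)
  have d4 : ∀ j k, a j - a k * τ ^ 2 ≠ 0 := fun j k => sub_ne_zero.2 (h3 j k)
  have d5 : ∀ j, ∀ k ∈ Finset.univ.erase j, a j - a k ≠ 0 := fun j k hk =>
    sub_ne_zero.2 fun h => Finset.ne_of_mem_erase hk (ha h).symm
  have g1 : ∀ x z : ℂ, x - z * τ⁻¹ ^ 2 = -(z - x * τ ^ 2) * τ⁻¹ ^ 2 := fun x z => by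
    field_simp
    ring
  set S : ℂ := ∏ j, (τ * (a j - y * τ ^ 2)⁻¹) with hS
  have e0 : τ ^ n / ∏ j, (a j - y * τ ^ 2) = S := by
    have : τ ^ n = ∏ _j : Fin n, τ := by simp
    rw [this, ← Finset.prod_div_distrib]
    rfl
  have e1 : S * ∏ j, (y * τ - a j * τ⁻¹) / (y * τ⁻¹ - a j * τ⁻¹) =
      (∏ j, (y - a j * τ ^ 2) / ((y - a j) * τ)) / ∏ j, (a j - y * τ⁻¹ ^ 2) := by
    rw [hS, ← Finset.prod_mul_distrib, ← Finset.prod_div_distrib]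
    refine Finset.prod_congr rfl fun j _ => ?_
    have t1 := d1 j
    have t2 : y - τ ^ 2 * a j ≠ 0 := by rw [mul_comm]; exact d2 j
    have t3 : a j - τ ^ 2 * y ≠ 0 := by rw [mul_comm]; exact d3 j
    have t4 : y * τ - a j * τ⁻¹ = -(a j - y * τ ^ 2) * τ⁻¹ := by field_simp; ring
    have t5 : y * τ⁻¹ - a j * τ⁻¹ = (y - a j) * τ⁻¹ := by ring
    rw [t4, t5, g1]
    field_simp
  have e2 : ∀ j, S * ((y * τ - y * τ⁻¹) / (a j * τ⁻¹ - y * τ⁻¹) *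
      ∏ k ∈ Finset.univ.erase j, (y * τ - a k * τ⁻¹) / (a j * τ⁻¹ - a k * τ⁻¹)) =
      -(y * ((1 - τ ^ 2) / ((y - a j) * τ) *
        (∏ k ∈ Finset.univ.erase j, (a j - a k * τ ^ 2) / ((a j - a k) * τ)) /
        ((y - a j * τ⁻¹ ^ 2) * ∏ k ∈ Finset.univ.erase j, (a k - a j * τ⁻¹ ^ 2)))) := by
    intro j
    have f1 : S = (τ * (a j - y * τ ^ 2)⁻¹) *
        ∏ k ∈ Finset.univ.erase j, (τ * (a k - y * τ ^ 2)⁻¹) :=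
      (Finset.mul_prod_erase _ _ (Finset.mem_univ j)).symm
    have f2 : (∏ k ∈ Finset.univ.erase j, (τ * (a k - y * τ ^ 2)⁻¹)) *
        ∏ k ∈ Finset.univ.erase j, (y * τ - a k * τ⁻¹) / (a j * τ⁻¹ - a k * τ⁻¹) =
        (∏ k ∈ Finset.univ.erase j, (a j - a k * τ ^ 2) / ((a j - a k) * τ)) /
          ∏ k ∈ Finset.univ.erase j, (a k - a j * τ⁻¹ ^ 2) := by
      rw [← Finset.prod_mul_distrib, ← Finset.prod_div_distrib]
      refine Finset.prod_congr rfl fun k hk => ?_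
      have t1 := d5 j k hk
      have t2 : a j - τ ^ 2 * a k ≠ 0 := by rw [mul_comm]; exact d4 j k
      have t3 : a k - τ ^ 2 * y ≠ 0 := by rw [mul_comm]; exact d3 k
      have t4 : y * τ - a k * τ⁻¹ = -(a k - y * τ ^ 2) * τ⁻¹ := by field_simp; ring
      have t5 : a j * τ⁻¹ - a k * τ⁻¹ = (a j - a k) * τ⁻¹ := by ring
      rw [t4, t5, g1]
      field_simp
    have f3 : (τ * (a j - y * τ ^ 2)⁻¹) * ((y * τ - y * τ⁻¹) / (a j * τ⁻¹ - y * τ⁻¹)) =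
        -(y * ((1 - τ ^ 2) / ((y - a j) * τ) / (y - a j * τ⁻¹ ^ 2))) := by
      have t1 := d1 j
      have t3 := d3 j
      have t4 : y * τ - y * τ⁻¹ = (y * τ ^ 2 - y) * τ⁻¹ := by field_simp
      have t5 : a j * τ⁻¹ - y * τ⁻¹ = -(y - a j) * τ⁻¹ := by ring
      rw [t4, t5, g1]
      field_simp
      ring
    rw [f1, mul_mul_mul_comm, f2, f3, neg_mul, mul_assoc, div_mul_div_comm]
  have hinj : Function.Injective fun j => a j * τ⁻¹ := fun j k h =>
    ha (mul_right_cancel₀ (inv_ne_zero hτ) h)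
  have hXp : (X * p).natDegree ≤ n :=
    natDegree_mul_le.trans (by rw [natDegree_X]; omega)
  have key := eval_eq_lagrange_option hinj (x₀ := y * τ⁻¹)
    (fun j h => hy j (mul_right_cancel₀ (inv_ne_zero hτ) h)) hXp (y * τ)
  simp only [eval_mul, eval_X] at key
  have hL : τ ^ n * τ ^ 2 * (c * p.eval (y * τ) / ∏ j, (a j - y * τ ^ 2)) =
      c * τ * y⁻¹ * (S * (y * τ * p.eval (y * τ))) := by
    rw [← e0]; field_simp
  rw [hL, key, mul_add, mul_left_comm S, e1, Finset.mul_sum, mul_add, Finset.mul_sum,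
    sub_eq_add_neg ((∏ j, (y - a j * τ ^ 2) / ((y - a j) * τ)) * _), ← Finset.sum_neg_distrib]
  congr 1
  · field_simp
  · refine Finset.sum_congr rfl fun j _ => ?_
    rw [mul_left_comm S, e2 j]
    generalize (∏ k ∈ Finset.univ.erase j, (a j - a k * τ ^ 2) / ((a j - a k) * τ)) = P
    generalize ((y - a j * τ⁻¹ ^ 2) * ∏ k ∈ Finset.univ.erase j, (a k - a j * τ⁻¹ ^ 2)) = Q
    have t1 : y⁻¹ * y = 1 := inv_mul_cancel₀ hy0
    have t2 : τ * τ⁻¹ = 1 := mul_inv_cancel₀ hτ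
    linear_combination (-(c * τ * τ⁻¹ * a j * p.eval (a j * τ⁻¹) *
      ((1 - τ ^ 2) / ((y - a j) * τ) * P / Q))) * t1 -
      (c * a j * p.eval (a j * τ⁻¹) * ((1 - τ ^ 2) / ((y - a j) * τ) * P / Q)) * t2

end

/-- The first reduced deformed cyclicity equation. -/
theorem equationB_smirnovH {q L : ℂ} (hq0 : q ≠ 0) (hq1 : ‖q‖ < 1) (hL : Complex.exp L = q)
    {n l : ℕ} (hnl : n < l) {θ : (Fin n → ℂ) → (Fin n ⊕ Fin l → ℂ) → ℂ} (hθ : IsTheta q L θ) :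
    EquationB q⁻¹ L (q⁻¹ ^ (-(n : ℤ))) (domain q θ) (smirnovH q θ) := by
  intro u i hu hu' hne hinj
  obtain ⟨p, c, hp, h1, h2, h3⟩ := exists_polynomial_smirnovH_B hq0 hq1 hL hnl hθ hu i hu'
  have hnv : ∀ s t, zOf u s ≠ zOf u t * q⁻¹ ^ 2 := fun s t => hu.2 s t 0
  have key := lagrange_B (inv_ne_zero hq0) hinj hne c hp (fun j => hnv _ _) (fun j => hnv _ _)
    (fun j k => hnv _ _)
  rw [inv_inv] at key
  rw [h1, h3, zpow_neg, inv_inv, zpow_natCast, key]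
  simp only [h2]

end
end SmirnovIntegral

namespace SmirnovIntegral
open scoped BigOperators Topology
noncomputable section

open Polynomial

/-! ### The second reduced cyclicity equation -/

section

variable {q L : ℂ} {m l : ℕ} {θ : (Fin (m + 1) → ℂ) → (Fin (m + 1) ⊕ Fin l → ℂ) → ℂ}

/-- The product `∏ (x - z_j τ)` over the left group without the `i`-th variable. -/
def polyAErase (q : ℂ) (u : Fin (m + 1) ⊕ Fin l → ℂ) (i : Fin (m + 1)) : ℂ[X] :=
  ∏ j : Fin m, (X - C (zOf u (Sum.inl (i.succAbove j)) * q⁻¹))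

lemma polyA_eq (q : ℂ) (u : Fin (m + 1) ⊕ Fin l → ℂ) (i : Fin (m + 1)) :
    polyA q u = (X - C (zOf u (Sum.inl i) * q⁻¹)) * polyAErase q u i :=
  Fin.prod_univ_succAbove _ i

/-- The part of the denominator of `H` which is symmetric in the right group and the `i`-th
variable. -/
def symmDenom (q : ℂ) (u : Fin (m + 1) ⊕ Fin l → ℂ) (i : Fin (m + 1)) : ℂ :=
  ∏ j : Fin m, (-q * ((zOf u (Sum.inl i) - zOf u (Sum.inl (i.succAbove j)) * q⁻¹ ^ 2) *
    ∏ k : Fin l, (zOf u (Sum.inr k) - zOf u (Sum.inl (i.succAbove j)) * q⁻¹ ^ 2)))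

lemma symmDenom_eq (hq0 : q ≠ 0) (u : Fin (m + 1) ⊕ Fin l → ℂ) (i : Fin (m + 1)) :
    symmDenom q u i =
      (∏ j : Fin m, (zOf u (Sum.inl (i.succAbove j)) * q⁻¹ - zOf u (Sum.inl i) * q)) *
        ∏ j : Fin m, ∏ k : Fin l,
          (zOf u (Sum.inr k) - zOf u (Sum.inl (i.succAbove j)) * q⁻¹ ^ 2) := by
  unfold symmDenom
  rw [← Finset.prod_mul_distrib]
  refine Finset.prod_congr rfl fun j _ => ?_
  rw [← mul_assoc]
  congr 1
  field_simp
  ring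

lemma denom_eq (q : ℂ) (u : Fin (m + 1) ⊕ Fin l → ℂ) (i : Fin (m + 1)) :
    denom q u = (∏ k : Fin l, (zOf u (Sum.inr k) - zOf u (Sum.inl i) * q⁻¹ ^ 2)) *
      ∏ j : Fin m, ∏ k : Fin l,
        (zOf u (Sum.inr k) - zOf u (Sum.inl (i.succAbove j)) * q⁻¹ ^ 2) :=
  Fin.prod_univ_succAbove _ i

lemma prod_sub_ne_zero (hq0 : q ≠ 0) {u : Fin (m + 1) ⊕ Fin l → ℂ}
    (hnv : ∀ s t, zOf u s ≠ zOf u t * q⁻¹ ^ 2) (i : Fin (m + 1)) :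
    ∏ j : Fin m, (zOf u (Sum.inl (i.succAbove j)) * q⁻¹ - zOf u (Sum.inl i) * q) ≠ 0 := by
  refine Finset.prod_ne_zero_iff.2 fun j _ => sub_ne_zero.2 fun h => ?_
  refine hnv (Sum.inl i) (Sum.inl (i.succAbove j)) (mul_right_cancel₀ hq0 ?_)
  rw [← h]
  field_simp

/-- The polynomials in the unified expression of the forms for the second equation. -/
def rowC (q : ℂ) (M D : ℂ[X]) (Q : ℂ → ℂ[X]) (w : ℂ) : Fin (m + 1) → ℂ[X] :=
  Matrix.vecCons ((X - C w) * (D * dq (q⁻¹ ^ 2)⁻¹ (Q w))) fun k : Fin m =>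
    vC q⁻¹ M D ((M * X ^ (k : ℕ)) /ₘ D) (X ^ (k : ℕ)) w

variable (hq0 : q ≠ 0) (hq1 : ‖q‖ < 1) {u : Fin (m + 1) ⊕ Fin l → ℂ} {Γ : Cycle}

/-- M, D and `symmDenom` are unchanged when the `i`-th left variable is exchanged with a right one;
the dependence on the singled-out variable is confined to w and the last product. -/
theorem smirnovH_eq_rowC (hnl : m + 1 < l) (hθ : IsTheta q L θ) (h : IsGood q u Γ)
    (hu : u ∈ xRegular θ) (hnv : ∀ s t, zOf u s ≠ zOf u t * q⁻¹ ^ 2) (i : Fin (m + 1))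
    {M D : ℂ[X]} {Q : ℂ → ℂ[X]} (hM : M = polyB q u * (X - C (zOf u (Sum.inl i) * q)))
    (hD : D = polyAErase q u i)
    (hQ : ∀ w, (M /ₘ D - (X - C w) * (X - C (w * q⁻¹⁻¹ ^ 2)) * Q w).natDegree ≤ 1) :
    smirnovH q θ u = prefactor q (m + 1) l / symmDenom q u i *
      (thetaForm hq0 hq1 h hu (rowC q M D Q (zOf u (Sum.inl i) * q⁻¹))) /
        ∏ k : Fin l, (zOf u (Sum.inr k) - zOf u (Sum.inl i) * q⁻¹ ^ 2) := by
  have hw : zOf u (Sum.inl i) * q⁻¹ * q⁻¹⁻¹ ^ 2 = zOf u (Sum.inl i) * q := by field_simp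
  have hM' : M = polyB q u * (X - C (zOf u (Sum.inl i) * q⁻¹ * q⁻¹⁻¹ ^ 2)) := by rw [hw, hM]
  subst hD
  have key := baseVal_C (fun j : Fin m => zOf u (Sum.inl (i.succAbove j)) * q⁻¹)
    (inv_ne_zero hq0) (zOf u (Sum.inl i) * q⁻¹) (B := polyB q u) (M := M)
    (monic_prod_X_sub_C' fun j : Fin (m + 1) => zOf u (Sum.inl j) * q⁻¹) (polyA_eq q u i) hM'
    (thetaForm_killsExact hq0 hq1 hθ h hu) (hQ _)
  have h0 := prod_sub_ne_zero hq0 hnv i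
  simp only [hw] at key
  rw [smirnovH_eq_baseVal hq0 hq1 hnl h hu, denom_eq q u i, symmDenom_eq hq0]
  change _ = _ * (thetaForm hq0 hq1 h hu (Matrix.vecCons _ _)) / _
  unfold polyAErase
  rw [key]
  generalize baseVal _ _ _ _ = β
  generalize ∏ j : Fin m, (zOf u (Sum.inl (i.succAbove j)) * q⁻¹ - zOf u (Sum.inl i) * q) = π at h0 ⊢
  rw [div_mul_eq_mul_div, div_mul_eq_mul_div, div_div, mul_left_comm, mul_assoc π,
    mul_div_mul_left _ _ h0]
  congr 1
  ring

theorem smirnovH_shifted_eq_rowC (hL : Complex.exp L = q) (hnl : m + 1 < l) (hθ : IsTheta q L θ)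
    (h : IsGood q u Γ) (hu : u ∈ xRegular θ) (hnv : ∀ s t, zOf u s ≠ zOf u t * q⁻¹ ^ 2)
    (i : Fin (m + 1)) {Γ' : Cycle} {u' : Fin (m + 1) ⊕ Fin l → ℂ}
    (huu' : u' = Function.update u (Sum.inl i) (u (Sum.inl i) + 4 * L)) (h' : IsGood q u' Γ')
    (hu' : u' ∈ xRegular θ)
    {M D : ℂ[X]} {Q : ℂ → ℂ[X]} (hM : M = polyB q u * (X - C (zOf u (Sum.inl i) * q)))
    (hD : D = polyAErase q u i)
    (hQ : ∀ w, (M /ₘ D - (X - C w) * (X - C (w * q⁻¹⁻¹ ^ 2)) * Q w).natDegree ≤ 1) :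
    smirnovH q θ u' = prefactor q (m + 1) l / symmDenom q u i *
      (thetaForm hq0 hq1 h hu (rowC q M D Q (zOf u (Sum.inl i) * q))) /
        ∏ k : Fin l, (zOf u (Sum.inr k) - zOf u (Sum.inl i) * q ^ 2) := by
  -- The second equation divides by τ⁴, so `thetaForm_shift` is applied from u' to u.
  have hback : u = Function.update u' (Sum.inl i) (u' (Sum.inl i) - 4 * L) := by
    rw [huu']
    simp
  have hz := zOf_update u' (Sum.inl i) (u' (Sum.inl i) - 4 * L)
  rw [exp_sub_four_mul hL, ← hback] at hz
  have hzi : zOf u' (Sum.inl i) = zOf u (Sum.inl i) * q ^ 4 := by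
    rw [hz, Function.update_self]
    unfold zOf
    field_simp
  have hza : ∀ j : Fin m, zOf u' (Sum.inl (i.succAbove j)) = zOf u (Sum.inl (i.succAbove j)) :=
    fun j => by rw [hz, Function.update_of_ne (by simp)]
  have hzb : ∀ k, zOf u' (Sum.inr k) = zOf u (Sum.inr k) := fun k => by
    rw [hz, Function.update_of_ne (by simp)]
  have hB : polyB q u' = polyB q u := by simp only [polyB, hzb]
  have hw : zOf u (Sum.inl i) * q * q⁻¹⁻¹ ^ 2 = zOf u (Sum.inl i) * q ^ 4 * q⁻¹ := by field_simp
  have hw3 : zOf u' (Sum.inl i) * q⁻¹ ^ 3 = zOf u (Sum.inl i) * q := by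
    rw [hzi]; field_simp
  have hw1 : zOf u' (Sum.inl i) * q⁻¹ = zOf u (Sum.inl i) * q * q⁻¹⁻¹ ^ 2 := by rw [hzi, hw]
  have hJ := fun G => (thetaForm_shift hq0 hq1 hL hθ (Sum.inl i) h' hu' hback h hu G).symm
  rw [hw3, hw1] at hJ
  have hA : polyA q u' = (X - C (zOf u (Sum.inl i) * q * q⁻¹⁻¹ ^ 2)) * polyAErase q u i := by
    rw [polyA_eq q u' i, hw1]
    simp only [polyAErase, hza]
  rw [← hB] at hM
  subst hD
  have key := baseVal_shifted_C (fun j : Fin m => zOf u (Sum.inl (i.succAbove j)) * q⁻¹)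
    (inv_ne_zero hq0) (zOf u (Sum.inl i) * q) (B := polyB q u') (M := M)
    (monic_prod_X_sub_C' fun j : Fin (m + 1) => zOf u' (Sum.inl j) * q⁻¹) hA hM
    (thetaForm_killsExact hq0 hq1 hθ h' hu') hJ (hQ _)
  have h0 := prod_sub_ne_zero hq0 hnv i
  rw [smirnovH_eq_baseVal hq0 hq1 hnl h' hu', denom_eq q u' i, symmDenom_eq hq0]
  change _ = _ * (thetaForm hq0 hq1 h hu (Matrix.vecCons _ _)) / _
  unfold polyAErase
  rw [key]
  have e : ∀ k, zOf u (Sum.inr k) - zOf u (Sum.inl i) * q ^ 4 * q⁻¹ ^ 2 =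
      zOf u (Sum.inr k) - zOf u (Sum.inl i) * q ^ 2 := fun k => by
    congr 1
    field_simp
  simp only [hza, hzb, hzi, e]
  generalize baseVal _ _ _ _ = β
  generalize ∏ j : Fin m, (zOf u (Sum.inl (i.succAbove j)) * q⁻¹ - zOf u (Sum.inl i) * q) = π at h0 ⊢
  rw [div_mul_eq_mul_div, div_mul_eq_mul_div, div_div, mul_left_comm, mul_assoc π,
    mul_div_mul_left _ _ h0]
  congr 1
  ring

section

variable {ι κ : Type*} [DecidableEq ι] [DecidableEq κ] (z : ι ⊕ κ → ℂ) (i : ι) (j : κ)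

lemma comp_swap_inl' : (z ∘ Equiv.swap (Sum.inl i) (Sum.inr j)) (Sum.inl i) = z (Sum.inr j) := by
  simp

lemma prod_comp_swap' [Fintype κ] {R : Type*} [CommMonoid R] (f : ℂ → R) :
    ∏ k, f ((z ∘ Equiv.swap (Sum.inl i) (Sum.inr j)) (Sum.inr k)) =
      f (z (Sum.inl i)) * ∏ k ∈ Finset.univ.erase j, f (z (Sum.inr k)) := by
  rw [← Finset.mul_prod_erase _ _ (Finset.mem_univ j)]
  congr 1
  · simp
  · refine Finset.prod_congr rfl fun k hk => ?_
    rw [Function.comp_apply, Equiv.swap_apply_of_ne_of_ne (by simp)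
      (by simpa using Finset.ne_of_mem_erase hk)]

lemma mul_prod_comp_swap' [Fintype κ] {R : Type*} [CommMonoid R] (f : ℂ → R) :
    f ((z ∘ Equiv.swap (Sum.inl i) (Sum.inr j)) (Sum.inl i)) *
        ∏ k, f ((z ∘ Equiv.swap (Sum.inl i) (Sum.inr j)) (Sum.inr k)) =
      f (z (Sum.inl i)) * ∏ k, f (z (Sum.inr k)) := by
  rw [prod_comp_swap', comp_swap_inl', mul_left_comm,
    Finset.mul_prod_erase _ (fun k => f (z (Sum.inr k))) (Finset.mem_univ j)]

end

/-- All the values of `H` in the second equation in terms of one polynomial. -/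
theorem exists_polynomial_smirnovH_C (hq0 : q ≠ 0) (hq1 : ‖q‖ < 1) (hL : Complex.exp L = q)
    (hnl : m + 1 < l) (hθ : IsTheta q L θ) (hu : u ∈ domain q θ) (i : Fin (m + 1))
    (hu' : Function.update u (Sum.inl i) (u (Sum.inl i) + 4 * L) ∈ domain q θ) :
    ∃ (p : ℂ[X]) (c : ℂ), p.natDegree + 1 ≤ l ∧
      smirnovH q θ u = c * p.eval (zOf u (Sum.inl i) * q⁻¹) /
        ∏ j : Fin l, (zOf u (Sum.inr j) - zOf u (Sum.inl i) * q⁻¹ ^ 2) ∧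
      (∀ j : Fin l, smirnovH q θ (u ∘ Equiv.swap (Sum.inl i) (Sum.inr j)) =
        c * p.eval (zOf u (Sum.inr j) * q⁻¹) /
          ((zOf u (Sum.inl i) - zOf u (Sum.inr j) * q⁻¹ ^ 2) *
            ∏ k ∈ Finset.univ.erase j, (zOf u (Sum.inr k) - zOf u (Sum.inr j) * q⁻¹ ^ 2))) ∧
      smirnovH q θ (Function.update u (Sum.inl i) (u (Sum.inl i) + 4 * L)) =
        c * p.eval (zOf u (Sum.inl i) * q) /
          ∏ j : Fin l, (zOf u (Sum.inr j) - zOf u (Sum.inl i) * q ^ 2) := by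
  obtain ⟨Γ, h⟩ := exists_isGood hq0 hq1 hu
  obtain ⟨Γ', h'⟩ := exists_isGood hq0 hq1 hu'
  have hx := regularSet_subset hu.1
  have hnv : ∀ s t, zOf u s ≠ zOf u t * q⁻¹ ^ 2 := fun s t => hu.2 s t 0
  obtain ⟨M, hM⟩ : ∃ M, M = polyB q u * (X - C (zOf u (Sum.inl i) * q)) := ⟨_, rfl⟩
  obtain ⟨D, hD⟩ : ∃ D, D = polyAErase q u i := ⟨_, rfl⟩
  -- The quotient has degree at most (l + 1) − m = e + 2 with e = l − (m + 1). The first row has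
  -- degree at most e in w and the other m rows at most 1, so p has degree at most e + m = l − 1.
  have hdeg : (M /ₘ D).natDegree ≤ (l - (m + 1)) + 2 := by
    have h1 : M.natDegree ≤ l + 1 := by
      rw [hM]
      refine natDegree_mul_le.trans ?_
      rw [natDegree_X_sub_C]
      exact Nat.add_le_add_right (natDegree_prod_X_sub_C _).le 1
    have h2 : D.natDegree = m := by
      rw [hD]
      exact natDegree_prod_X_sub_C _
    have h3 : D.Monic := by
      rw [hD]
      exact monic_prod_X_sub_C' _
    rw [natDegree_divByMonic _ h3]
    omega
  obtain ⟨Q, hQ, hQ'⟩ := exists_quotient (q⁻¹⁻¹ ^ 2) (q⁻¹ ^ 2)⁻¹ D (M /ₘ D) _ hdeg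
  have hQ'' : ∀ w, (M /ₘ D - (X - C w) * (X - C (w * q⁻¹⁻¹ ^ 2)) * Q w).natDegree ≤ 1 := hQ'
  obtain ⟨p, hp, hpw⟩ := exists_polynomial_vC (thetaForm hq0 hq1 h hx) q⁻¹ M D
    (fun k => (M * X ^ (k : ℕ)) /ₘ D) (fun k => X ^ (k : ℕ)) hQ
  have hpw' : ∀ w, p.eval w = thetaForm hq0 hq1 h hx (rowC q M D Q w) := hpw
  refine ⟨p, prefactor q (m + 1) l / symmDenom q u i, by omega, ?_, fun j => ?_, ?_⟩
  · rw [hpw']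
    exact smirnovH_eq_rowC hq0 hq1 hnl hθ h hx hnv i hM hD hQ''
  · set σ := Equiv.swap (Sum.inl i : Fin (m + 1) ⊕ Fin l) (Sum.inr j) with hσ
    have e2 : zOf (u ∘ σ) (Sum.inl i) = zOf u (Sum.inr j) := comp_swap_inl' (zOf u) i j
    have e3 : ∀ k, zOf (u ∘ σ) (Sum.inl (i.succAbove k)) = zOf u (Sum.inl (i.succAbove k)) :=
      fun k => by
        rw [zOf_comp, hσ, Equiv.swap_apply_of_ne_of_ne (by simp)
          (by simp)]
    have h1 : M = polyB q (u ∘ σ) * (X - C (zOf (u ∘ σ) (Sum.inl i) * q)) := by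
      have := mul_prod_comp_swap' (zOf u) i j fun y => X - C (y * q⁻¹⁻¹)
      simp only [inv_inv] at this
      rw [hM, mul_comm, mul_comm (polyB _ _)]
      unfold polyB
      simp only [inv_inv]
      exact this.symm
    have h2 : D = polyAErase q (u ∘ σ) i := by
      rw [hD]
      simp only [polyAErase, e3]
    have h3 : symmDenom q (u ∘ σ) i = symmDenom q u i := by
      unfold symmDenom
      refine Finset.prod_congr rfl fun k _ => ?_
      rw [e3]
      congr 1
      exact mul_prod_comp_swap' (zOf u) i j fun y => y - zOf u (Sum.inl (i.succAbove k)) * q⁻¹ ^ 2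
    rw [smirnovH_eq_rowC hq0 hq1 hnl hθ (h.comp σ) (hθ.comp_mem hx σ)
      (fun s t => hnv (σ s) (σ t)) i h1 h2 hQ'', thetaForm_comp hq0 hq1 hθ h hx σ, h3, e2, ← hpw']
    congr 1
    exact prod_comp_swap' (zOf u) i j fun y => y - zOf u (Sum.inr j) * q⁻¹ ^ 2
  · rw [hpw']
    exact smirnovH_shifted_eq_rowC hq0 hq1 hL hnl hθ h hx hnv i rfl h' (regularSet_subset hu'.1)
      hM hD hQ''

end

/-- The second reduced deformed cyclicity equation. -/
theorem equationC_smirnovH {q L : ℂ} (hq0 : q ≠ 0) (hq1 : ‖q‖ < 1) (hL : Complex.exp L = q)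
    {n l : ℕ} (hnl : n < l) {θ : (Fin n → ℂ) → (Fin n ⊕ Fin l → ℂ) → ℂ} (hθ : IsTheta q L θ) :
    EquationC q⁻¹ L (q⁻¹ ^ (-(l : ℤ))) (domain q θ) (smirnovH q θ) := by
  intro u i hu hu' hne hinj
  obtain ⟨m, rfl⟩ : ∃ m, n = m + 1 := ⟨n - 1, by have := i.2; omega⟩
  obtain ⟨p, c, hp, h1, h2, h3⟩ := exists_polynomial_smirnovH_C hq0 hq1 hL hnl hθ hu i hu'
  have hnv : ∀ s t, zOf u t ≠ zOf u s * q ^ 2 := fun s t heq => by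
    refine hu.2 s t 0 ?_
    rw [heq, mul_zero, add_zero]
    field_simp
  -- Here the base of `lagrange_C` is q = τ⁻¹: the nodes are z_jτ and the evaluation point is yτ⁻¹.
  have key := lagrange_C hq0 hinj hne c hp (zOf_ne_zero u _) (fun j => hnv _ _) (fun j => hnv _ _)
    (fun j k => hnv _ _)
  rw [h1, h3, zpow_neg, zpow_natCast, ← inv_pow]
  simp only [h2, inv_inv]
  exact key

end
end SmirnovIntegral

/-- Independence of the contour is expressed by one function H serving all contours. Its
construction from good cycles makes holomorphy and both equations available on all of `domain`. -/
theorem mainTheorem1 (q L : ℂ) (hq0 : 0 < ‖q‖) (hq1 : ‖q‖ < 1) (hL : Complex.exp L = q)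
    (n l : ℕ) (hnl : n < l)
    (θ : (Fin n → ℂ) → (Fin n ⊕ Fin l → ℂ) → ℂ) (hθ : SmirnovIntegral.IsTheta q L θ) :
    ∃ H : (Fin n ⊕ Fin l → ℂ) → ℂ,
      -- `H` is the integral, for every admissible contour, and is holomorphic in `u = log z`
      (∀ u ∈ SmirnovIntegral.domain q θ, ∀ γ : ℝ → ℂ,
        SmirnovIntegral.IsContour q (SmirnovIntegral.zOf u) γ →
          H u = SmirnovIntegral.smirnovIntegral q θ γ u) ∧
      DifferentiableOn ℂ H (SmirnovIntegral.domain q θ) ∧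
      -- `H` is symmetric in each of the two groups of variables
      (∀ u ∈ SmirnovIntegral.domain q θ, ∀ (σ : Equiv.Perm (Fin n)) (ρ : Equiv.Perm (Fin l)),
        H (u ∘ Equiv.sumCongr σ ρ) = H u) ∧
      SmirnovIntegral.EquationB q⁻¹ L (q⁻¹ ^ (-(n : ℤ))) (SmirnovIntegral.domain q θ) H ∧
      SmirnovIntegral.EquationC q⁻¹ L (q⁻¹ ^ (-(l : ℤ))) (SmirnovIntegral.domain q θ) H := by
  have h0 : q ≠ 0 := norm_pos_iff.1 hq0
  exact ⟨SmirnovIntegral.smirnovH q θ,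
    fun u hu γ hγ => SmirnovIntegral.smirnovH_eq_contour h0 hq1 hnl hu hγ,
    SmirnovIntegral.differentiableOn_smirnovH h0 hq1,
    fun u hu σ ρ => SmirnovIntegral.smirnovH_comp h0 hq1 hθ hu σ ρ,
    SmirnovIntegral.equationB_smirnovH h0 hq1 hL hnl hθ,
    SmirnovIntegral.equationC_smirnovH h0 hq1 hL hnl hθ⟩
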